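/- Let $\mathbf k$ be a field. **Filtered complexes.** A filtered cochain complex is a $\mathbb Z$-graded $\mathbf k$-vector space $X=\bigoplus_n X^n$ with a differential $\partial$ of degree $1$ and a function $\ell:X\to\mathbb R\cup\{-\infty\}$ with $\ell(\lambda a+b)\le\max\{\ell(a),\ell(b)\}$ for $\lambda\ne0$, $\ell(a)=-\infty\iff a=0$, $\ell(\partial a)\le\ell(a)$, and such that each $X^{\le r}=\{\ell\le r\}$ is a graded subspace. $X[d]$ denotes the complex with $X[d]^n=X^{n-d}$ and differential $(-1)^d\partial$. **Filtered dg-categories.** In a filtered dg-category $\mathcal A$ each $\mathrm{Hom}(A,B)$ is a filtered cochain complex, composition is bilinear, associative, of degree $0$, satisfies the Leibniz rule $d(g\circ f)=dg\circ f+(-1)^{|g|}g\circ df$ and $\ell(g\circ f)\le\ell(g)+\ell(f)$, and the identities are closed of degree $0$ with $\ell(\mathbb 1_A)\le 0$ (equivalently $\ell(\mathbb 1_A)=0$ unless $\mathbb 1_A=0$). Its shift completion $\Sigma\mathcal A$ has objects $\Sigma^rA[d]$ ($A\in\mathcal A$, $r\in\mathbb R$, $d\in\mathbb Z$), and $\mathrm{Hom}(\Sigma^rA[a],\Sigma^sB[b])$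 is $\mathrm{Hom}(A,B)$ with degrees raised by $b-a$, differential $(-1)^b d$ and filtration function $\ell+s-r$. Objects of $\mathrm{Tw}(\mathcal A)$ are filtered one-sided twisted complexes: finite (possibly empty) lists $X_1,\dots,X_n$ of objects of $\Sigma\mathcal A$ with $q_{ij}\in\mathrm{Hom}(X_j,X_i)$ of degree $1$, $q_{ij}=0$ for $i\ge j$, $dq_{ij}+\sum_kq_{ik}q_{kj}=0$ and $\ell(q_{ij})\le0$. Morphisms are matrices over $\Sigma\mathcal A$, with matrix multiplication, differential $Df=df+q'f-(-1)^{|f|}fq$ and $\ell(f)=\max_{ij}\ell(f_{ij})$. One has $\mathcal A\hookrightarrow\mathrm{Tw}(\mathcal A)$ (one summand, $r=d=0$, $q=0$); $\mathcal A$ is *filtered pre-triangulated* if this is an equivalence of filtered dg-categories, that is (being an isomorphism of filtered complexes on morphisms) every object of $\mathrm{Tw}(\mathcal A)$ is isomorphic to one of $\mathcal A$ by mutually inverse closed degree-$0$ morphisms with $\ell\le0$. **Triangulated persistence categories.** A persistence category $\mathcal C$ has persistence $\mathbf k$-modules $r\mapsto\mathrm{Mor}^r(A,B)$ ($r\in\mathbb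 R$, structure maps $i_{r,s}$) as morphisms, with bilinear associative compositions $\mathrm{Mor}^r(A,B)\times\mathrm{Mor}^s(B,C)\to\mathrm{Mor}^{r+s}(A,C)$ compatible with the structure maps, and identities in $\mathrm{Mor}^0(A,A)$; its $0$-level $\mathcal C_0$ has the morphisms of shift $0$; $K$ is $r$-acyclic if $i_{0,r}(\mathbb 1_K)=0$. A shift functor on $\mathcal C$ is a monoidal functor $\Sigma:(\mathbb R,+)\to\mathcal P\mathrm{End}(\mathcal C)$ to the persistence endofunctors, where $\mathbb R$ has exactly one morphism $r\to s$ for all $r,s$, sent to a natural transformation $\eta_{r,s}:\Sigma^r\to\Sigma^s$ of shift $s-r$. A triangulated persistence category (TPC) is a persistence category with a shift functor such that (i) $\mathcal C_0$ is triangulated, and the functors $\mathrm{Mor}^r$ split, compatibly with the structure maps, over finite direct sums of $\mathcal C_0$ in each variable; (ii) each $\Sigma^r$ restricts to a triangulated functor on $\mathcal C_0$; (iii) for $r\ge0$ the morphism $\eta_r^A=i_{-r,0}((\eta_{r,0})_A):\Sigma^rA\to\Sigma^0A\cong A$ embeds into an exact triangle $\Sigma^rA\to A\to K\to T\Sigma^rA$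 of $\mathcal C_0$ with $K$ $r$-acyclic. The TPC is *strict* if $\Sigma$ is a strict monoidal functor, the translation $T$ is an automorphism of $\mathcal C_0$, and $T$ and all $\Sigma^r$ commute strictly. For a filtered dg-category $\mathcal A$, $H^0(\mathcal A)$ is the persistence category with the objects of $\mathcal A$ and $\mathrm{Mor}^r(A,B)=H^0(\mathrm{Hom}^{\le r}(A,B))$. **Theorem.** 1. For every filtered dg-category $\mathcal A$, $H^0(\mathrm{Tw}(\mathcal A))$ is a strict TPC. More precisely it is one with the shift functor $(\bigoplus_i\Sigma^{r_i}A_i[d_i],q)\mapsto(\bigoplus_i\Sigma^{r_i+r}A_i[d_i],q)$ whose $\eta_{r,s}$ are induced by identities, with the translation $T(\bigoplus_i\Sigma^{r_i}A_i[d_i],q)=(\bigoplus_i\Sigma^{r_i}A_i[d_i-1],-q)$, $f\mapsto f$, and with exact triangles those isomorphic to the triangles $X\xrightarrow{f}Y\to\mathrm{Cone}^0(f)\to TX$ for closed degree-$0$ morphisms $f$ with $\ell(f)\le0$, where $\mathrm{Cone}^0(f)=\left(Y\oplus TX,\begin{pmatrix}q_Y&f\\0&-q_X\end{pmatrix}\right)$,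 with the evident inclusion and projection. 2. If $\mathcal A$ is filtered pre-triangulated, then $H^0(\mathcal A)$ is a TPC. 3. The filtered dg-category $\mathcal{FK}_{\mathbf k}$ of filtered cochain complexes over $\mathbf k$ is filtered pre-triangulated, where $\mathrm{Hom}(X,Y)$ consists of the finite sums of homogeneous linear maps of finite $\ell(f)=\inf\{r\mid\ell_Y(f(x))\le\ell_X(x)+r\ \forall x\}$ (with $\ell(0)=-\infty$), with differential $f\mapsto\partial_Yf-(-1)^{|f|}f\partial_X$; and $H^0(\mathcal{FK}_{\mathbf k})$ is a strict TPC with $\Sigma^r(X,\partial,\ell)=(X,\partial,\ell+r)$, with $\eta_{r,s}$ induced by the identity maps, and with $TX=X[-1]$. -/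

import Mathlib

open CategoryTheory

universe w u v

noncomputable section

/-- A filtered cochain complex over the field `k`, written as its total space `X`, a `k`-module
with an internal `ℤ`-grading `deg`, together with a differential `d` of degree `1` and a
filtration function `ℓ : X → ℝ ∪ {-∞}`.  The last axiom says that each `{x | ℓ x ≤ r}` is a
*graded* subspace, so that it is again a cochain complex. -/
structure FilteredComplex (k : Type w) [Field k] where
  X : Type v
  [acg : AddCommGroup X]
  [mod : Module k X]
  deg : ℤ → Submodule k X
  internal : DirectSum.IsInternal deg
  d : X →ₗ[k] X
  d_deg : ∀ {n : ℤ} {x : X}, x ∈ deg n → d x ∈ deg (n + 1)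
  d_d : ∀ x, d (d x) = 0
  ℓ : X → WithBot ℝ
  ℓ_smul_add : ∀ (c : k) (x y : X), c ≠ 0 → ℓ (c • x + y) ≤ max (ℓ x) (ℓ y)
  ℓ_eq_bot : ∀ x, ℓ x = ⊥ ↔ x = 0
  ℓ_d : ∀ x, ℓ (d x) ≤ ℓ x
  ℓ_component : ∀ c : ℤ →₀ X, (∀ n, c n ∈ deg n) → ∀ n, ℓ (c n) ≤ ℓ (c.sum fun _ x => x)

namespace FilteredComplex

attribute [instance] acg mod

variable {k : Type w} [Field k] (C : FilteredComplex.{w, v} k)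

theorem bijective_coe : Function.Bijective (DirectSum.coeLinearMap C.deg) := C.internal

/-- The sign operator: `x ↦ (-1)^n x` on elements of degree `n`. -/
def sgn : C.X →ₗ[k] C.X :=
  (DirectSum.toModule k ℤ C.X fun n =>
    ((n.negOnePow : ℤ) : k) • (C.deg n).subtype) ∘ₗ
  (LinearEquiv.ofBijective (DirectSum.coeLinearMap C.deg) C.bijective_coe).symm.toLinearMap

variable {C}

theorem negOnePow_smul (n : ℤ) (x : C.X) :
    ((n.negOnePow : ℤ) : k) • x = n.negOnePow • x := by
  rcases Int.units_eq_one_or n.negOnePow with h | h <;> simp [h]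

theorem sgn_of_mem {n : ℤ} {x : C.X} (hx : x ∈ C.deg n) : C.sgn x = n.negOnePow • x := by
  have : (LinearEquiv.ofBijective (DirectSum.coeLinearMap C.deg) C.bijective_coe).symm x
      = DirectSum.lof k ℤ (fun n => C.deg n) n ⟨x, hx⟩ := by
    rw [LinearEquiv.symm_apply_eq]
    exact (DirectSum.coeLinearMap_lof C.deg n ⟨x, hx⟩).symm
  simp only [sgn, LinearMap.comp_apply, LinearEquiv.coe_coe, this, DirectSum.toModule_lof]
  exact negOnePow_smul n x

theorem hom_induction {P : C.X → Prop} (h0 : P 0) (hadd : ∀ x y, P x → P y → P (x + y))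
    (hdeg : ∀ n x, x ∈ C.deg n → P x) (x : C.X) : P x := by
  have hx : x ∈ ⨆ n, C.deg n := by rw [C.internal.submodule_iSup_eq_top]; trivial
  exact Submodule.iSup_induction C.deg (motive := P) hx hdeg h0 hadd

theorem linear_ext {M : Type*} [AddCommGroup M] [Module k M] {f g : C.X →ₗ[k] M}
    (h : ∀ n x, x ∈ C.deg n → f x = g x) : f = g := by
  ext x
  induction x using hom_induction with
  | h0 => simp
  | hadd x y hx hy => simp [hx, hy]
  | hdeg n x hx => exact h n x hx

theorem exists_decomp (x : C.X) :
    ∃ c : ℤ →₀ C.X, (∀ n, c n ∈ C.deg n) ∧ (c.sum fun _ x => x) = x := by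
  have hx : x ∈ ⨆ n, C.deg n := by rw [C.internal.submodule_iSup_eq_top]; trivial
  rw [Submodule.mem_iSup_iff_exists_finsupp] at hx
  exact hx

theorem ℓ_zero : C.ℓ 0 = ⊥ := (C.ℓ_eq_bot 0).2 rfl

theorem ℓ_add (x y : C.X) : C.ℓ (x + y) ≤ max (C.ℓ x) (C.ℓ y) := by
  simpa using C.ℓ_smul_add 1 x y one_ne_zero

theorem ℓ_smul (c : k) (x : C.X) : C.ℓ (c • x) ≤ C.ℓ x := by
  by_cases hc : c = 0
  · simp [hc, ℓ_zero]
  · simpa [ℓ_zero] using C.ℓ_smul_add c x 0 hc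

theorem ℓ_negOnePow (n : ℤ) (x : C.X) : C.ℓ (n.negOnePow • x) ≤ C.ℓ x := by
  rw [← negOnePow_smul]; exact ℓ_smul _ _

theorem ℓ_neg (x : C.X) : C.ℓ (-x) ≤ C.ℓ x := by
  simpa using ℓ_smul (-1 : k) x

variable (C) in
/-- The subspace `X^{≤ b}`. -/
def fil (b : WithBot ℝ) : Submodule k C.X where
  carrier := {x | C.ℓ x ≤ b}
  zero_mem' := by simp [ℓ_zero]
  add_mem' hx hy := (ℓ_add _ _).trans (max_le hx hy)
  smul_mem' c x hx := (ℓ_smul c x).trans hx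

theorem ℓ_sum {ι : Type*} (s : Finset ι) (f : ι → C.X) (b : WithBot ℝ)
    (h : ∀ i ∈ s, C.ℓ (f i) ≤ b) : C.ℓ (∑ i ∈ s, f i) ≤ b :=
  (C.fil b).sum_mem h

theorem ℓ_sgn (x : C.X) : C.ℓ (C.sgn x) ≤ C.ℓ x := by
  obtain ⟨c, hc, rfl⟩ := exists_decomp x
  rw [Finsupp.sum, map_sum]
  refine ℓ_sum _ _ _ fun n _ => ?_
  rw [sgn_of_mem (hc n)]
  exact (ℓ_negOnePow _ _).trans (C.ℓ_component c hc n)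

theorem sgn_deg {n : ℤ} {x : C.X} (hx : x ∈ C.deg n) : C.sgn x ∈ C.deg n := by
  rw [sgn_of_mem hx, ← negOnePow_smul]
  exact Submodule.smul_mem _ _ hx

theorem sgn_d (x : C.X) : C.sgn (C.d x) = -C.d (C.sgn x) := by
  have : C.sgn ∘ₗ C.d = -(C.d ∘ₗ C.sgn) := by
    refine linear_ext fun n x hx => ?_
    simp [sgn_of_mem hx, sgn_of_mem (C.d_deg hx), ← negOnePow_smul, Int.negOnePow_succ]
  exact LinearMap.congr_fun this x

/-- `C` with degrees raised by `m`, the differential multiplied by `(-1)^e`, and the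
filtration function raised by `r`. -/
def twist (C : FilteredComplex.{w, v} k) (r : ℝ) (m e : ℤ) : FilteredComplex.{w, v} k where
  X := C.X
  deg n := C.deg (n - m)
  internal := by
    rw [DirectSum.isInternal_submodule_iff_iSupIndep_and_iSup_eq_top]
    refine ⟨C.internal.submodule_iSupIndep.comp (sub_left_injective), ?_⟩
    rw [← C.internal.submodule_iSup_eq_top]
    exact (Equiv.subRight m).iSup_comp (g := C.deg)
  d := ((e.negOnePow : ℤ) : k) • C.d
  d_deg {n x} hx := by
    have := C.d_deg hx
    rw [show n - m + 1 = n + 1 - m by ring] at this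
    exact Submodule.smul_mem _ _ this
  d_d x := by simp [C.d_d]
  ℓ x := C.ℓ x + (r : WithBot ℝ)
  ℓ_smul_add c x y hc := by
    rcases le_max_iff.1 (C.ℓ_smul_add c x y hc) with h | h
    · exact le_max_of_le_left (by gcongr)
    · exact le_max_of_le_right (by gcongr)
  ℓ_eq_bot x := by simp [C.ℓ_eq_bot]
  ℓ_d x := by
    gcongr
    exact (ℓ_smul _ _).trans (C.ℓ_d x)
  ℓ_component c hc n := by
    gcongr
    set c' : ℤ →₀ C.X := c.embDomain (Equiv.subRight m).toEmbedding with hc'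
    have h1 : ∀ n, c' (n - m) = c n := fun n =>
      Finsupp.embDomain_apply_self (Equiv.subRight m).toEmbedding c n
    have h2 : ∀ n, c' n ∈ C.deg n := fun n => by
      have := hc (n + m)
      rw [← h1] at this
      simpa using this
    have h3 : (c'.sum fun _ x => x) = c.sum fun _ x => x := by
      rw [hc', Finsupp.sum_embDomain]
    rw [← h1 n, ← h3]
    exact C.ℓ_component c' h2 _

/-- The complex `Σ^r C[m]`: `(C[m])^n = C^{n-m}`, with differential `(-1)^m d` and filtration
function `ℓ + r`. -/
abbrev shift (C : FilteredComplex.{w, v} k) (r : ℝ) (m : ℤ) : FilteredComplex.{w, v} k :=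
  C.twist r m m

end FilteredComplex

set_option linter.checkUnivs false in
/-- A filtered dg-category over `k`: hom-sets are filtered cochain complexes and the bilinear
composition `comp g f = g ∘ f` is a filtered chain map
`Hom(B, C) ⊗ Hom(A, B) → Hom(A, C)`.  The identities are closed with `ℓ (id A) ≤ 0`; together
with `comp_ℓ` this forces `ℓ (id A) = 0` unless `id A = 0`, that is, unless `A` is a zero
object. -/
structure FilteredDGCat (k : Type w) [Field k] where
  Obj : Type u
  Hom : Obj → Obj → FilteredComplex.{w, v} k
  id : ∀ A, (Hom A A).X
  comp : ∀ {A B C}, (Hom B C).X →ₗ[k] (Hom A B).X →ₗ[k] (Hom A C).X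
  id_comp : ∀ {A B} (f : (Hom A B).X), comp (id B) f = f
  comp_id : ∀ {A B} (f : (Hom A B).X), comp f (id A) = f
  assoc : ∀ {A B C D} (h : (Hom C D).X) (g : (Hom B C).X) (f : (Hom A B).X),
    comp (comp h g) f = comp h (comp g f)
  id_deg : ∀ A, id A ∈ (Hom A A).deg 0
  id_closed : ∀ A, (Hom A A).d (id A) = 0
  id_ℓ : ∀ A, (Hom A A).ℓ (id A) ≤ 0
  comp_deg : ∀ {A B C} {m n : ℤ} {g : (Hom B C).X} {f : (Hom A B).X},
    g ∈ (Hom B C).deg m → f ∈ (Hom A B).deg n → comp g f ∈ (Hom A C).deg (m + n)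
  leibniz : ∀ {A B C} {m : ℤ} {g : (Hom B C).X} (f : (Hom A B).X), g ∈ (Hom B C).deg m →
    (Hom A C).d (comp g f) =
      comp ((Hom B C).d g) f + m.negOnePow • comp g ((Hom A B).d f)
  comp_ℓ : ∀ {A B C} (g : (Hom B C).X) (f : (Hom A B).X),
    (Hom A C).ℓ (comp g f) ≤ (Hom B C).ℓ g + (Hom A B).ℓ f

namespace FilteredDGCat

open FilteredComplex

variable {k : Type w} [Field k]

/-! ### The shift completion -/

/-- The formal object `Σ^r A[d]`. -/
structure SigObj (A : FilteredDGCat.{w, u, v} k) where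
  obj : A.Obj
  r : ℝ
  d : ℤ

theorem negOnePow_smul' {M : Type*} [AddCommGroup M] [Module k M] (n : ℤ) (x : M) :
    n.negOnePow • x = ((n.negOnePow : ℤ) : k) • x := by
  rcases Int.units_eq_one_or n.negOnePow with h | h <;> simp [h]

theorem sign_mul_self (n : ℤ) : ((n.negOnePow : ℤ) : k) * ((n.negOnePow : ℤ) : k) = 1 := by
  rcases Int.units_eq_one_or n.negOnePow with h | h <;> simp [h]

theorem sign_add (m n : ℤ) : (((m + n).negOnePow : ℤ) : k) =
    ((m.negOnePow : ℤ) : k) * ((n.negOnePow : ℤ) : k) := by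
  simp [Int.negOnePow_add]

theorem sign_sub (m n : ℤ) : (((m - n).negOnePow : ℤ) : k) =
    ((m.negOnePow : ℤ) : k) * ((n.negOnePow : ℤ) : k) := by
  simp [Int.negOnePow_sub]

/-- The shift completion `ΣA`: `Hom(Σ^r A[a], Σ^s B[b])` is `Hom(A, B)` with degrees raised by
`b - a`, filtration function `ℓ + s - r` and differential `(-1)^b d`. -/
def Sig (A : FilteredDGCat.{w, u, v} k) : FilteredDGCat.{w, u, v} k where
  Obj := SigObj A
  Hom X Y := (A.Hom X.obj Y.obj).twist (Y.r - X.r) (Y.d - X.d) Y.d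
  id X := A.id X.obj
  comp := A.comp
  id_comp := A.id_comp
  comp_id := A.comp_id
  assoc := A.assoc
  id_deg X := by
    change A.id X.obj ∈ (A.Hom X.obj X.obj).deg (0 - (X.d - X.d))
    rw [sub_self, sub_self]; exact A.id_deg _
  id_closed X := by
    change ((X.d.negOnePow : ℤ) : k) • (A.Hom X.obj X.obj).d (A.id X.obj) = 0
    rw [A.id_closed, smul_zero]
  id_ℓ X := by
    change (A.Hom X.obj X.obj).ℓ (A.id X.obj) + ((X.r - X.r : ℝ) : WithBot ℝ) ≤ 0
    simpa using A.id_ℓ X.obj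
  comp_deg {X Y Z m n g f} hg hf := by
    have := A.comp_deg hg hf
    rw [show m - (Z.d - Y.d) + (n - (Y.d - X.d)) = m + n - (Z.d - X.d) by ring] at this
    exact this
  leibniz {X Y Z m g} f hg := by
    change ((Z.d.negOnePow : ℤ) : k) • (A.Hom X.obj Z.obj).d (A.comp g f) =
      A.comp (((Z.d.negOnePow : ℤ) : k) • (A.Hom Y.obj Z.obj).d g) f +
      m.negOnePow • A.comp g (((Y.d.negOnePow : ℤ) : k) • (A.Hom X.obj Y.obj).d f)
    rw [A.leibniz f hg]
    simp only [negOnePow_smul' (k := k), map_smul, smul_add, smul_smul]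
    congr 2
    rw [sign_sub, sign_sub]
    linear_combination (((m.negOnePow : ℤ) : k) * ((Y.d.negOnePow : ℤ) : k)) *
      sign_mul_self (k := k) Z.d
  comp_ℓ {X Y Z} g f := by
    change (A.Hom X.obj Z.obj).ℓ (A.comp g f) + ((Z.r - X.r : ℝ) : WithBot ℝ) ≤
      ((A.Hom Y.obj Z.obj).ℓ g + ((Z.r - Y.r : ℝ) : WithBot ℝ)) +
      ((A.Hom X.obj Y.obj).ℓ f + ((Y.r - X.r : ℝ) : WithBot ℝ))
    rw [add_add_add_comm, ← WithBot.coe_add, show Z.r - Y.r + (Y.r - X.r) = Z.r - X.r by ring]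
    gcongr
    exact A.comp_ℓ g f

/-! ### Matrices and one-sided twisted complexes over a filtered dg-category `B` -/

variable (B : FilteredDGCat.{w, u, v} k)

theorem comp_sgn_leibniz {X Y Z : B.Obj} (g : (B.Hom Y Z).X) (f : (B.Hom X Y).X) :
    (B.Hom X Z).d (B.comp g f) = B.comp ((B.Hom Y Z).d g) f +
      B.comp ((B.Hom Y Z).sgn g) ((B.Hom X Y).d f) := by
  induction g using hom_induction with
  | h0 => simp
  | hadd g g' h h' => simp only [map_add, LinearMap.add_apply, h, h']; abel
  | hdeg n g hg =>
    rw [B.leibniz f hg, sgn_of_mem hg, negOnePow_smul' (k := k), negOnePow_smul' (k := k)]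
    simp

theorem sgn_comp {X Y Z : B.Obj} (g : (B.Hom Y Z).X) (f : (B.Hom X Y).X) :
    (B.Hom X Z).sgn (B.comp g f) = B.comp ((B.Hom Y Z).sgn g) ((B.Hom X Y).sgn f) := by
  induction g using hom_induction with
  | h0 => simp
  | hadd g g' h h' => simp only [map_add, LinearMap.add_apply, h, h']
  | hdeg n g hg =>
    induction f using hom_induction with
    | h0 => simp
    | hadd f f' h h' => simp only [map_add, h, h']
    | hdeg m f hf =>
      rw [sgn_of_mem hg, sgn_of_mem hf, sgn_of_mem (B.comp_deg hg hf)]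
      simp only [negOnePow_smul' (k := k), map_smul, LinearMap.smul_apply, smul_smul, sign_add]
      congr 1
      ring

/-- The complex of matrices `(f_{ij} : X_j → Y_i)` between two finite families of objects,
with the entrywise grading and differential and the filtration function `max_{ij} ℓ(f_{ij})`. -/
def matComplex {m n : ℕ} (X : Fin m → B.Obj) (Y : Fin n → B.Obj) :
    FilteredComplex.{w, v} k where
  X := ∀ (i : Fin n) (j : Fin m), (B.Hom (X j) (Y i)).X
  deg p := Submodule.pi Set.univ fun i => Submodule.pi Set.univ fun j =>
    (B.Hom (X j) (Y i)).deg p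
  internal := by
    rw [DirectSum.isInternal_submodule_iff_iSupIndep_and_iSup_eq_top]
    constructor
    · intro p
      rw [Submodule.disjoint_def]
      intro f hf hf'
      funext i j
      let π : (∀ (i : Fin n) (j : Fin m), (B.Hom (X j) (Y i)).X) →ₗ[k] (B.Hom (X j) (Y i)).X :=
        LinearMap.proj j ∘ₗ LinearMap.proj i
      have h1 : f i j ∈ (B.Hom (X j) (Y i)).deg p := hf i trivial j trivial
      have h2 : π f ∈ ⨆ q, ⨆ (_ : q ≠ p), (B.Hom (X j) (Y i)).deg q := by
        have := Submodule.mem_map_of_mem (f := π) hf'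
        simp only [Submodule.map_iSup] at this
        have hle : (⨆ q, ⨆ (_ : q ≠ p), Submodule.map π (Submodule.pi Set.univ fun i =>
            Submodule.pi Set.univ fun j => (B.Hom (X j) (Y i)).deg q)) ≤
            ⨆ q, ⨆ (_ : q ≠ p), (B.Hom (X j) (Y i)).deg q := iSup₂_mono fun q _ => ?_
        · exact hle this
        rintro _ ⟨g, hg, rfl⟩
        exact hg i trivial j trivial
      exact (Submodule.disjoint_def.1
        ((B.Hom (X j) (Y i)).internal.submodule_iSupIndep p)) _ h1 h2
    · rw [eq_top_iff]
      rintro f -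
      have hf : f = ∑ i, ∑ j, Pi.single i (Pi.single j (f i j)) := by
        funext a b
        simp only [Finset.sum_apply]
        rw [Finset.sum_eq_single a, Finset.sum_eq_single b]
        · simp
        · intro c _ hc; simp [Pi.single_eq_of_ne' hc]
        · simp
        · intro c _ hc; simp [Pi.single_eq_of_ne' hc]
        · simp
      rw [hf]
      refine Submodule.sum_mem _ fun i _ => Submodule.sum_mem _ fun j _ => ?_
      induction f i j using hom_induction with
      | h0 => simp
      | hadd x y hx hy =>
        rw [Pi.single_add, Pi.single_add]
        exact Submodule.add_mem _ hx hy
      | hdeg p x hx =>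
        refine Submodule.mem_iSup_of_mem p fun a _ b _ => ?_
        by_cases ha : a = i
        · subst ha
          by_cases hb : b = j
          · subst hb; simpa using hx
          · simp [hb]
        · simp [ha]
  d := LinearMap.pi fun i => LinearMap.pi fun j =>
    (B.Hom (X j) (Y i)).d ∘ₗ LinearMap.proj j ∘ₗ LinearMap.proj i
  d_deg hf i _ j _ := (B.Hom (X j) (Y i)).d_deg (hf i trivial j trivial)
  d_d f := by funext i j; exact (B.Hom (X j) (Y i)).d_d _
  ℓ f := Finset.univ.sup fun i => Finset.univ.sup fun j => (B.Hom (X j) (Y i)).ℓ (f i j)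
  ℓ_smul_add c f g hc := by
    refine Finset.sup_le fun i _ => Finset.sup_le fun j _ => ?_
    refine ((B.Hom (X j) (Y i)).ℓ_smul_add c _ _ hc).trans (max_le_max ?_ ?_)
    · exact (Finset.le_sup (f := fun j => (B.Hom (X j) (Y i)).ℓ (f i j))
        (Finset.mem_univ j)).trans (Finset.le_sup (f := fun i => Finset.univ.sup fun j =>
          (B.Hom (X j) (Y i)).ℓ (f i j)) (Finset.mem_univ i))
    · exact (Finset.le_sup (f := fun j => (B.Hom (X j) (Y i)).ℓ (g i j))
        (Finset.mem_univ j)).trans (Finset.le_sup (f := fun i => Finset.univ.sup fun j =>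
          (B.Hom (X j) (Y i)).ℓ (g i j)) (Finset.mem_univ i))
  ℓ_eq_bot f := by
    simp only [Finset.sup_eq_bot_iff, Finset.mem_univ, true_imp_iff, ℓ_eq_bot]
    exact ⟨fun h => funext fun i => funext fun j => h i j, fun h i j => by rw [h]; rfl⟩
  ℓ_d f := Finset.sup_mono_fun fun i _ => Finset.sup_mono_fun fun j _ =>
    (B.Hom (X j) (Y i)).ℓ_d _
  ℓ_component c hc p := by
    refine Finset.sup_mono_fun fun i _ => Finset.sup_mono_fun fun j _ => ?_
    let π : (∀ (i : Fin n) (j : Fin m), (B.Hom (X j) (Y i)).X) →ₗ[k] (B.Hom (X j) (Y i)).X :=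
      LinearMap.proj j ∘ₗ LinearMap.proj i
    have := (B.Hom (X j) (Y i)).ℓ_component (c.mapRange π (map_zero _))
      (fun q => hc q i trivial j trivial) p
    rw [Finsupp.sum_mapRange_index (by simp)] at this
    convert this using 2
    · simp [π]
    · exact map_sum π _ _

variable {B}

section matrices

variable {l m n : ℕ} {W : Fin l → B.Obj} {X : Fin m → B.Obj} {Y : Fin n → B.Obj}

theorem mat_ℓ_le {f : (B.matComplex X Y).X} {b : WithBot ℝ} :
    (B.matComplex X Y).ℓ f ≤ b ↔ ∀ i j, (B.Hom (X j) (Y i)).ℓ (f i j) ≤ b := by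
  change (Finset.univ.sup fun i : Fin n => Finset.univ.sup fun j : Fin m =>
    (B.Hom (X j) (Y i)).ℓ (f i j)) ≤ b ↔ _
  simp

theorem entry_ℓ_le (f : (B.matComplex X Y).X) (i : Fin n) (j : Fin m) :
    (B.Hom (X j) (Y i)).ℓ (f i j) ≤ (B.matComplex X Y).ℓ f := mat_ℓ_le.1 le_rfl i j

theorem mat_mem_deg {f : (B.matComplex X Y).X} {p : ℤ} :
    f ∈ (B.matComplex X Y).deg p ↔ ∀ i j, f i j ∈ (B.Hom (X j) (Y i)).deg p :=
  ⟨fun h i j => h i trivial j trivial, fun h i _ j _ => h i j⟩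

theorem mat_sgn (f : (B.matComplex X Y).X) (i : Fin n) (j : Fin m) :
    (B.matComplex X Y).sgn f i j = (B.Hom (X j) (Y i)).sgn (f i j) := by
  induction f using hom_induction with
  | h0 => rw [map_zero]; exact (map_zero (B.Hom (X j) (Y i)).sgn).symm
  | hadd f g hf hg =>
    rw [map_add]
    change (B.matComplex X Y).sgn f i j + (B.matComplex X Y).sgn g i j =
      (B.Hom (X j) (Y i)).sgn (f i j + g i j)
    rw [hf, hg, map_add]
  | hdeg p f hf =>
    rw [sgn_of_mem hf, sgn_of_mem (mat_mem_deg.1 hf i j)]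
    rfl

variable (W X Y) in
/-- Matrix multiplication: `(g f)_{ij} = ∑ₖ g_{ik} ∘ f_{kj}`. -/
def matComp : (B.matComplex X Y).X →ₗ[k] (B.matComplex W X).X →ₗ[k] (B.matComplex W Y).X :=
  LinearMap.mk₂ k (fun g f i j => ∑ c, B.comp (g i c) (f c j))
    (fun g g' f => by
      funext i j
      change ∑ c, B.comp (g i c + g' i c) (f c j) = _ + _
      simp [Finset.sum_add_distrib])
    (fun a g f => by
      funext i j
      change ∑ c, B.comp (a • g i c) (f c j) = a • _
      simp [Finset.smul_sum])
    (fun g f f' => by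
      funext i j
      change ∑ c, B.comp (g i c) (f c j + f' c j) = _ + _
      simp [Finset.sum_add_distrib])
    (fun a g f => by
      funext i j
      change ∑ c, B.comp (g i c) (a • f c j) = a • _
      simp [Finset.smul_sum])

theorem matComp_apply (g : (B.matComplex X Y).X) (f : (B.matComplex W X).X) (i j) :
    matComp W X Y g f i j = ∑ c, B.comp (g i c) (f c j) := rfl

theorem matComp_assoc {p : ℕ} {V : Fin p → B.Obj} (h : (B.matComplex X Y).X)
    (g : (B.matComplex W X).X) (f : (B.matComplex V W).X) :
    matComp V W Y (matComp W X Y h g) f = matComp V X Y h (matComp V W X g f) := by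
  funext i j
  simp only [matComp_apply, map_sum, LinearMap.sum_apply, B.assoc]
  exact Finset.sum_comm

variable (X) in
/-- The identity matrix. -/
def matOne : (B.matComplex X X).X := fun i j =>
  if h : i = j then h ▸ B.id (X i) else 0

theorem matOne_self (i : Fin m) : matOne X i i = B.id (X i) := by simp [matOne]

theorem matOne_ne {i j : Fin m} (h : i ≠ j) : matOne X i j = 0 := by simp [matOne, h]

theorem matOne_comp (f : (B.matComplex X Y).X) : matComp X Y Y (matOne Y) f = f := by
  funext i j
  rw [matComp_apply, Finset.sum_eq_single i]
  · rw [matOne_self, B.id_comp]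
  · intro c _ hc
    rw [matOne_ne hc.symm]; simp
  · simp

theorem matComp_one (f : (B.matComplex X Y).X) : matComp X X Y f (matOne X) = f := by
  funext i j
  rw [matComp_apply, Finset.sum_eq_single j]
  · rw [matOne_self, B.comp_id]
  · intro c _ hc
    rw [matOne_ne hc]; simp
  · simp

theorem matOne_deg : matOne X ∈ (B.matComplex X X).deg 0 := by
  rw [mat_mem_deg]
  intro i j
  by_cases h : i = j
  · subst h; rw [matOne_self]; exact B.id_deg _
  · rw [matOne_ne h]; exact Submodule.zero_mem _

theorem matOne_closed : (B.matComplex X X).d (matOne X) = 0 := by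
  funext i j
  change (B.Hom (X j) (X i)).d (matOne X i j) = 0
  by_cases h : i = j
  · subst h; rw [matOne_self]; exact B.id_closed _
  · rw [matOne_ne h]; exact map_zero _

theorem matOne_ℓ : (B.matComplex X X).ℓ (matOne X) ≤ 0 := by
  rw [mat_ℓ_le]
  intro i j
  by_cases h : i = j
  · subst h; rw [matOne_self]; exact B.id_ℓ _
  · rw [matOne_ne h, ℓ_zero]; exact bot_le

theorem matComp_deg {p q : ℤ} {g : (B.matComplex X Y).X} {f : (B.matComplex W X).X}
    (hg : g ∈ (B.matComplex X Y).deg p) (hf : f ∈ (B.matComplex W X).deg q) :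
    matComp W X Y g f ∈ (B.matComplex W Y).deg (p + q) := by
  rw [mat_mem_deg] at *
  intro i j
  rw [matComp_apply]
  exact Submodule.sum_mem _ fun c _ => B.comp_deg (hg i c) (hf c j)

theorem matComp_ℓ (g : (B.matComplex X Y).X) (f : (B.matComplex W X).X) :
    (B.matComplex W Y).ℓ (matComp W X Y g f) ≤
      (B.matComplex X Y).ℓ g + (B.matComplex W X).ℓ f := by
  rw [mat_ℓ_le]
  intro i j
  rw [matComp_apply]
  exact ℓ_sum _ _ _ fun c _ => (B.comp_ℓ _ _).trans
    (add_le_add (entry_ℓ_le g i c) (entry_ℓ_le f c j))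

theorem mat_leibniz (g : (B.matComplex X Y).X) (f : (B.matComplex W X).X) :
    (B.matComplex W Y).d (matComp W X Y g f) =
      matComp W X Y ((B.matComplex X Y).d g) f +
      matComp W X Y ((B.matComplex X Y).sgn g) ((B.matComplex W X).d f) := by
  funext i j
  change (B.Hom (W j) (Y i)).d (∑ c, B.comp (g i c) (f c j)) =
    (∑ c, B.comp ((B.Hom (X c) (Y i)).d (g i c)) (f c j)) +
    ∑ c, B.comp ((B.matComplex X Y).sgn g i c) ((B.Hom (W j) (X c)).d (f c j))
  simp only [map_sum, comp_sgn_leibniz, Finset.sum_add_distrib, mat_sgn]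

theorem mat_sgn_comp (g : (B.matComplex X Y).X) (f : (B.matComplex W X).X) :
    (B.matComplex W Y).sgn (matComp W X Y g f) =
      matComp W X Y ((B.matComplex X Y).sgn g) ((B.matComplex W X).sgn f) := by
  funext i j
  rw [mat_sgn, matComp_apply, matComp_apply, map_sum]
  simp only [mat_sgn, sgn_comp]

end matrices

variable (B) in
/-- A filtered one-sided twisted complex `(⨁ Xᵢ, q)` over the filtered dg-category `B`. -/
structure TwObj where
  n : ℕ
  obj : Fin n → B.Obj
  q : ∀ i j : Fin n, (B.Hom (obj j) (obj i)).X
  q_deg : ∀ i j, q i j ∈ (B.Hom (obj j) (obj i)).deg 1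
  q_onesided : ∀ i j, j ≤ i → q i j = 0
  q_mc : ∀ i j, (B.Hom (obj j) (obj i)).d (q i j) + ∑ c, B.comp (q i c) (q c j) = 0
  q_ℓ : ∀ i j, (B.Hom (obj j) (obj i)).ℓ (q i j) ≤ 0

namespace TwObj

variable (X Y : TwObj B)

/-- The structure map `q` as a matrix. -/
def qm : (B.matComplex X.obj X.obj).X := X.q

/-- The twisted differential `D f = d f + q' f - (-1)^{|f|} f q`. -/
def D : (B.matComplex X.obj Y.obj).X →ₗ[k] (B.matComplex X.obj Y.obj).X :=
  (B.matComplex X.obj Y.obj).d + matComp X.obj Y.obj Y.obj Y.qm -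
    (matComp X.obj X.obj Y.obj).flip X.qm ∘ₗ (B.matComplex X.obj Y.obj).sgn

variable {X Y}

theorem D_apply (f : (B.matComplex X.obj Y.obj).X) :
    D X Y f = (B.matComplex X.obj Y.obj).d f + matComp _ _ _ Y.qm f -
      matComp _ _ _ ((B.matComplex X.obj Y.obj).sgn f) X.qm := rfl

theorem qm_deg : X.qm ∈ (B.matComplex X.obj X.obj).deg 1 := mat_mem_deg.2 X.q_deg

theorem qm_sgn : (B.matComplex X.obj X.obj).sgn X.qm = -X.qm := by
  rw [sgn_of_mem qm_deg]; simp

theorem qm_mc : (B.matComplex X.obj X.obj).d X.qm + matComp _ _ _ X.qm X.qm = 0 := by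
  funext i j
  exact X.q_mc i j

theorem qm_ℓ : (B.matComplex X.obj X.obj).ℓ X.qm ≤ 0 := mat_ℓ_le.2 X.q_ℓ

theorem sgn_sgn {C : FilteredComplex.{w, v} k} (x : C.X) : C.sgn (C.sgn x) = x := by
  induction x using hom_induction with
  | h0 => simp
  | hadd x y hx hy => simp [hx, hy]
  | hdeg n x hx =>
    rw [sgn_of_mem (sgn_deg hx), sgn_of_mem hx, smul_smul, Int.units_mul_self, one_smul]

theorem D_D (f : (B.matComplex X.obj Y.obj).X) : D X Y (D X Y f) = 0 := by
  have hX : (B.matComplex X.obj X.obj).d X.qm = - matComp _ _ _ X.qm X.qm :=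
    eq_neg_of_add_eq_zero_left qm_mc
  have hY : (B.matComplex Y.obj Y.obj).d Y.qm = - matComp _ _ _ Y.qm Y.qm :=
    eq_neg_of_add_eq_zero_left qm_mc
  simp only [D_apply, map_add, map_sub, mat_leibniz, mat_sgn_comp, qm_sgn, sgn_sgn, sgn_d,
    LinearMap.neg_apply, map_neg, hX, hY,
    d_d, matComp_assoc]
  abel

theorem D_leibniz {Z : TwObj B} (g : (B.matComplex Y.obj Z.obj).X)
    (f : (B.matComplex X.obj Y.obj).X) :
    D X Z (matComp _ _ _ g f) = matComp _ _ _ (D Y Z g) f +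
      matComp _ _ _ ((B.matComplex Y.obj Z.obj).sgn g) (D X Y f) := by
  simp only [D_apply, mat_leibniz, mat_sgn_comp, map_add, map_sub, LinearMap.add_apply,
    LinearMap.sub_apply, matComp_assoc]
  abel

theorem D_leibniz_of_mem {Z : TwObj B} {m : ℤ} {g : (B.matComplex Y.obj Z.obj).X}
    (f : (B.matComplex X.obj Y.obj).X) (hg : g ∈ (B.matComplex Y.obj Z.obj).deg m) :
    D X Z (matComp _ _ _ g f) = matComp _ _ _ (D Y Z g) f +
      m.negOnePow • matComp _ _ _ g (D X Y f) := by
  rw [D_leibniz, sgn_of_mem hg, negOnePow_smul' (k := k), negOnePow_smul' (k := k), map_smul,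
    LinearMap.smul_apply]

variable (X Y) in
/-- The morphism complex between two twisted complexes. -/
def homComplex : FilteredComplex.{w, v} k where
  __ := B.matComplex X.obj Y.obj
  d := D X Y
  d_deg {p f} hf := by
    rw [D_apply]
    refine Submodule.sub_mem _ (Submodule.add_mem _ (d_deg _ hf) ?_) ?_
    · have := matComp_deg Y.qm_deg hf
      rwa [add_comm] at this
    · exact matComp_deg (sgn_deg hf) X.qm_deg
  d_d := D_D
  ℓ_d f := by
    rw [D_apply, sub_eq_add_neg]
    refine (ℓ_add _ _).trans (max_le ((ℓ_add _ _).trans (max_le (ℓ_d _ _) ?_))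
      ((ℓ_neg _).trans ?_))
    · refine (matComp_ℓ _ _).trans ?_
      calc _ ≤ 0 + (B.matComplex X.obj Y.obj).ℓ f := by gcongr; exact Y.qm_ℓ
        _ = _ := zero_add _
    · refine (matComp_ℓ _ _).trans ?_
      calc _ ≤ (B.matComplex X.obj Y.obj).ℓ f + 0 := by
            gcongr
            · exact ℓ_sgn _
            · exact X.qm_ℓ
        _ = _ := add_zero _

theorem D_one : D X X (matOne X.obj) = 0 := by
  rw [D_apply, matOne_closed, sgn_of_mem matOne_deg]
  simp [matOne_comp, matComp_one]

end TwObj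

variable (B) in
/-- The filtered dg-category of filtered one-sided twisted complexes over `B`. -/
def twCat : FilteredDGCat.{w, max u v, v} k where
  Obj := TwObj B
  Hom X Y := TwObj.homComplex X Y
  id X := matOne X.obj
  comp {X Y Z} := matComp X.obj Y.obj Z.obj
  id_comp := matOne_comp
  comp_id := matComp_one
  assoc := matComp_assoc
  id_deg _ := matOne_deg
  id_closed _ := TwObj.D_one
  id_ℓ _ := matOne_ℓ
  comp_deg := matComp_deg
  leibniz f hg := TwObj.D_leibniz_of_mem f hg
  comp_ℓ := matComp_ℓ

/-- The filtered pre-triangulated completion `Tw(A)`: filtered one-sided twisted complexes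
over the shift completion `ΣA`. -/
def Tw (A : FilteredDGCat.{w, u, v} k) : FilteredDGCat.{w, max u v, v} k := A.Sig.twCat

end FilteredDGCat

/-! ### Persistence categories -/

set_option linter.checkUnivs false in
/-- A persistence category over `k`: `Mor r A B` are the morphisms of shift `r`, `i` the
structure maps of the persistence module `r ↦ Mor r A B`, and `comp f g = g ∘ f`. -/
structure PersistenceCategory (k : Type w) [Field k] where
  Obj : Type u
  Mor : ℝ → Obj → Obj → Type v
  [acg : ∀ r A B, AddCommGroup (Mor r A B)]
  [mod : ∀ r A B, Module k (Mor r A B)]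
  i : ∀ {A B : Obj} {r s : ℝ}, r ≤ s → (Mor r A B →ₗ[k] Mor s A B)
  i_refl : ∀ {A B} {r : ℝ} (f : Mor r A B), i (le_refl r) f = f
  i_trans : ∀ {A B} {r s t : ℝ} (h : r ≤ s) (h' : s ≤ t) (f : Mor r A B),
    i h' (i h f) = i (h.trans h') f
  id : ∀ A, Mor 0 A A
  comp : ∀ {A B C} {r s : ℝ}, Mor r A B →ₗ[k] Mor s B C →ₗ[k] Mor (r + s) A C
  comp_i : ∀ {A B C} {r r' s s' : ℝ} (h : r ≤ r') (h' : s ≤ s')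
    (f : Mor r A B) (g : Mor s B C),
    comp (i h f) (i h' g) = i (add_le_add h h') (comp f g)
  id_comp : ∀ {A B} {r : ℝ} (f : Mor r A B), i (zero_add r).le (comp (id A) f) = f
  comp_id : ∀ {A B} {r : ℝ} (f : Mor r A B), i (add_zero r).le (comp f (id B)) = f
  assoc : ∀ {A B C D} {r s t : ℝ} (f : Mor r A B) (g : Mor s B C) (h : Mor t C D),
    i (add_assoc r s t).le (comp (comp f g) h) = comp f (comp g h)

namespace PersistenceCategory

attribute [instance] acg mod

variable {k : Type w} [Field k] (C : PersistenceCategory.{w, u, v} k)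

/-- Composition followed by a structure map (an identification of `Mor (r + s)` with `Mor t`
when `r + s = t`). -/
def cmp {C : PersistenceCategory.{w, u, v} k} {X Y Z : C.Obj} {r s t : ℝ} (h : r + s ≤ t)
    (f : C.Mor r X Y) (g : C.Mor s Y Z) : C.Mor t X Z := C.i h (C.comp f g)

section

variable {C} {X Y Z W : C.Obj}

theorem cmp_zero_assoc (f : C.Mor 0 X Y) (g : C.Mor 0 Y Z) (h : C.Mor 0 Z W) :
    cmp (add_zero 0).le (cmp (add_zero 0).le f g) h =
      cmp (add_zero 0).le f (cmp (add_zero 0).le g h) := by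
  simp only [cmp]
  have h1 := C.comp_i (add_zero (0 : ℝ)).le le_rfl (C.comp f g) h
  have h2 := C.comp_i le_rfl (add_zero (0 : ℝ)).le f (C.comp g h)
  rw [C.i_refl] at h1 h2
  rw [h1, h2, ← C.assoc, C.i_trans, C.i_trans, C.i_trans]

theorem add_cmp {r s t : ℝ} (h : r + s ≤ t) (f f' : C.Mor r X Y) (g : C.Mor s Y Z) :
    cmp h (f + f') g = cmp h f g + cmp h f' g := by
  simp only [cmp, map_add, LinearMap.add_apply]

theorem cmp_add {r s t : ℝ} (h : r + s ≤ t) (f : C.Mor r X Y) (g g' : C.Mor s Y Z) :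
    cmp h f (g + g') = cmp h f g + cmp h f g' := by
  simp only [cmp, map_add]

end

/-- The `0`-level `C₀`: the same objects, and the morphisms of shift `0`. -/
def Zero : Type u := C.Obj

instance : Category.{v} C.Zero where
  Hom A B := C.Mor 0 A B
  id A := C.id A
  comp f g := cmp (add_zero 0).le f g
  id_comp f := C.id_comp f
  comp_id f := C.comp_id f
  assoc f g h := cmp_zero_assoc f g h

instance : Preadditive C.Zero where
  homGroup A B := C.acg 0 A B
  add_comp _ _ _ f f' g := add_cmp (add_zero 0).le f f' g
  comp_add _ _ _ f g g' := cmp_add (add_zero 0).le f g g'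

/-- `K` is `r`-acyclic: the identity of `K` becomes zero in `Mor r K K`. -/
def IsAcyclic {r : ℝ} (hr : 0 ≤ r) (K : C.Obj) : Prop := C.i hr (C.id K) = 0

end PersistenceCategory

/-- A persistence functor. -/
structure PersistenceFunctor {k : Type w} [Field k] (C D : PersistenceCategory.{w, u, v} k) where
  obj : C.Obj → D.Obj
  map : ∀ {A B : C.Obj} {r : ℝ}, C.Mor r A B →ₗ[k] D.Mor r (obj A) (obj B)
  map_i : ∀ {A B} {r s : ℝ} (h : r ≤ s) (f : C.Mor r A B), map (C.i h f) = D.i h (map f)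
  map_id : ∀ A, map (C.id A) = D.id (obj A)
  map_comp : ∀ {A B E} {r s : ℝ} (f : C.Mor r A B) (g : C.Mor s B E),
    map (C.comp f g) = D.comp (map f) (map g)

theorem PersistenceFunctor.map_cmp {k : Type w} [Field k]
    {C D : PersistenceCategory.{w, u, v} k} (F : PersistenceFunctor C D) {A B E : C.Obj}
    {r s t : ℝ} (h : r + s ≤ t) (f : C.Mor r A B) (g : C.Mor s B E) :
    F.map (PersistenceCategory.cmp h f g) =
      PersistenceCategory.cmp h (F.map f) (F.map g) := by
  simp only [PersistenceCategory.cmp, F.map_i, F.map_comp]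

/-- The restriction of a persistence functor to the `0`-levels. -/
def PersistenceFunctor.zero {k : Type w} [Field k] {C D : PersistenceCategory.{w, u, v} k}
    (F : PersistenceFunctor C D) : C.Zero ⥤ D.Zero where
  obj A := F.obj A
  map {A B} f := F.map (A := A) (B := B) (r := 0) f
  map_id A := F.map_id A
  map_comp f g := F.map_cmp (add_zero 0).le f g

open PersistenceCategory in
/-- A shift functor on `C`: a monoidal functor `Σ` from `(ℝ, +)`, with exactly one morphism
`r ⟶ s` for all `r, s`, to the endofunctors of `C`, such that the natural transformation
`η r s : Σ^r ⟶ Σ^s` has shift `s - r`.  The isomorphisms `ε : 𝟭 ≅ Σ^0` and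
`μ r s : Σ^r ∘ Σ^s ≅ Σ^(r + s)` of shift `0` are the monoidal structure. -/
structure ShiftFunctor {k : Type w} [Field k] (C : PersistenceCategory.{w, u, v} k) where
  F : ℝ → PersistenceFunctor C C
  η : ∀ (r s : ℝ) (A : C.Obj), C.Mor (s - r) ((F r).obj A) ((F s).obj A)
  η_refl : ∀ r A, C.i (sub_self r).le (η r r A) = C.id ((F r).obj A)
  η_trans : ∀ r s t A, cmp (by simp) (η r s A) (η s t A) = η r t A
  η_natural : ∀ r s {A B} {a : ℝ} (f : C.Mor a A B),
    cmp (t := a + (s - r)) (by simp) ((F r).map f) (η r s B) =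
      cmp (by rw [add_comm]) (η r s A) ((F s).map f)
  ε : ∀ A : C.Zero, A ≅ (F 0).zero.obj A
  ε_natural : ∀ {A B : C.Obj} {a : ℝ} (f : C.Mor a A B),
    cmp (t := a) (by simp) f (ε B).hom = cmp (by simp) (ε A).hom ((F 0).map f)
  μ : ∀ (r s : ℝ) (A : C.Zero), (F r).zero.obj ((F s).zero.obj A) ≅ (F (r + s)).zero.obj A
  μ_natural : ∀ r s {A B : C.Obj} {a : ℝ} (f : C.Mor a A B),
    cmp (t := a) (by simp) ((F r).map ((F s).map f)) (μ r s B).hom =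
      cmp (by simp) (μ r s A).hom ((F (r + s)).map f)
  μ_η : ∀ r r' s s' (A : C.Obj),
    cmp (t := (r' + s') - (r + s)) (by simp)
        (cmp (t := (r' + s') - (r + s)) (by linarith)
          ((F r).map (η s s' A)) (η r r' ((F s').obj A)))
        (μ r' s' A).hom =
      cmp (by simp) (μ r s A).hom (η (r + s) (r' + s') A)
  assoc : ∀ r s t (A : C.Obj),
    cmp (t := 0) (by linarith)
        (cmp (t := 0) (by simp) (μ r s ((F t).obj A)).hom (μ (r + s) t A).hom)
        (η (r + s + t) (r + (s + t)) A) =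
      cmp (by simp) ((F r).map (μ s t A).hom) (μ r (s + t) A).hom
  left_unit : ∀ r (A : C.Obj),
    cmp (t := 0) (by simp) (ε ((F r).obj A)).hom (μ 0 r A).hom =
      C.i (by simp) (η r (0 + r) A)
  right_unit : ∀ r (A : C.Obj),
    cmp (t := 0) (by simp) ((F r).map (ε A).hom) (μ r 0 A).hom =
      C.i (by simp) (η r (r + 0) A)

namespace ShiftFunctor

variable {k : Type w} [Field k] {C : PersistenceCategory.{w, u, v} k} (S : ShiftFunctor C)

/-- A shift functor is strict if it is a strict monoidal functor: `Σ^0` is equal to the identity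
functor, `Σ^r ∘ Σ^s` is equal to `Σ^(r + s)`, and `ε`, `μ` are identities. -/
structure IsStrict : Prop where
  obj_zero : ∀ A, (S.F 0).obj A = A
  map_zero : ∀ {A B : C.Obj} {a : ℝ} (f : C.Mor a A B), HEq ((S.F 0).map f) f
  ε_eq : ∀ A : C.Obj, HEq (S.ε A).hom (C.id A)
  obj_add : ∀ r s A, (S.F r).obj ((S.F s).obj A) = (S.F (r + s)).obj A
  map_add : ∀ r s {A B : C.Obj} {a : ℝ} (f : C.Mor a A B),
    HEq ((S.F r).map ((S.F s).map f)) ((S.F (r + s)).map f)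
  μ_eq : ∀ r s (A : C.Obj), HEq (S.μ r s A).hom (C.id ((S.F (r + s)).obj A))

/-- For `r ≥ 0`, the morphism `η_r^A : Σ^r A ⟶ A` of shift `0`, the image of
`η r 0 : Σ^r A ⟶ Σ^0 A ≅ A` under the structure map `Mor (-r) → Mor 0`. -/
def etaZero {r : ℝ} (hr : 0 ≤ r) (A : C.Zero) : (S.F r).zero.obj A ⟶ A :=
  PersistenceCategory.cmp (C := C) (t := 0) (by linarith) (S.η r 0 A) (S.ε A).inv

end ShiftFunctor

open Pretriangulated Limits in
/-- The structure of a triangulated persistence category on the persistence category `C`. -/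
structure TPC {k : Type w} [Field k] (C : PersistenceCategory.{w, u, v} k) where
  shift : ShiftFunctor C
  /-- The `0`-level is a triangulated category. -/
  [hasZeroObject : HasZeroObject C.Zero]
  [hasShift : HasShift C.Zero ℤ]
  [shift_additive : ∀ n : ℤ, (shiftFunctor C.Zero n).Additive]
  [pretriangulated : Pretriangulated C.Zero]
  [isTriangulated : IsTriangulated C.Zero]
  /-- Finite direct sums in the `0`-level split all morphism spaces. -/
  biprod_left : ∀ {A B : C.Zero} (b : BinaryBicone A B), Nonempty b.IsBilimit →
    ∀ (X : C.Obj) (r : ℝ), Function.Bijective fun f : C.Mor r b.pt X =>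
      ((PersistenceCategory.cmp (zero_add r).le b.inl f,
        PersistenceCategory.cmp (zero_add r).le b.inr f) : C.Mor r A X × C.Mor r B X)
  biprod_right : ∀ {A B : C.Zero} (b : BinaryBicone A B), Nonempty b.IsBilimit →
    ∀ (X : C.Obj) (r : ℝ), Function.Bijective fun f : C.Mor r X b.pt =>
      ((PersistenceCategory.cmp (add_zero r).le f b.fst,
        PersistenceCategory.cmp (add_zero r).le f b.snd) : C.Mor r X A × C.Mor r X B)
  /-- Each `Σ^r` restricts to a triangulated endofunctor of the `0`-level. -/
  [commShift : ∀ r : ℝ, (shift.F r).zero.CommShift ℤ]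
  [sigma_isTriangulated : ∀ r : ℝ, (shift.F r).zero.IsTriangulated]
  /-- `η_r^A` has an `r`-acyclic cofiber. -/
  cofiber : ∀ {r : ℝ} (hr : 0 ≤ r) (A : C.Zero),
    ∃ (K : C.Zero) (g : A ⟶ K) (h : K ⟶ ((shift.F r).zero.obj A)⟦(1 : ℤ)⟧),
      Triangle.mk (shift.etaZero hr A) g h ∈ distTriang C.Zero ∧ C.IsAcyclic hr K

namespace TPC

variable {k : Type w} [Field k] {C : PersistenceCategory.{w, u, v} k} (S : TPC C)

/-- The translation `T` of the `0`-level. -/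
abbrev T : C.Zero ⥤ C.Zero := letI := S.hasShift; shiftFunctor C.Zero (1 : ℤ)

/-- The structure is strict: the shift functor is strict monoidal, the translation `T` is an
automorphism of the category `C₀`, and `T` and `Σ^r` commute on the nose. -/
structure IsStrict : Prop where
  shift_strict : S.shift.IsStrict
  T_bijective : Function.Bijective S.T.obj
  T_comm : ∀ (r : ℝ) (A : C.Zero), (S.shift.F r).zero.obj (S.T.obj A) =
    S.T.obj ((S.shift.F r).zero.obj A)
  commShift_eq : ∀ (r : ℝ) (A : C.Zero),
    letI := S.hasShift
    ((S.commShift r).commShiftIso 1).hom.app A = eqToHom (T_comm r A)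

end TPC

/-! ### The degree-`0` cohomology category -/

namespace FilteredComplex

variable {k : Type w} [Field k] (C : FilteredComplex.{w, v} k)

/-- The degree-`0` cocycles of `X^{≤ r}`. -/
def cocycles (r : ℝ) : Submodule k C.X := C.deg 0 ⊓ LinearMap.ker C.d ⊓ C.fil r

/-- The degree-`0` coboundaries of `X^{≤ r}`: the differentials of its degree `-1` elements. -/
def coboundaries (r : ℝ) : Submodule k C.X := (C.deg (-1) ⊓ C.fil r).map C.d

/-- `H^0(X^{≤ r})`. -/
abbrev cohomology (r : ℝ) : Type v :=
  C.cocycles r ⧸ (C.coboundaries r).submoduleOf (C.cocycles r)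

theorem fil_mono {r s : ℝ} (h : r ≤ s) : C.fil r ≤ C.fil s := fun _ hx =>
  le_trans hx (WithBot.coe_le_coe.2 h)

theorem cocycles_mono {r s : ℝ} (h : r ≤ s) : C.cocycles r ≤ C.cocycles s :=
  inf_le_inf le_rfl (C.fil_mono h)

theorem coboundaries_mono {r s : ℝ} (h : r ≤ s) : C.coboundaries r ≤ C.coboundaries s :=
  Submodule.map_mono (inf_le_inf le_rfl (C.fil_mono h))

/-- The structure map `H^0(X^{≤ r}) → H^0(X^{≤ s})` induced by the inclusion. -/
def cohomologyMap {r s : ℝ} (h : r ≤ s) : C.cohomology r →ₗ[k] C.cohomology s :=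
  Submodule.mapQ _ _ (Submodule.inclusion (C.cocycles_mono h)) fun _ hx =>
    C.coboundaries_mono h hx

end FilteredComplex

namespace FilteredDGCat

open FilteredComplex

variable {k : Type w} [Field k] (A : FilteredDGCat.{w, u, v} k)

variable {A} in
theorem comp_cocycles {X Y Z : A.Obj} {r s : ℝ} {f : (A.Hom X Y).X} {g : (A.Hom Y Z).X}
    (hf : f ∈ (A.Hom X Y).cocycles r) (hg : g ∈ (A.Hom Y Z).cocycles s) :
    A.comp g f ∈ (A.Hom X Z).cocycles (r + s) := by
  obtain ⟨⟨hf0, hfd⟩, hfl⟩ := hf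
  obtain ⟨⟨hg0, hgd⟩, hgl⟩ := hg
  refine ⟨⟨?_, ?_⟩, ?_⟩
  · simpa using A.comp_deg hg0 hf0
  · change (A.Hom X Z).d (A.comp g f) = 0
    rw [A.leibniz f hg0, LinearMap.mem_ker.1 hfd, LinearMap.mem_ker.1 hgd]
    simp
  · refine (A.comp_ℓ g f).trans ?_
    rw [add_comm, WithBot.coe_add]
    exact add_le_add hfl hgl

variable {A} in
theorem comp_coboundaries_left {X Y Z : A.Obj} {r s : ℝ} {f : (A.Hom X Y).X}
    {g : (A.Hom Y Z).X} (hf : f ∈ (A.Hom X Y).coboundaries r)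
    (hg : g ∈ (A.Hom Y Z).cocycles s) : A.comp g f ∈ (A.Hom X Z).coboundaries (r + s) := by
  obtain ⟨h, ⟨hh, hhl⟩, rfl⟩ := hf
  obtain ⟨⟨hg0, hgd⟩, hgl⟩ := hg
  refine ⟨A.comp g h, ⟨?_, ?_⟩, ?_⟩
  · simpa using A.comp_deg hg0 hh
  · refine (A.comp_ℓ g h).trans ?_
    rw [add_comm, WithBot.coe_add]
    exact add_le_add hhl hgl
  · rw [A.leibniz h hg0, LinearMap.mem_ker.1 hgd]
    simp

variable {A} in
theorem comp_coboundaries_right {X Y Z : A.Obj} {r s : ℝ} {f : (A.Hom X Y).X}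
    {g : (A.Hom Y Z).X} (hf : f ∈ (A.Hom X Y).cocycles r)
    (hg : g ∈ (A.Hom Y Z).coboundaries s) : A.comp g f ∈ (A.Hom X Z).coboundaries (r + s) := by
  obtain ⟨h, ⟨hh, hhl⟩, rfl⟩ := hg
  obtain ⟨⟨hf0, hfd⟩, hfl⟩ := hf
  refine ⟨A.comp h f, ⟨?_, ?_⟩, ?_⟩
  · simpa using A.comp_deg hh hf0
  · refine (A.comp_ℓ h f).trans ?_
    rw [add_comm, WithBot.coe_add]
    exact add_le_add hfl hhl
  · rw [A.leibniz f hh, LinearMap.mem_ker.1 hfd]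
    simp

/-- Composition of cocycles, with values in cohomology. -/
def cocycleComp (X Y Z : A.Obj) (r s : ℝ) :
    (A.Hom X Y).cocycles r →ₗ[k] (A.Hom Y Z).cocycles s →ₗ[k] (A.Hom X Z).cohomology (r + s) :=
  LinearMap.mk₂ k
    (fun f g => Submodule.Quotient.mk ⟨A.comp g.1 f.1, comp_cocycles f.2 g.2⟩)
    (fun f f' g => by
      rw [← Submodule.Quotient.mk_add]
      exact congrArg _ (Subtype.ext (map_add _ _ _)))
    (fun c f g => by
      rw [← Submodule.Quotient.mk_smul]
      exact congrArg _ (Subtype.ext (map_smul _ _ _)))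
    (fun f g g' => by
      rw [← Submodule.Quotient.mk_add]
      exact congrArg _ (Subtype.ext (LinearMap.map_add₂ _ _ _ _)))
    (fun c f g => by
      rw [← Submodule.Quotient.mk_smul]
      exact congrArg _ (Subtype.ext (LinearMap.map_smul₂ _ _ _ _)))

/-- Composition of cohomology classes. -/
def cohomologyComp (X Y Z : A.Obj) (r s : ℝ) :
    (A.Hom X Y).cohomology r →ₗ[k] (A.Hom Y Z).cohomology s →ₗ[k]
      (A.Hom X Z).cohomology (r + s) :=
  (Submodule.liftQ _ (Submodule.liftQ _ (A.cocycleComp X Y Z r s) (by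
    intro f hf
    refine LinearMap.ext fun g => ?_
    exact (Submodule.Quotient.mk_eq_zero _).2 (comp_coboundaries_left hf g.2))).flip (by
    intro g hg
    refine LinearMap.ext fun f => ?_
    obtain ⟨f, rfl⟩ := Submodule.Quotient.mk_surjective _ f
    exact (Submodule.Quotient.mk_eq_zero _).2 (comp_coboundaries_right f.2 hg))).flip

variable {A} in
/-- The class in `H^0(Hom^{≤ r})` of a cocycle. -/
def cls {X Y : A.Obj} {r : ℝ} (f : (A.Hom X Y).X) (hf : f ∈ (A.Hom X Y).cocycles r) :
    (A.Hom X Y).cohomology r := Submodule.Quotient.mk ⟨f, hf⟩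

theorem id_mem_cocycles (X : A.Obj) : A.id X ∈ (A.Hom X X).cocycles 0 :=
  ⟨⟨A.id_deg X, A.id_closed X⟩, A.id_ℓ X⟩

/-- The degree-`0` cohomology category of a filtered dg-category, as a persistence category:
`Mor^r(X, Y) = H^0(Hom^{≤ r}(X, Y))`. -/
def H0 : PersistenceCategory.{w, u, v} k where
  Obj := A.Obj
  Mor r X Y := (A.Hom X Y).cohomology r
  i h := cohomologyMap _ h
  i_refl f := by
    obtain ⟨f, rfl⟩ := Submodule.Quotient.mk_surjective _ f
    rfl
  i_trans h h' f := by
    obtain ⟨f, rfl⟩ := Submodule.Quotient.mk_surjective _ f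
    rfl
  id X := cls (A.id X) (A.id_mem_cocycles X)
  comp {X Y Z r s} := A.cohomologyComp X Y Z r s
  comp_i h h' f g := by
    obtain ⟨f, rfl⟩ := Submodule.Quotient.mk_surjective _ f
    obtain ⟨g, rfl⟩ := Submodule.Quotient.mk_surjective _ g
    rfl
  id_comp f := by
    obtain ⟨f, rfl⟩ := Submodule.Quotient.mk_surjective _ f
    exact congrArg Submodule.Quotient.mk (Subtype.ext (A.comp_id f.1))
  comp_id f := by
    obtain ⟨f, rfl⟩ := Submodule.Quotient.mk_surjective _ f
    exact congrArg Submodule.Quotient.mk (Subtype.ext (A.id_comp f.1))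
  assoc f g h := by
    obtain ⟨f, rfl⟩ := Submodule.Quotient.mk_surjective _ f
    obtain ⟨g, rfl⟩ := Submodule.Quotient.mk_surjective _ g
    obtain ⟨h, rfl⟩ := Submodule.Quotient.mk_surjective _ h
    exact congrArg Submodule.Quotient.mk (Subtype.ext (A.assoc h.1 g.1 f.1).symm)

/-! ### Shifts, suspension and cones of twisted complexes -/

variable {A}

/-- `Σ^r` on objects of `ΣA`. -/
def sigSigma (r : ℝ) (X : A.Sig.Obj) : A.Sig.Obj :=
  SigObj.mk (A := A) (SigObj.obj X) (SigObj.r X + r) (SigObj.d X)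

/-- `X ↦ X[-1]` on objects of `ΣA`. -/
def sigSusp (X : A.Sig.Obj) : A.Sig.Obj :=
  SigObj.mk (A := A) (SigObj.obj X) (SigObj.r X) (SigObj.d X - 1)

theorem sigSigma_ℓ (r s : ℝ) (X Y : A.Sig.Obj) (f : (A.Sig.Hom X Y).X) :
    (A.Sig.Hom (sigSigma r X) (sigSigma s Y)).ℓ f =
      (A.Sig.Hom X Y).ℓ f + ((s - r : ℝ) : WithBot ℝ) := by
  obtain ⟨X, a, c⟩ := X
  obtain ⟨Y, b, d⟩ := Y
  change (A.Hom X Y).ℓ f + ((b + s - (a + r) : ℝ) : WithBot ℝ) =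
    ((A.Hom X Y).ℓ f + ((b - a : ℝ) : WithBot ℝ)) + ((s - r : ℝ) : WithBot ℝ)
  rw [add_assoc, ← WithBot.coe_add]
  congr 2
  ring

theorem sigSusp_deg {X Y : A.Sig.Obj} {f : (A.Sig.Hom X Y).X} {n : ℤ} :
    f ∈ (A.Sig.Hom (sigSusp X) (sigSusp Y)).deg n ↔ f ∈ (A.Sig.Hom X Y).deg n := by
  obtain ⟨X, a, c⟩ := X
  obtain ⟨Y, b, d⟩ := Y
  change f ∈ (A.Hom X Y).deg (n - (d - 1 - (c - 1))) ↔ f ∈ (A.Hom X Y).deg (n - (d - c))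
  rw [sub_sub_sub_cancel_right]

theorem sigSusp_deg' {X Y : A.Sig.Obj} {f : (A.Sig.Hom X Y).X} {n : ℤ}
    (hf : f ∈ (A.Sig.Hom X Y).deg n) : f ∈ (A.Sig.Hom (sigSusp X) Y).deg (n + 1) := by
  obtain ⟨X, a, c⟩ := X
  obtain ⟨Y, b, d⟩ := Y
  change f ∈ (A.Hom X Y).deg (n + 1 - (d - (c - 1)))
  change f ∈ (A.Hom X Y).deg (n - (d - c)) at hf
  rwa [show n + 1 - (d - (c - 1)) = n - (d - c) by ring]

theorem sigSusp_d {X Y : A.Sig.Obj} (f : (A.Sig.Hom X Y).X) :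
    (A.Sig.Hom (sigSusp X) (sigSusp Y)).d (-f) = (A.Sig.Hom X Y).d f := by
  obtain ⟨X, a, c⟩ := X
  obtain ⟨Y, b, d⟩ := Y
  change (((d - 1).negOnePow : ℤ) : k) • (A.Hom X Y).d (-f) =
    ((d.negOnePow : ℤ) : k) • (A.Hom X Y).d f
  refine (congrArg _ (map_neg (A.Hom X Y).d f)).trans ?_
  rw [sign_sub]
  simp
  rfl

theorem sig_neg_comp_neg {X Y Z : A.Sig.Obj} (g : (A.Sig.Hom Y Z).X) (f : (A.Sig.Hom X Y).X) :
    A.Sig.comp (-g) (-f) = A.Sig.comp g f := by simp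

namespace TwObj

theorem D_entry {B : FilteredDGCat.{w, u, v} k} {X Y : TwObj B}
    {f : (B.matComplex X.obj Y.obj).X} (h0 : f ∈ (B.matComplex X.obj Y.obj).deg 0)
    (hd : D X Y f = 0) (i : Fin Y.n) (j : Fin X.n) :
    (B.Hom (X.obj j) (Y.obj i)).d (f i j) + ∑ c, B.comp (Y.q i c) (f c j) -
      ∑ c, B.comp (f i c) (X.q c j) = 0 := by
  rw [D_apply, sgn_of_mem h0, Int.negOnePow_zero, one_smul] at hd
  exact congrFun (congrFun hd i) j

theorem D_of_q_zero {B : FilteredDGCat.{w, u, v} k} {X Y : TwObj B} (hX : X.qm = 0)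
    (hY : Y.qm = 0) (f : (B.matComplex X.obj Y.obj).X) :
    D X Y f = (B.matComplex X.obj Y.obj).d f := by
  rw [D_apply, hX, hY, map_zero, map_zero, LinearMap.zero_apply, add_zero, sub_zero]

/-- The twisted complex `Σ^r X`. -/
def sigma (r : ℝ) (X : TwObj A.Sig) : TwObj A.Sig where
  n := X.n
  obj i := sigSigma r (X.obj i)
  q := X.q
  q_deg := X.q_deg
  q_onesided := X.q_onesided
  q_mc := X.q_mc
  q_ℓ i j := by
    refine (sigSigma_ℓ r r _ _ (X.q i j)).trans_le ?_
    rw [sub_self, WithBot.coe_zero, add_zero]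
    exact X.q_ℓ i j

/-- The twisted complex `X[-1]`.  Since the differentials of `ΣA` carry the sign of the target
degree, the structure map changes its sign. -/
def susp (X : TwObj A.Sig) : TwObj A.Sig where
  n := X.n
  obj i := sigSusp (X.obj i)
  q i j := (-X.q i j : (A.Sig.Hom (X.obj j) (X.obj i)).X)
  q_deg i j := sigSusp_deg.2 (Submodule.neg_mem _ (X.q_deg i j))
  q_onesided i j h := neg_eq_zero.2 (X.q_onesided i j h)
  q_mc i j := by
    refine Eq.trans ?_ (X.q_mc i j)
    refine congrArg₂ (fun x y : (A.Sig.Hom (X.obj j) (X.obj i)).X => x + y)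
      (sigSusp_d (X.q i j)) ?_
    exact Finset.sum_congr rfl fun c _ => sig_neg_comp_neg (X.q i c) (X.q c j)
  q_ℓ i j := by
    exact (ℓ_neg (C := A.Sig.Hom (X.obj j) (X.obj i)) _).trans (X.q_ℓ i j)

variable (X Y : TwObj A.Sig)

/-- The summands of a cone `Y ⊕ X[-1]`, indexed by a sum type. -/
def coneObj : Fin Y.n ⊕ Fin X.n → A.Sig.Obj
  | .inl i => Y.obj i
  | .inr j => sigSusp (X.obj j)

variable {X Y} in
/-- The block matrix `(q', f; 0, q)`, where `q` is the structure map of `X[-1]`. -/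
def coneQ (f : (A.Sig.matComplex X.obj Y.obj).X) :
    ∀ a b : Fin Y.n ⊕ Fin X.n, (A.Sig.Hom (coneObj X Y b) (coneObj X Y a)).X
  | .inl i, .inl j => Y.q i j
  | .inl i, .inr j => f i j
  | .inr _, .inl _ => 0
  | .inr i, .inr j => X.susp.q i j

theorem coneQ_mc {f : (A.Sig.matComplex X.obj Y.obj).X} (hf : f ∈ (homComplex X Y).cocycles 0)
    (a b) : (A.Sig.Hom (coneObj X Y b) (coneObj X Y a)).d (coneQ f a b) +
      ∑ c, A.Sig.comp (coneQ f a c) (coneQ f c b) = 0 := by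
  rw [Fintype.sum_sum_type]
  rcases a with i | i <;> rcases b with j | j
  · have h2 : ∑ c, A.Sig.comp (coneQ f (.inl i) (.inr c)) (coneQ f (.inr c) (.inl j)) = 0 :=
      Finset.sum_eq_zero fun c _ => map_zero _
    rw [h2, add_zero]
    exact Y.q_mc i j
  · have hij := D_entry hf.1.1 hf.1.2 i j
    have h2 : ∑ c, A.Sig.comp (coneQ f (.inl i) (.inr c)) (coneQ f (.inr c) (.inr j)) =
        -∑ c, A.Sig.comp (f i c) (X.q c j) := by
      rw [← Finset.sum_neg_distrib]
      exact Finset.sum_congr rfl fun c _ =>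
        map_neg (A.Sig.comp (A := X.obj j) (B := X.obj c) (C := Y.obj i) (f i c)) (X.q c j)
    rw [h2]
    refine Eq.trans ?_ hij
    refine Eq.trans ?_ (sub_eq_add_neg _ _).symm
    exact (add_assoc _ _ _).symm
  · have h1 : ∑ c, A.Sig.comp (coneQ f (.inr i) (.inl c)) (coneQ f (.inl c) (.inl j)) = 0 :=
      Finset.sum_eq_zero fun c _ => LinearMap.map_zero₂ _ _
    have h2 : ∑ c, A.Sig.comp (coneQ f (.inr i) (.inr c)) (coneQ f (.inr c) (.inl j)) = 0 :=
      Finset.sum_eq_zero fun c _ => map_zero _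
    rw [h1, h2, add_zero, add_zero]
    exact map_zero _
  · have h1 : ∑ c, A.Sig.comp (coneQ f (.inr i) (.inl c)) (coneQ f (.inl c) (.inr j)) = 0 :=
      Finset.sum_eq_zero fun c _ => LinearMap.map_zero₂ _ _
    rw [h1, zero_add]
    exact X.susp.q_mc i j

theorem coneQ_deg {f : (A.Sig.matComplex X.obj Y.obj).X} (hf : f ∈ (homComplex X Y).cocycles 0) :
    ∀ a b, coneQ f a b ∈ (A.Sig.Hom (coneObj X Y b) (coneObj X Y a)).deg 1
  | .inl i, .inl j => Y.q_deg i j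
  | .inl i, .inr j => by
    have := sigSusp_deg' (mat_mem_deg.1 hf.1.1 i j)
    rwa [zero_add] at this
  | .inr _, .inl _ => Submodule.zero_mem _
  | .inr i, .inr j => X.susp.q_deg i j

theorem coneQ_ℓ {f : (A.Sig.matComplex X.obj Y.obj).X} (hf : f ∈ (homComplex X Y).cocycles 0) :
    ∀ a b, (A.Sig.Hom (coneObj X Y b) (coneObj X Y a)).ℓ (coneQ f a b) ≤ 0
  | .inl i, .inl j => Y.q_ℓ i j
  | .inl i, .inr j => (entry_ℓ_le f i j).trans hf.2
  | .inr _, .inl _ => ℓ_zero.trans_le bot_le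
  | .inr i, .inr j => X.susp.q_ℓ i j

theorem coneQ_onesided (f : (A.Sig.matComplex X.obj Y.obj).X) (a b : Fin Y.n ⊕ Fin X.n)
    (h : finSumFinEquiv b ≤ finSumFinEquiv a) : coneQ f a b = 0 := by
  rcases a with i | i <;> rcases b with j | j
  · exact Y.q_onesided i j (Fin.le_def.2 (by
      have := Fin.le_def.1 h
      simpa only [finSumFinEquiv_apply_left, finSumFinEquiv_apply_right, Fin.val_castAdd,
        Fin.val_natAdd, add_le_add_iff_left] using this))
  · exfalso
    simp only [finSumFinEquiv_apply_left, finSumFinEquiv_apply_right, Fin.le_def,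
      Fin.val_castAdd, Fin.val_natAdd] at h
    omega
  · rfl
  · exact X.susp.q_onesided i j (Fin.le_def.2 (by
      have := Fin.le_def.1 h
      simpa only [finSumFinEquiv_apply_left, finSumFinEquiv_apply_right, Fin.val_castAdd,
        Fin.val_natAdd, add_le_add_iff_left] using this))

variable {X Y}

/-- The `0`-filtered mapping cone of a closed degree-`0` morphism `f : X ⟶ Y` with `ℓ f ≤ 0`:
the twisted complex `Y ⊕ X[-1]` with the structure map `(q', f; 0, q)`. -/
def cone (f : (A.Sig.matComplex X.obj Y.obj).X) (hf : f ∈ (homComplex X Y).cocycles 0) :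
    TwObj A.Sig where
  n := Y.n + X.n
  obj a := coneObj X Y (finSumFinEquiv.symm a)
  q a b := coneQ f (finSumFinEquiv.symm a) (finSumFinEquiv.symm b)
  q_deg a b := coneQ_deg X Y hf _ _
  q_onesided a b h := coneQ_onesided X Y f _ _ (by simpa using h)
  q_mc a b := by
    refine Eq.trans ?_ (coneQ_mc X Y hf (finSumFinEquiv.symm a) (finSumFinEquiv.symm b))
    refine congrArg _ ?_
    exact Equiv.sum_comp finSumFinEquiv.symm fun c =>
      A.Sig.comp (coneQ f (finSumFinEquiv.symm a) c) (coneQ f c (finSumFinEquiv.symm b))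
  q_ℓ a b := coneQ_ℓ X Y hf _ _

variable (X Y) in
/-- The rows of the inclusion `Y ⟶ Y ⊕ X[-1]`. -/
def coneIncRow : ∀ (a : Fin Y.n ⊕ Fin X.n) (j : Fin Y.n),
    (A.Sig.Hom (Y.obj j) (coneObj X Y a)).X
  | .inl i, j => matOne Y.obj i j
  | .inr _, _ => 0

variable (X Y) in
/-- The columns of the projection `Y ⊕ X[-1] ⟶ X[-1]`. -/
def coneProjCol : ∀ (i : Fin X.n) (b : Fin Y.n ⊕ Fin X.n),
    (A.Sig.Hom (coneObj X Y b) (X.susp.obj i)).X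
  | _, .inl _ => 0
  | i, .inr j => matOne X.susp.obj i j

/-- The matrix of the inclusion `Y ⟶ cone f`. -/
def coneInc (f : (A.Sig.matComplex X.obj Y.obj).X) (hf : f ∈ (homComplex X Y).cocycles 0) :
    (homComplex Y (cone f hf)).X :=
  fun a j => coneIncRow X Y (finSumFinEquiv.symm a) j

/-- The matrix of the projection `cone f ⟶ X[-1]`. -/
def coneProj (f : (A.Sig.matComplex X.obj Y.obj).X) (hf : f ∈ (homComplex X Y).cocycles 0) :
    (homComplex (cone f hf) X.susp).X :=
  fun i b => coneProjCol X Y i (finSumFinEquiv.symm b)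

end TwObj

/-! ### Filtered pre-triangulated dg-categories -/

/-- A filtered dg-functor. -/
structure DGFunctor (A : FilteredDGCat.{w, u, v} k) (B : FilteredDGCat.{w, max u v, v} k) where
  obj : A.Obj → B.Obj
  map : ∀ {X Y : A.Obj}, (A.Hom X Y).X →ₗ[k] (B.Hom (obj X) (obj Y)).X
  map_id : ∀ X, map (A.id X) = B.id (obj X)
  map_comp : ∀ {X Y Z} (g : (A.Hom Y Z).X) (f : (A.Hom X Y).X),
    map (A.comp g f) = B.comp (map g) (map f)
  map_deg : ∀ {X Y} {n : ℤ} {f : (A.Hom X Y).X}, f ∈ (A.Hom X Y).deg n →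
    map f ∈ (B.Hom (obj X) (obj Y)).deg n
  map_d : ∀ {X Y} (f : (A.Hom X Y).X), map ((A.Hom X Y).d f) = (B.Hom (obj X) (obj Y)).d (map f)
  map_ℓ : ∀ {X Y} (f : (A.Hom X Y).X), (B.Hom (obj X) (obj Y)).ℓ (map f) ≤ (A.Hom X Y).ℓ f

/-- Two objects of a filtered dg-category are isomorphic: there are mutually inverse closed
morphisms of degree `0` with `ℓ ≤ 0`. -/
def Isomorphic (A : FilteredDGCat.{w, u, v} k) (X Y : A.Obj) : Prop :=
  ∃ f ∈ (A.Hom X Y).cocycles 0, ∃ g ∈ (A.Hom Y X).cocycles 0,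
    A.comp g f = A.id X ∧ A.comp f g = A.id Y

/-- A filtered dg-functor is an equivalence of filtered dg-categories if it is an isomorphism of
filtered complexes on morphisms and essentially surjective. -/
def DGFunctor.IsEquivalence {A : FilteredDGCat.{w, u, v} k} {B : FilteredDGCat.{w, max u v, v} k}
    (F : DGFunctor A B) : Prop :=
  (∀ X Y : A.Obj, Function.Bijective (F.map : (A.Hom X Y).X →ₗ[k] _) ∧
    ∀ f : (A.Hom X Y).X, (B.Hom (F.obj X) (F.obj Y)).ℓ (F.map f) = (A.Hom X Y).ℓ f) ∧
  ∀ Y : B.Obj, ∃ X : A.Obj, B.Isomorphic (F.obj X) Y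

variable (A)

/-- An object of `A` as a twisted complex with one summand and `q = 0`. -/
def inclObj (X : A.Obj) : TwObj A.Sig where
  n := 1
  obj _ := SigObj.mk (A := A) X 0 0
  q _ _ := 0
  q_deg _ _ := Submodule.zero_mem _
  q_onesided _ _ _ := rfl
  q_mc i j := by simp
  q_ℓ _ _ := ℓ_zero.trans_le bot_le

theorem incl_mem_deg {X Y : A.Obj} {n : ℤ} {f : (A.Hom X Y).X} (hf : f ∈ (A.Hom X Y).deg n) :
    f ∈ (A.Sig.Hom (SigObj.mk (A := A) X 0 0) (SigObj.mk (A := A) Y 0 0)).deg n := by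
  change f ∈ (A.Hom X Y).deg (n - (0 - 0))
  rwa [sub_self, sub_zero]

theorem incl_ℓ {X Y : A.Obj} (f : (A.Hom X Y).X) :
    (A.Sig.Hom (SigObj.mk (A := A) X 0 0) (SigObj.mk (A := A) Y 0 0)).ℓ f = (A.Hom X Y).ℓ f := by
  change (A.Hom X Y).ℓ f + ((0 - 0 : ℝ) : WithBot ℝ) = _
  rw [sub_self, WithBot.coe_zero, add_zero]

theorem incl_d {X Y : A.Obj} (f : (A.Hom X Y).X) :
    (A.Sig.Hom (SigObj.mk (A := A) X 0 0) (SigObj.mk (A := A) Y 0 0)).d f = (A.Hom X Y).d f := by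
  change (((0 : ℤ).negOnePow : ℤ) : k) • (A.Hom X Y).d f = _
  simp

theorem incl_qm (X : A.Obj) : (A.inclObj X).qm = 0 := rfl

theorem incl_D {X Y : A.Obj} (f : (A.Hom X Y).X) (i : Fin 1) (j : Fin 1) :
    TwObj.D (A.inclObj X) (A.inclObj Y) (fun _ _ => f) i j = (A.Hom X Y).d f := by
  exact (congrFun (congrFun (TwObj.D_of_q_zero (A.incl_qm X) (A.incl_qm Y) _) i) j).trans
    (A.incl_d f)

/-- The inclusion `A ↪ Tw(A)`. -/
def incl : DGFunctor A A.Tw where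
  obj X := A.inclObj X
  map {X Y} := LinearMap.pi fun _ => LinearMap.pi fun _ => LinearMap.id
  map_id X := by
    funext i j
    obtain rfl : i = j := Subsingleton.elim (α := Fin 1) i j
    exact (matOne_self (B := A.Sig) (X := (A.inclObj X).obj) i).symm
  map_comp {X Y Z} g f := by
    funext i j
    exact (Fin.sum_univ_one (fun _ => A.comp g f)).symm
  map_deg hf := mat_mem_deg.2 fun _ _ => A.incl_mem_deg hf
  map_d {X Y} f := by
    funext i j
    exact (A.incl_D f i j).symm
  map_ℓ f := mat_ℓ_le.2 fun _ _ => (A.incl_ℓ f).le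

/-- `A` is (filtered) pre-triangulated if the inclusion `A ↪ Tw(A)` is an equivalence of filtered
dg-categories. -/
def IsPretriangulated : Prop := A.incl.IsEquivalence

end FilteredDGCat

/-! ### The filtered dg-category of filtered cochain complexes -/

namespace FilteredComplex

variable {k : Type w} [Field k] {X Y Z : FilteredComplex.{w, v} k}

/-- `f : X → Y` raises the filtration level by at most `r`. -/
def Bound (f : X.X →ₗ[k] Y.X) (r : ℝ) : Prop := ∀ x, Y.ℓ (f x) ≤ X.ℓ x + (r : WithBot ℝ)

theorem Bound.zero (r : ℝ) : Bound (0 : X.X →ₗ[k] Y.X) r := fun x => by simp [ℓ_zero]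

theorem Bound.mono {f : X.X →ₗ[k] Y.X} {r s : ℝ} (hf : Bound f r) (h : r ≤ s) : Bound f s :=
  fun x => (hf x).trans (add_le_add le_rfl (WithBot.coe_le_coe.2 h))

theorem Bound.smul_add {f g : X.X →ₗ[k] Y.X} {r : ℝ} (hf : Bound f r) (hg : Bound g r) (c : k) :
    Bound (c • f + g) r := fun x =>
  (ℓ_add _ _).trans (max_le ((ℓ_smul _ _).trans (hf x)) (hg x))

theorem Bound.comp {g : Y.X →ₗ[k] Z.X} {f : X.X →ₗ[k] Y.X} {r s : ℝ} (hg : Bound g s)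
    (hf : Bound f r) : Bound (g ∘ₗ f) (s + r) := fun x => by
  refine (hg _).trans ?_
  rw [add_comm s r, WithBot.coe_add, ← add_assoc]
  gcongr
  exact hf x

theorem bound_sgn : Bound X.sgn 0 := fun x => by simpa using ℓ_sgn x

theorem bound_d : Bound X.d 0 := fun x => by simpa using X.ℓ_d x

theorem bound_of_homogeneous {f : X.X →ₗ[k] Y.X} {r : ℝ}
    (h : ∀ p, ∀ x ∈ X.deg p, Y.ℓ (f x) ≤ X.ℓ x + (r : WithBot ℝ)) : Bound f r := fun x => by
  obtain ⟨c, hc, rfl⟩ := exists_decomp x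
  rw [Finsupp.sum, map_sum]
  refine ℓ_sum _ _ _ fun p _ => (h p _ (hc p)).trans ?_
  gcongr
  exact X.ℓ_component c hc p

/-- The filtration function of a linear map: `ℓ(f) = inf {r | ∀ x, ℓ(f x) ≤ ℓ(x) + r}`, which is
`-∞` for `f = 0`. -/
def homℓ (f : X.X →ₗ[k] Y.X) : WithBot ℝ :=
  open Classical in if f = 0 then ⊥ else ((sInf {r : ℝ | Bound f r} : ℝ) : WithBot ℝ)

theorem exists_lower {f : X.X →ₗ[k] Y.X} (x : X.X) (hx : f x ≠ 0) :
    ∃ a b : ℝ, X.ℓ x = a ∧ Y.ℓ (f x) = b := by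
  have h1 : X.ℓ x ≠ ⊥ := fun h => hx (by rw [(X.ℓ_eq_bot x).1 h, map_zero])
  have h2 : Y.ℓ (f x) ≠ ⊥ := fun h => hx ((Y.ℓ_eq_bot _).1 h)
  obtain ⟨a, ha⟩ := WithBot.ne_bot_iff_exists.1 h1
  obtain ⟨b, hb⟩ := WithBot.ne_bot_iff_exists.1 h2
  exact ⟨a, b, ha.symm, hb.symm⟩

theorem homℓ_le {f : X.X →ₗ[k] Y.X} (hf : ∃ s, Bound f s) {r : ℝ} :
    homℓ f ≤ (r : WithBot ℝ) ↔ Bound f r := by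
  classical
  rw [homℓ]
  split_ifs with h
  · subst h; simp [Bound.zero]
  · rw [WithBot.coe_le_coe]
    constructor
    · intro hr
      refine Bound.mono (fun x => ?_) hr
      by_cases hx : f x = 0
      · simp [hx, ℓ_zero]
      obtain ⟨a, b, ha, hb⟩ := exists_lower x hx
      rw [ha, hb, ← WithBot.coe_add, WithBot.coe_le_coe]
      have : b - a ≤ sInf {r : ℝ | Bound f r} := le_csInf hf fun s hs => by
        have := hs x
        rw [ha, hb, ← WithBot.coe_add, WithBot.coe_le_coe] at this
        linarith
      linarith
    · intro hr
      refine csInf_le ?_ hr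
      obtain ⟨x, hx⟩ : ∃ x, f x ≠ 0 := by
        by_contra! hcon
        exact h (LinearMap.ext hcon)
      obtain ⟨a, b, ha, hb⟩ := exists_lower x hx
      refine ⟨b - a, fun s hs => ?_⟩
      have := hs x
      rw [ha, hb, ← WithBot.coe_add, WithBot.coe_le_coe] at this
      linarith

theorem le_of_forall_real {a b : WithBot ℝ} (h : ∀ r : ℝ, a ≤ r → b ≤ r) : b ≤ a := by
  induction a with
  | bot =>
    induction b with
    | bot => exact le_rfl
    | coe b =>
      have := h (b - 1) bot_le
      rw [WithBot.coe_le_coe] at this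
      linarith
  | coe a => exact h a le_rfl

theorem homℓ_eq_bot {f : X.X →ₗ[k] Y.X} : homℓ f = ⊥ ↔ f = 0 := by
  classical
  rw [homℓ]
  split_ifs with h <;> simp [h]

variable (X Y) in
/-- The linear maps of degree `n` and of finite filtration level. -/
def homDeg (n : ℤ) : Submodule k (X.X →ₗ[k] Y.X) where
  carrier := {f | (∃ r, Bound f r) ∧ ∀ p, ∀ x ∈ X.deg p, f x ∈ Y.deg (p + n)}
  zero_mem' := ⟨⟨0, Bound.zero 0⟩, fun _ _ _ => Submodule.zero_mem _⟩
  add_mem' {f g} := by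
    rintro ⟨⟨r, hr⟩, hf⟩ ⟨⟨s, hs⟩, hg⟩
    refine ⟨⟨max r s, ?_⟩, fun p x hx => Submodule.add_mem _ (hf p x hx) (hg p x hx)⟩
    simpa using (hr.mono (le_max_left r s)).smul_add (hs.mono (le_max_right r s)) 1
  smul_mem' c f := by
    rintro ⟨⟨r, hr⟩, hf⟩
    refine ⟨⟨r, ?_⟩, fun p x hx => Submodule.smul_mem _ _ (hf p x hx)⟩
    simpa using hr.smul_add (Bound.zero r) c

variable (X Y) in
/-- The space of finite sums of homogeneous linear maps of finite filtration level. -/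
def homTotal : Submodule k (X.X →ₗ[k] Y.X) := ⨆ n, homDeg X Y n

theorem exists_bound {f : X.X →ₗ[k] Y.X} (hf : f ∈ homTotal X Y) : ∃ r, Bound f r := by
  refine Submodule.iSup_induction (homDeg X Y) (motive := fun f => ∃ r, Bound f r) hf
    (fun n f hf => hf.1) ⟨0, Bound.zero 0⟩ ?_
  rintro f g ⟨r, hr⟩ ⟨s, hs⟩
  refine ⟨max r s, ?_⟩
  simpa using (hr.mono (le_max_left r s)).smul_add (hs.mono (le_max_right r s)) 1

variable (X Y) in
/-- The differential `f ↦ ∂ ∘ f - (-1)^{|f|} f ∘ ∂` on linear maps; the sign is written as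
`(-1)^{|f|} f = sgn ∘ f ∘ sgn`. -/
def homD : (X.X →ₗ[k] Y.X) →ₗ[k] (X.X →ₗ[k] Y.X) where
  toFun f := Y.d ∘ₗ f - Y.sgn ∘ₗ f ∘ₗ X.sgn ∘ₗ X.d
  map_add' f g := by ext x; simp; abel
  map_smul' c f := by ext x; simp [smul_sub]

theorem homD_of_mem {n : ℤ} {f : X.X →ₗ[k] Y.X} (hf : f ∈ homDeg X Y n) :
    homD X Y f = Y.d ∘ₗ f - n.negOnePow • (f ∘ₗ X.d) := by
  refine linear_ext fun p x hx => ?_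
  have h1 := X.d_deg hx
  have h2 : Y.sgn (f (X.sgn (X.d x))) = n.negOnePow • f (X.d x) := by
    rw [sgn_of_mem h1, ← negOnePow_smul, map_smul, map_smul, sgn_of_mem (hf.2 _ _ h1),
      ← negOnePow_smul, ← negOnePow_smul, smul_smul]
    congr 1
    rw [Int.negOnePow_add (p + 1) n]
    push_cast
    rw [← mul_assoc, FilteredDGCat.sign_mul_self, one_mul]
  change Y.d (f x) - Y.sgn (f (X.sgn (X.d x))) = Y.d (f x) - n.negOnePow • f (X.d x)
  rw [h2]

theorem Bound.homD {f : X.X →ₗ[k] Y.X} {r : ℝ} (hf : Bound f r) :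
    Bound (homD X Y f) r := by
  have h1 : Bound (Y.d ∘ₗ f) r := by simpa using bound_d.comp hf
  have h2 : Bound (Y.sgn ∘ₗ f ∘ₗ X.sgn ∘ₗ X.d) r := by
    simpa using bound_sgn.comp (hf.comp (bound_sgn.comp bound_d))
  have := h2.smul_add h1 (-1)
  rwa [neg_one_smul, neg_add_eq_sub] at this

theorem homD_mem_deg {n : ℤ} {f : X.X →ₗ[k] Y.X} (hf : f ∈ homDeg X Y n) :
    homD X Y f ∈ homDeg X Y (n + 1) := by
  obtain ⟨r, hr⟩ := hf.1
  refine ⟨⟨r, hr.homD⟩, fun p x hx => ?_⟩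
  refine Submodule.sub_mem _ ?_ ?_
  · have := Y.d_deg (hf.2 p x hx)
    rwa [add_assoc] at this
  · have := sgn_deg (hf.2 _ _ (sgn_deg (X.d_deg hx)))
    rwa [add_assoc, add_comm 1 n] at this

theorem homD_mem {f : X.X →ₗ[k] Y.X} (hf : f ∈ homTotal X Y) : homD X Y f ∈ homTotal X Y := by
  refine Submodule.iSup_induction (homDeg X Y) (motive := fun f => homD X Y f ∈ homTotal X Y) hf
    (fun n f hf => Submodule.mem_iSup_of_mem (n + 1) (homD_mem_deg hf)) ?_ ?_
  · rw [map_zero]; exact Submodule.zero_mem _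
  · intro f g hf hg
    rw [map_add]; exact Submodule.add_mem _ hf hg

theorem homD_homD (f : X.X →ₗ[k] Y.X) : homD X Y (homD X Y f) = 0 := by
  ext x
  simp [homD, X.d_d, Y.d_d, sgn_d, map_neg]

theorem component_bound {c : ℤ →₀ (X.X →ₗ[k] Y.X)} (hc : ∀ n, c n ∈ homDeg X Y n) {r : ℝ}
    (h : Bound (c.sum fun _ f => f) r) (n : ℤ) : Bound (c n) r := by
  refine bound_of_homogeneous fun p x hx => ?_
  let e : (X.X →ₗ[k] Y.X) →ₗ[k] Y.X := LinearMap.applyₗ x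
  let c₁ : ℤ →₀ Y.X := c.mapRange e (map_zero e)
  let c₂ : ℤ →₀ Y.X := c₁.embDomain (Equiv.addLeft p).toEmbedding
  have h1 : ∀ m, c₂ (p + m) = c m x := fun m =>
    Finsupp.embDomain_apply_self (Equiv.addLeft p).toEmbedding c₁ m
  have h2 : ∀ m, c₂ m ∈ Y.deg m := fun m => by
    have := (hc (m - p)).2 p x hx
    rw [← h1] at this
    simpa using this
  have h3 : (c₂.sum fun _ y => y) = (c.sum fun _ f => f) x := by
    rw [Finsupp.sum_embDomain, Finsupp.sum_mapRange_index (fun _ => rfl)]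
    exact (map_sum e _ _).symm
  have := Y.ℓ_component c₂ h2 (p + n)
  rw [h1, h3] at this
  exact this.trans (h x)

variable (X Y) in
/-- The filtered complex of morphisms between two filtered complexes. -/
def hom : FilteredComplex.{w, v} k where
  X := homTotal X Y
  deg n := (homDeg X Y n).submoduleOf (homTotal X Y)
  internal := by
    rw [DirectSum.isInternal_submodule_iff_iSupIndep_and_iSup_eq_top]
    constructor
    · intro n
      rw [Submodule.disjoint_def]
      intro f hf hf'
      refine Subtype.ext (linear_ext fun p x hx => ?_)
      let e : homTotal X Y →ₗ[k] Y.X := LinearMap.applyₗ x ∘ₗ (homTotal X Y).subtype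
      have h1 : e f ∈ Y.deg (p + n) := hf.2 p x hx
      have h2 : e f ∈ ⨆ q, ⨆ (_ : q ≠ p + n), Y.deg q := by
        have hm := Submodule.mem_map_of_mem (f := e) hf'
        simp only [Submodule.map_iSup] at hm
        have hle : (⨆ q, ⨆ (_ : q ≠ n), Submodule.map e
            ((homDeg X Y q).submoduleOf (homTotal X Y))) ≤
            ⨆ q, ⨆ (_ : q ≠ p + n), Y.deg q := by
          refine iSup₂_le fun q hq => ?_
          refine le_trans ?_ (le_iSup₂_of_le (p + q) (fun h => hq (add_left_cancel h)) le_rfl)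
          rintro _ ⟨g, hg, rfl⟩
          exact hg.2 p x hx
        exact hle hm
      exact Submodule.disjoint_def.1 (Y.internal.submodule_iSupIndep (p + n)) _ h1 h2
    · rw [eq_top_iff]
      rintro ⟨f, hf⟩ -
      refine Submodule.iSup_induction' (homDeg X Y) (motive := fun f hf =>
        (⟨f, hf⟩ : homTotal X Y) ∈ ⨆ n, (homDeg X Y n).submoduleOf (homTotal X Y))
        ?_ ?_ ?_ hf
      · exact fun n f hf => Submodule.mem_iSup_of_mem n hf
      · exact Submodule.zero_mem _
      · exact fun f g _ _ h h' => Submodule.add_mem _ h h'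
  d := (homD X Y).restrict fun _ => homD_mem
  d_deg hf := homD_mem_deg hf
  d_d f := Subtype.ext (homD_homD f.1)
  ℓ f := homℓ f.1
  ℓ_smul_add c f g _ := le_of_forall_real fun r hr => by
    rw [max_le_iff, homℓ_le (exists_bound f.2), homℓ_le (exists_bound g.2)] at hr
    exact (homℓ_le (exists_bound (c • f + g).2)).2 (hr.1.smul_add hr.2 c)
  ℓ_eq_bot f := homℓ_eq_bot.trans (by simp)
  ℓ_d f := le_of_forall_real fun r hr =>
    (homℓ_le ⟨r, ((homℓ_le (exists_bound f.2)).1 hr).homD⟩).2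
      ((homℓ_le (exists_bound f.2)).1 hr).homD
  ℓ_component c hc n := le_of_forall_real fun r hr => by
    rw [homℓ_le (exists_bound (Subtype.prop _))] at hr
    refine (homℓ_le (exists_bound (c n).2)).2 ?_
    refine component_bound (c := c.mapRange (homTotal X Y).subtype (map_zero _)) hc ?_ n
    rw [Finsupp.sum_mapRange_index (fun _ => rfl)]
    convert hr
    exact (map_sum (homTotal X Y).subtype _ _).symm

theorem comp_mem_homDeg {m n : ℤ} {g : Y.X →ₗ[k] Z.X} {f : X.X →ₗ[k] Y.X}
    (hg : g ∈ homDeg Y Z m) (hf : f ∈ homDeg X Y n) : g ∘ₗ f ∈ homDeg X Z (m + n) := by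
  obtain ⟨r, hr⟩ := hf.1
  obtain ⟨s, hs⟩ := hg.1
  refine ⟨⟨s + r, hs.comp hr⟩, fun p x hx => ?_⟩
  have := hg.2 _ _ (hf.2 p x hx)
  rwa [add_assoc, add_comm n m] at this

theorem comp_mem_homTotal {g : Y.X →ₗ[k] Z.X} {f : X.X →ₗ[k] Y.X} (hg : g ∈ homTotal Y Z)
    (hf : f ∈ homTotal X Y) : g ∘ₗ f ∈ homTotal X Z := by
  refine Submodule.iSup_induction (homDeg Y Z) (motive := fun g => g ∘ₗ f ∈ homTotal X Z) hg
    (fun m g hg => ?_) ?_ (fun g g' h h' => ?_)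
  · refine Submodule.iSup_induction (homDeg X Y) (motive := fun f => g ∘ₗ f ∈ homTotal X Z) hf
      (fun n f hf => Submodule.mem_iSup_of_mem (m + n) (comp_mem_homDeg hg hf)) ?_
      (fun f f' h h' => ?_)
    · rw [LinearMap.comp_zero]; exact Submodule.zero_mem _
    · rw [LinearMap.comp_add]; exact Submodule.add_mem _ h h'
  · rw [LinearMap.zero_comp]; exact Submodule.zero_mem _
  · rw [LinearMap.add_comp]; exact Submodule.add_mem _ h h'

theorem homD_comp {m : ℤ} {g : Y.X →ₗ[k] Z.X} (hg : g ∈ homDeg Y Z m) (f : X.X →ₗ[k] Y.X) :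
    homD X Z (g ∘ₗ f) = homD Y Z g ∘ₗ f + m.negOnePow • (g ∘ₗ homD X Y f) := by
  have h2 : ∀ y, Z.sgn (g y) = m.negOnePow • g (Y.sgn y) := fun y => by
    have : Z.sgn ∘ₗ g = ((m.negOnePow : ℤ) : k) • (g ∘ₗ Y.sgn) := by
      refine linear_ext fun p y hy => ?_
      change Z.sgn (g y) = ((m.negOnePow : ℤ) : k) • g (Y.sgn y)
      rw [sgn_of_mem (hg.2 p y hy), sgn_of_mem hy, ← negOnePow_smul,
        ← negOnePow_smul, map_smul, smul_smul, FilteredDGCat.sign_add, mul_comm]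
    rw [← negOnePow_smul]
    exact LinearMap.congr_fun this y
  rw [homD_of_mem hg]
  ext x
  change Z.d (g (f x)) - Z.sgn (g (f (X.sgn (X.d x)))) =
    (Z.d (g (f x)) - m.negOnePow • g (Y.d (f x))) +
    m.negOnePow • g (Y.d (f x) - Y.sgn (f (X.sgn (X.d x))))
  rw [h2, map_sub, smul_sub]
  abel

theorem id_mem_homDeg : (LinearMap.id : X.X →ₗ[k] X.X) ∈ homDeg X X 0 :=
  ⟨⟨0, fun x => by simp⟩, fun p x hx => by simpa using hx⟩

end FilteredComplex

open FilteredComplex in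
/-- The filtered dg-category of filtered cochain complexes over `k`. -/
def FK (k : Type w) [Field k] : FilteredDGCat.{w, max w (v + 1), v} k where
  Obj := FilteredComplex.{w, v} k
  Hom X Y := hom X Y
  id X := ⟨LinearMap.id, Submodule.mem_iSup_of_mem 0 id_mem_homDeg⟩
  comp {X Y Z} := LinearMap.mk₂ k
    (fun g f => ⟨g.1 ∘ₗ f.1, comp_mem_homTotal g.2 f.2⟩)
    (fun g g' f => Subtype.ext (LinearMap.add_comp _ _ _))
    (fun c g f => Subtype.ext (LinearMap.smul_comp _ _ _))
    (fun g f f' => Subtype.ext (LinearMap.comp_add _ _ _))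
    (fun c g f => Subtype.ext (LinearMap.comp_smul _ _ _))
  id_comp _ := rfl
  comp_id _ := rfl
  assoc _ _ _ := rfl
  id_deg _ := id_mem_homDeg
  id_closed X := by
    refine Subtype.ext ((homD_of_mem id_mem_homDeg).trans ?_)
    rw [Int.negOnePow_zero, one_smul]
    exact sub_self X.d
  id_ℓ X := (homℓ_le (r := 0) ⟨0, fun x => by simp⟩).2 fun x => by simp
  comp_deg hg hf := comp_mem_homDeg hg hf
  leibniz {X Y Z m g} f hg := by
    refine Subtype.ext ((homD_comp hg f.1).trans ?_)
    rw [FilteredDGCat.negOnePow_smul' (k := k), FilteredDGCat.negOnePow_smul' (k := k)]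
    rfl
  comp_ℓ {X Y Z} g f := by
    change homℓ (g.1 ∘ₗ f.1) ≤ homℓ g.1 + homℓ f.1
    by_cases hg : g.1 = 0
    · rw [hg, LinearMap.zero_comp, homℓ_eq_bot.2 rfl]; exact bot_le
    by_cases hf : f.1 = 0
    · rw [hf, LinearMap.comp_zero, homℓ_eq_bot.2 rfl]; exact bot_le
    obtain ⟨a, ha⟩ := WithBot.ne_bot_iff_exists.1 (mt homℓ_eq_bot.1 hg)
    obtain ⟨b, hb⟩ := WithBot.ne_bot_iff_exists.1 (mt homℓ_eq_bot.1 hf)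
    have hga := (homℓ_le (exists_bound g.2)).1 ha.ge
    have hfb := (homℓ_le (exists_bound f.2)).1 hb.ge
    rw [← ha, ← hb, ← WithBot.coe_add]
    exact (homℓ_le ⟨_, hga.comp hfb⟩).2 (hga.comp hfb)

/-! ### The standard structures on `H^0(Tw(A))` and on `H^0` of filtered complexes -/

namespace FilteredDGCat

open FilteredComplex Pretriangulated

variable {k : Type w} [Field k]

/-- The morphism `φ` of shift `r` is the class of the cocycle `f`. -/
def IsClass {A : FilteredDGCat.{w, u, v} k} {X Y : A.Obj} {r : ℝ} (φ : A.H0.Mor r X Y)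
    (f : (A.Hom X Y).X) : Prop :=
  ∃ hf : f ∈ (A.Hom X Y).cocycles r, φ = cls f hf

/-- The triangulated persistence structure `S` on `H^0(Tw(A))` is the standard one: the shift
functor is `X ↦ Σ^r X` with the `η r s` induced by identities, the translation is `X ↦ X[-1]`,
`f ↦ f`, and for each closed degree-`0` morphism `f : X ⟶ Y` with `ℓ f ≤ 0` the triangle
`X ⟶ Y ⟶ cone f ⟶ X[-1]` is exact.  (By the axioms of triangulated categories, the exact
triangles are then exactly the triangles isomorphic to these.) -/
structure IsStandard {A : FilteredDGCat.{w, u, v} k} (S : TPC A.Tw.H0) : Prop where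
  sigma_obj : ∀ (r : ℝ) (X : TwObj A.Sig), (S.shift.F r).obj X = X.sigma r
  eta : ∀ (r s : ℝ) (X : TwObj A.Sig), ∃ φ : A.Tw.H0.Mor (s - r) (X.sigma r) (X.sigma s),
    IsClass φ (matOne X.obj) ∧ HEq (S.shift.η r s X) φ
  T_obj : ∀ X : TwObj A.Sig, S.T.obj X = X.susp
  T_map : ∀ (X Y : TwObj A.Sig) (f : (A.Tw.Hom X Y).X) (hf : f ∈ (A.Tw.Hom X Y).cocycles 0),
    ∃ φ : A.Tw.H0.Mor 0 X.susp Y.susp, IsClass φ f ∧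
      HEq (S.T.map (X := X) (Y := Y) (cls f hf)) φ
  cone : letI := S.hasZeroObject; letI := S.hasShift; letI := S.shift_additive
    letI := S.pretriangulated
    ∀ (X Y : TwObj A.Sig) (f : (A.Tw.Hom X Y).X) (hf : f ∈ (A.Tw.Hom X Y).cocycles 0),
    ∃ (i : A.Tw.H0.Mor 0 Y (TwObj.cone f hf)) (p : A.Tw.H0.Mor 0 (TwObj.cone f hf) (S.T.obj X))
      (p' : A.Tw.H0.Mor 0 (TwObj.cone f hf) X.susp),
      IsClass i (TwObj.coneInc f hf) ∧ IsClass p' (TwObj.coneProj f hf) ∧ HEq p p' ∧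
      Triangle.mk (C := A.Tw.H0.Zero) (X := X) (Y := Y) (Z := TwObj.cone f hf)
        (cls f hf) i p ∈ distTriang A.Tw.H0.Zero

/-- The triangulated persistence structure `S` on `H^0` of the category of filtered cochain
complexes is the standard one: `Σ^r (X, ∂, ℓ) = (X, ∂, ℓ + r)` with the `η r s` induced by the
identity maps, and the translation is `X ↦ X[-1]`. -/
structure IsStandardFK (S : TPC (FK.{w, v} k).H0) : Prop where
  sigma_obj : ∀ (r : ℝ) (X : FilteredComplex.{w, v} k), (S.shift.F r).obj X = X.shift r 0
  eta : ∀ (r s : ℝ) (X : FilteredComplex.{w, v} k),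
    ∃ (φ : (FK.{w, v} k).H0.Mor (s - r) (X.shift r 0) (X.shift s 0))
      (f : homTotal (X.shift r 0) (X.shift s 0)), (f.1 : X.X →ₗ[k] X.X) = LinearMap.id ∧
      IsClass φ f ∧ HEq (S.shift.η r s X) φ
  T_obj : ∀ X : FilteredComplex.{w, v} k, S.T.obj X = X.shift 0 (-1)

end FilteredDGCat

end

/-!
Write `B` for a filtered dg-category, and call an object `Y` a shifted copy of `X` if there is a
closed isomorphism `X ⟶ Y` of some degree `n` and some level `r` whose inverse has level `-r`
(`Twist`).  All the structure of a triangulated persistence category on `H^0(B)` comes from two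
properties of `B`.

* `Shifts`: each object has shifted copies `Σ^r X` and `X[-n]`.  Conjugation by the isomorphisms
  `X ⟶ Σ^r X` and `X ⟶ X[-n]` gives the shift functor and the translation.  Every structure
  morphism (the `η r s`, the units and the products, the commutation of `Σ^r` with the
  translation) is a composition of these isomorphisms and their inverses, so every coherence law
  holds because adjacent inverse factors cancel.
* `HasCones`: a closed morphism `f : X ⟶ Y` of degree `0` and level `0` has a cone `C`.  In a
  dg-category this can be said by equations: `C` is the direct sum of `Y` and of `X` placed one
  degree lower, and the differential of the inclusion of `X` is the inclusion of `Y` composed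
  with `f` (`ConeData`).  Since everything is required at level `0`, the usual homotopies of
  homological algebra have level `0` too.  This gives the rotation of triangles (`rotate_std`),
  their morphisms (`complete_std`) and the octahedron axiom (`octahedron_exact`).  If `f` has
  a closed inverse of level `r`, then `inl ∘ f⁻¹ ∘ snd` contracts its
  cone at level `r` (`ConeData.isAcyclic`); for the isomorphism `Σ^r X ⟶ X` this is the last
  axiom of a triangulated persistence category.

The result is `tpc`.  It is strict as soon as the chosen shifted copies compose strictly
(`StrictShifts`, `tpc_isStrict`).

Twisted complexes have both properties: the identity matrix is the isomorphism onto a shifted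
copy (`TwObj.relabel`), and the matrix `(q_Y, f; 0, -q_X)` defines the cone (`TwObj.coneData`).
If `A` is filtered pre-triangulated, then both properties descend from `Tw(A)` to `A`, because
`A ⟶ Tw(A)` is fully faithful and every object of `Tw(A)` is isomorphic to one of `A`
(`IsPretriangulated.nonempty_tpc`).  A twisted complex of filtered complexes is isomorphic to its
total complex, the direct sum of the shifted summands with the differential `∂ + q` (`fkTotal`,
`fk_isPretriangulated`).  Thus filtered complexes have cones; their shifted copies are the evident
ones, which compose strictly.
-/

noncomputable section

/-! ### Homogeneous elements -/

namespace FilteredComplex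

variable {k : Type w} [Field k] (C : FilteredComplex.{w, v} k)

/-- The elements of degree `n` and filtration level at most `r`. -/
def gr (n : ℤ) (r : ℝ) : Submodule k C.X := C.deg n ⊓ C.fil r

variable {C}

theorem gr_mono {n : ℤ} {r s : ℝ} (h : r ≤ s) : C.gr n r ≤ C.gr n s :=
  inf_le_inf le_rfl (C.fil_mono h)

theorem mem_cocycles_iff {r : ℝ} {x : C.X} : x ∈ C.cocycles r ↔ x ∈ C.gr 0 r ∧ C.d x = 0 :=
  ⟨fun h => ⟨⟨h.1.1, h.2⟩, h.1.2⟩, fun h => ⟨⟨h.1.1, h.2⟩, h.1.2⟩⟩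

theorem units_smul_mem {M : Type*} [AddCommGroup M] [Module k M] (S : Submodule k M) (e : ℤˣ)
    {x : M} (hx : x ∈ S) : e • x ∈ S := by
  rcases Int.units_eq_one_or e with rfl | rfl
  · simpa using hx
  · simpa using hx

end FilteredComplex

namespace FilteredDGCat

open FilteredComplex PersistenceCategory

variable {k : Type w} [Field k] {B : FilteredDGCat.{w, u, v} k}

/-! ### Cohomology classes -/

theorem comp_gr {X Y Z : B.Obj} {m n p : ℤ} {r s t : ℝ} {g : (B.Hom Y Z).X}
    {f : (B.Hom X Y).X} (hg : g ∈ (B.Hom Y Z).gr m r) (hf : f ∈ (B.Hom X Y).gr n s)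
    (h : m + n = p) (h' : r + s ≤ t) : B.comp g f ∈ (B.Hom X Z).gr p t := by
  refine ⟨h ▸ B.comp_deg hg.1 hf.1, (B.comp_ℓ g f).trans ?_⟩
  refine (add_le_add hg.2 hf.2).trans ?_
  rw [← WithBot.coe_add]
  exact WithBot.coe_le_coe.2 h'

theorem id_gr (X : B.Obj) : B.id X ∈ (B.Hom X X).gr 0 0 := ⟨B.id_deg X, B.id_ℓ X⟩

theorem units_smul_comp {X Y Z : B.Obj} (e : ℤˣ) (g : (B.Hom Y Z).X) (f : (B.Hom X Y).X) :
    B.comp (e • g) f = e • B.comp g f := by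
  rcases Int.units_eq_one_or e with rfl | rfl <;> simp

theorem comp_units_smul {X Y Z : B.Obj} (e : ℤˣ) (g : (B.Hom Y Z).X) (f : (B.Hom X Y).X) :
    B.comp g (e • f) = e • B.comp g f := by
  rcases Int.units_eq_one_or e with rfl | rfl <;> simp

theorem d_units_smul {X Y : B.Obj} (e : ℤˣ) (f : (B.Hom X Y).X) :
    (B.Hom X Y).d (e • f) = e • (B.Hom X Y).d f := by
  rcases Int.units_eq_one_or e with rfl | rfl <;> simp

theorem d_comp_of_closed {X Y Z : B.Obj} {m : ℤ} {r : ℝ} {g : (B.Hom Y Z).X}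
    (hg : g ∈ (B.Hom Y Z).gr m r) (hd : (B.Hom Y Z).d g = 0) (f : (B.Hom X Y).X) :
    (B.Hom X Z).d (B.comp g f) = m.negOnePow • B.comp g ((B.Hom X Y).d f) := by
  rw [B.leibniz f hg.1, hd, map_zero, LinearMap.zero_apply, zero_add]

theorem d_comp_zero {X Y Z : B.Obj} {r : ℝ} {g : (B.Hom Y Z).X}
    (hg : g ∈ (B.Hom Y Z).gr 0 r) (f : (B.Hom X Y).X) :
    (B.Hom X Z).d (B.comp g f) = B.comp ((B.Hom Y Z).d g) f + B.comp g ((B.Hom X Y).d f) := by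
  rw [B.leibniz f hg.1]; simp

theorem d_comp_one {X Y Z : B.Obj} {r : ℝ} {g : (B.Hom Y Z).X}
    (hg : g ∈ (B.Hom Y Z).gr 1 r) (f : (B.Hom X Y).X) :
    (B.Hom X Z).d (B.comp g f) = B.comp ((B.Hom Y Z).d g) f - B.comp g ((B.Hom X Y).d f) := by
  rw [B.leibniz f hg.1]; simp [sub_eq_add_neg]

theorem d_comp_neg_one {X Y Z : B.Obj} {r : ℝ} {g : (B.Hom Y Z).X}
    (hg : g ∈ (B.Hom Y Z).gr (-1) r) (f : (B.Hom X Y).X) :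
    (B.Hom X Z).d (B.comp g f) = B.comp ((B.Hom Y Z).d g) f - B.comp g ((B.Hom X Y).d f) := by
  rw [B.leibniz f hg.1]; simp [sub_eq_add_neg]

theorem cls_congr {X Y : B.Obj} {r : ℝ} {f g : (B.Hom X Y).X} {hf : f ∈ (B.Hom X Y).cocycles r}
    {hg : g ∈ (B.Hom X Y).cocycles r} (h : f = g) : cls f hf = cls g hg := by
  subst h; rfl

theorem cls_eq_iff {X Y : B.Obj} {r : ℝ} {f g : (B.Hom X Y).X}
    {hf : f ∈ (B.Hom X Y).cocycles r} {hg : g ∈ (B.Hom X Y).cocycles r} :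
    cls f hf = cls g hg ↔ ∃ h ∈ (B.Hom X Y).gr (-1) r, (B.Hom X Y).d h = f - g := by
  rw [cls, cls, Submodule.Quotient.eq]
  exact Iff.rfl

theorem exists_cls {X Y : B.Obj} {r : ℝ} (φ : B.H0.Mor r X Y) :
    ∃ (f : (B.Hom X Y).X) (hf : f ∈ (B.Hom X Y).cocycles r), φ = cls f hf := by
  obtain ⟨f, rfl⟩ := Submodule.Quotient.mk_surjective _ φ
  exact ⟨f.1, f.2, rfl⟩

/-- The composition of cocycles, with the bound on the level as a hypothesis. -/
theorem comp_cocycles' {X Y Z : B.Obj} {r s t : ℝ} {f : (B.Hom X Y).X} {g : (B.Hom Y Z).X}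
    (hf : f ∈ (B.Hom X Y).cocycles r) (hg : g ∈ (B.Hom Y Z).cocycles s) (h : r + s ≤ t) :
    B.comp g f ∈ (B.Hom X Z).cocycles t :=
  cocycles_mono _ h (comp_cocycles hf hg)

theorem cmp_cls {X Y Z : B.Obj} {r s t : ℝ} {f : (B.Hom X Y).X} {g : (B.Hom Y Z).X}
    (hf : f ∈ (B.Hom X Y).cocycles r) (hg : g ∈ (B.Hom Y Z).cocycles s) (h : r + s ≤ t) :
    cmp (C := B.H0) (X := X) (Y := Y) (Z := Z) h (cls f hf) (cls g hg) =
      cls (B.comp g f) (comp_cocycles' hf hg h) := rfl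

theorem i_cls {X Y : B.Obj} {r s : ℝ} {f : (B.Hom X Y).X}
    (hf : f ∈ (B.Hom X Y).cocycles r) (h : r ≤ s) :
    B.H0.i (A := X) (B := Y) h (cls f hf) = cls f (cocycles_mono _ h hf) := rfl

/-- The morphism of the `0`-level represented by a cocycle. -/
abbrev homCls {X Y : B.Obj} (f : (B.Hom X Y).X) (hf : f ∈ (B.Hom X Y).cocycles 0) :
    @Quiver.Hom B.H0.Zero _ X Y := cls f hf

theorem homCls_comp {X Y Z : B.Obj} {f : (B.Hom X Y).X} {g : (B.Hom Y Z).X}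
    (hf : f ∈ (B.Hom X Y).cocycles 0) (hg : g ∈ (B.Hom Y Z).cocycles 0) :
    homCls f hf ≫ homCls g hg = homCls (B.comp g f) (comp_cocycles' hf hg (add_zero 0).le) := rfl

theorem id_homCls (X : B.Obj) :
    @CategoryStruct.id B.H0.Zero _ X = homCls (B.id X) (B.id_mem_cocycles X) := rfl

theorem exists_homCls {X Y : B.H0.Zero} (φ : X ⟶ Y) :
    ∃ (f : (B.Hom X Y).X) (hf : f ∈ (B.Hom X Y).cocycles 0), φ = homCls f hf := exists_cls φ

theorem units_smul_homCls (e : ℤˣ) {X Y : B.H0.Zero} {f : (B.Hom X Y).X}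
    (hf : f ∈ (B.Hom X Y).cocycles 0) :
    e • homCls f hf = homCls (e • f) (units_smul_mem _ e hf) := by
  rcases Int.units_eq_one_or e with rfl | rfl
  · exact (one_smul _ _).trans (cls_congr (one_smul _ _).symm)
  · exact (Units.neg_smul _ _).trans ((congrArg Neg.neg (one_smul _ _)).trans
      (cls_congr (by rw [Units.neg_smul, one_smul]) :
        cls (-f) (Submodule.neg_mem _ hf) = cls _ _))

/-! ### Closed isomorphisms of arbitrary degree and filtration level -/

/-- A closed isomorphism `X ⟶ Y` of degree `n` with `ℓ ≤ r` whose inverse has `ℓ ≤ -r`; it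
presents `Y` as a copy of the complex `X`, shifted by `n` and with filtration raised by `r`. -/
structure Twist (B : FilteredDGCat.{w, u, v} k) (X Y : B.Obj) (r : ℝ) (n : ℤ) where
  hom : (B.Hom X Y).X
  inv : (B.Hom Y X).X
  hom_mem : hom ∈ (B.Hom X Y).gr n r
  inv_mem : inv ∈ (B.Hom Y X).gr (-n) (-r)
  d_hom : (B.Hom X Y).d hom = 0
  d_inv : (B.Hom Y X).d inv = 0
  hom_inv : B.comp inv hom = B.id X
  inv_hom : B.comp hom inv = B.id Y

namespace Twist

variable {X Y Z X' Y' Z' : B.Obj} {r s : ℝ} {m n : ℤ}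

theorem hom_inv_assoc (u : Twist B X Y r n) {W : B.Obj} (f : (B.Hom W X).X) :
    B.comp u.inv (B.comp u.hom f) = f := by
  rw [← B.assoc, u.hom_inv, B.id_comp]

theorem inv_hom_assoc (u : Twist B X Y r n) {W : B.Obj} (f : (B.Hom W Y).X) :
    B.comp u.hom (B.comp u.inv f) = f := by
  rw [← B.assoc, u.inv_hom, B.id_comp]

attribute [simp] hom_inv inv_hom hom_inv_assoc inv_hom_assoc d_hom d_inv

/-- Each object is a shifted copy of itself, with trivial shift. -/
def refl (X : B.Obj) : Twist B X X 0 0 where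
  hom := B.id X
  inv := B.id X
  hom_mem := id_gr X
  inv_mem := by simpa using id_gr X
  d_hom := B.id_closed X
  d_inv := B.id_closed X
  hom_inv := B.id_comp _
  inv_hom := B.id_comp _

/-- The inverse isomorphism, which undoes the shift. -/
def symm (u : Twist B X Y r n) : Twist B Y X (-r) (-n) where
  hom := u.inv
  inv := u.hom
  hom_mem := u.inv_mem
  inv_mem := by simpa using u.hom_mem
  d_hom := u.d_inv
  d_inv := u.d_hom
  hom_inv := u.inv_hom
  inv_hom := u.hom_inv

/-- The composition; the shifts add up. -/
def trans (u : Twist B X Y r m) (v : Twist B Y Z s n) : Twist B X Z (r + s) (m + n) where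
  hom := B.comp v.hom u.hom
  inv := B.comp u.inv v.inv
  hom_mem := comp_gr v.hom_mem u.hom_mem (add_comm _ _) (add_comm _ _).le
  inv_mem := comp_gr u.inv_mem v.inv_mem (neg_add m n).symm (neg_add r s).ge
  d_hom := by rw [d_comp_of_closed v.hom_mem v.d_hom]; simp
  d_inv := by rw [d_comp_of_closed u.inv_mem u.d_inv]; simp
  hom_inv := by simp [B.assoc]
  inv_hom := by simp [B.assoc]

theorem hom_mem_cocycles (u : Twist B X Y r n) (hn : n = 0) {t : ℝ} (hr : r ≤ t) :
    u.hom ∈ (B.Hom X Y).cocycles t :=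
  mem_cocycles_iff.2 ⟨gr_mono hr (hn ▸ u.hom_mem), u.d_hom⟩

theorem inv_mem_cocycles (u : Twist B X Y r n) (hn : n = 0) {t : ℝ} (hr : -r ≤ t) :
    u.inv ∈ (B.Hom Y X).cocycles t :=
  u.symm.hom_mem_cocycles (by simp [hn]) hr

/-- An isomorphism of degree and level `0` gives an isomorphism in the `0`-level of `H^0`. -/
def iso (u : Twist B X Y r n) (hn : n = 0) (hr : r = 0) :
    @Iso B.H0.Zero _ X Y where
  hom := homCls u.hom (u.hom_mem_cocycles hn hr.le)
  inv := homCls u.inv (u.inv_mem_cocycles hn (by simp [hr]))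
  hom_inv_id := (homCls_comp _ _).trans (cls_congr u.hom_inv)
  inv_hom_id := (homCls_comp _ _).trans (cls_congr u.inv_hom)

/-- The conjugation `f ↦ v ∘ f ∘ u⁻¹`. -/
def conjLin (u : Twist B X X' r n) (v : Twist B Y Y' r n) :
    (B.Hom X Y).X →ₗ[k] (B.Hom X' Y').X :=
  B.comp v.hom ∘ₗ B.comp.flip u.inv

theorem conjLin_apply (u : Twist B X X' r n) (v : Twist B Y Y' r n) (f : (B.Hom X Y).X) :
    conjLin u v f = B.comp v.hom (B.comp f u.inv) := rfl

theorem conjLin_mem (u : Twist B X X' r n) (v : Twist B Y Y' r n) {f : (B.Hom X Y).X} {p : ℤ}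
    {a : ℝ} (hf : f ∈ (B.Hom X Y).gr p a) : conjLin u v f ∈ (B.Hom X' Y').gr p a :=
  comp_gr v.hom_mem (comp_gr hf u.inv_mem rfl le_rfl) (by ring) (by linarith)

/-- Conjugation by an isomorphism of degree `n` commutes with the differential up to `(-1)^n`. -/
theorem d_conjLin (u : Twist B X X' r n) (v : Twist B Y Y' r n) (f : (B.Hom X Y).X) :
    (B.Hom X' Y').d (conjLin u v f) = n.negOnePow • conjLin u v ((B.Hom X Y).d f) := by
  induction f using hom_induction with
  | h0 => simp
  | hadd f g hf hg => simp only [map_add, hf, hg, smul_add]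
  | hdeg p f hf =>
    simp only [conjLin_apply]
    rw [d_comp_of_closed v.hom_mem v.d_hom, B.leibniz _ hf]
    simp

theorem conjLin_comp (u : Twist B X X' r n) (v : Twist B Y Y' r n) (w : Twist B Z Z' r n)
    (g : (B.Hom Y Z).X) (f : (B.Hom X Y).X) :
    conjLin u w (B.comp g f) = B.comp (conjLin v w g) (conjLin u v f) := by
  simp [conjLin_apply, B.assoc]

theorem conjLin_id (u : Twist B X X' r n) : conjLin u u (B.id X) = B.id X' := by
  rw [conjLin_apply, B.id_comp, inv_hom]

theorem conjLin_cocycles (u : Twist B X X' r n) (v : Twist B Y Y' r n) {f : (B.Hom X Y).X}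
    {a : ℝ} (hf : f ∈ (B.Hom X Y).cocycles a) : conjLin u v f ∈ (B.Hom X' Y').cocycles a := by
  rw [mem_cocycles_iff] at *
  exact ⟨conjLin_mem u v hf.1, by rw [d_conjLin, hf.2]; simp⟩

/-- Conjugation of cohomology classes.  It is well defined although conjugation is a chain map only
up to a sign, because that sign can be absorbed in the primitive of a coboundary. -/
def conj (u : Twist B X X' r n) (v : Twist B Y Y' r n) {a : ℝ} :
    (B.Hom X Y).cohomology a →ₗ[k] (B.Hom X' Y').cohomology a :=
  Submodule.mapQ _ _ ((conjLin u v).restrict fun _ => conjLin_cocycles u v) (by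
    rintro ⟨_, hf⟩ ⟨h, hh, rfl⟩
    refine ⟨n.negOnePow • conjLin u v h, units_smul_mem _ _ (conjLin_mem u v hh), ?_⟩
    rw [d_units_smul, d_conjLin, smul_smul, Int.units_mul_self, one_smul]
    rfl)

theorem conj_cls (u : Twist B X X' r n) (v : Twist B Y Y' r n) {a : ℝ} {f : (B.Hom X Y).X}
    (hf : f ∈ (B.Hom X Y).cocycles a) :
    conj u v (cls f hf) = cls (conjLin u v f) (conjLin_cocycles u v hf) := rfl

end Twist

/-- The persistence endofunctor of `H^0` given by a family of shifted copies of all objects. -/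
@[reducible] def conjFunctor {r : ℝ} {n : ℤ} (o : B.Obj → B.Obj) (u : ∀ X, Twist B X (o X) r n) :
    PersistenceFunctor B.H0 B.H0 where
  obj := o
  map {X Y a} := Twist.conj (u X) (u Y)
  map_i {X Y r s} h f := by
    obtain ⟨f, hf, rfl⟩ := exists_cls f
    rfl
  map_id X := (Twist.conj_cls _ _ _).trans (cls_congr (Twist.conjLin_id (u X)))
  map_comp {X Y Z a b} f g := by
    obtain ⟨f, hf, rfl⟩ := exists_cls f
    obtain ⟨g, hg, rfl⟩ := exists_cls g
    exact (Twist.conj_cls (u X) (u Z) (comp_cocycles hf hg)).trans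
      (cls_congr (Twist.conjLin_comp _ (u Y) _ _ _))

end FilteredDGCat

namespace FilteredDGCat

open FilteredComplex PersistenceCategory

variable {k : Type w} [Field k] {B : FilteredDGCat.{w, u, v} k}

/-! ### The shift functor -/

/-- A choice, for each object `X`, of objects `Σ^r X` and `X[-n]` together with the closed
isomorphisms from `X` that present them as shifted copies of `X`. -/
class Shifts (B : FilteredDGCat.{w, u, v} k) where
  /-- The object `Σ^r X`. -/
  sig : ℝ → B.Obj → B.Obj
  /-- The object `X[-n]`, that is `T^n X`. -/
  tr : ℤ → B.Obj → B.Obj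
  su : ∀ r X, Twist B X (sig r X) r 0
  tu : ∀ n X, Twist B X (tr n X) 0 (-n)

open Shifts

variable (B) [Shifts B]

/-- The persistence functor `Σ^r`. -/
def sigF (r : ℝ) : PersistenceFunctor B.H0 B.H0 := conjFunctor (sig r) (su r)

/-- The functor `X ↦ X[-n]`. -/
def trF (n : ℤ) : PersistenceFunctor B.H0 B.H0 := conjFunctor (tr n) (tu n)

/-- The shift functor on `H^0`: all its structure morphisms are composed of the chosen
isomorphisms `X ⟶ Σ^r X` and of their inverses. -/
def shiftF : ShiftFunctor B.H0 where
  F := sigF B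
  η r s X := cls (((su r X).symm.trans (su s X)).hom)
    (Twist.hom_mem_cocycles _ (by simp) (by linarith))
  η_refl r X := (i_cls _ _).trans (cls_congr (su r X).inv_hom)
  η_trans := fun r s t (X : B.Obj) => (cmp_cls _ _ _).trans (cls_congr (by
    change B.comp (B.comp (su t X).hom (su s X).inv) (B.comp (su s X).hom (su r X).inv) =
      B.comp (su t X).hom (su r X).inv
    simp [B.assoc]))
  η_natural := fun r s {X Y : B.Obj} a f => by
    obtain ⟨f, hf, rfl⟩ := exists_cls (B := B) f
    refine cls_congr ?_
    change B.comp (B.comp (su s Y).hom (su r Y).inv)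
        (B.comp (su r Y).hom (B.comp f (su r X).inv)) =
      B.comp (B.comp (su s Y).hom (B.comp f (su s X).inv)) (B.comp (su s X).hom (su r X).inv)
    simp [B.assoc]
  ε X := (su 0 X).iso rfl rfl
  ε_natural := fun {X Y : B.Obj} a f => by
    obtain ⟨f, hf, rfl⟩ := exists_cls (B := B) f
    refine cls_congr ?_
    change B.comp (su 0 Y).hom f =
      B.comp (B.comp (su 0 Y).hom (B.comp f (su 0 X).inv)) (su 0 X).hom
    simp [B.assoc, B.comp_id]
  μ r s X := ((((su s X).trans (su r (sig s X))).symm).trans (su (r + s) X)).iso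
    (by simp) (by ring)
  μ_natural := fun r s {X Y : B.Obj} a f => by
    obtain ⟨f, hf, rfl⟩ := exists_cls (B := B) f
    refine cls_congr ?_
    change B.comp (B.comp (su (r + s) Y).hom (B.comp (su s Y).inv (su r (sig s Y)).inv))
        (B.comp (su r (sig s Y)).hom
          (B.comp (B.comp (su s Y).hom (B.comp f (su s X).inv)) (su r (sig s X)).inv)) =
      B.comp (B.comp (su (r + s) Y).hom (B.comp f (su (r + s) X).inv))
        (B.comp (su (r + s) X).hom (B.comp (su s X).inv (su r (sig s X)).inv))
    simp [B.assoc]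
  μ_η := fun r r' s s' (X : B.Obj) => by
    refine cls_congr ?_
    change B.comp (B.comp (su (r' + s') X).hom (B.comp (su s' X).inv (su r' (sig s' X)).inv))
        (B.comp (B.comp (su r' (sig s' X)).hom (su r (sig s' X)).inv)
          (B.comp (su r (sig s' X)).hom (B.comp (B.comp (su s' X).hom (su s X).inv)
            (su r (sig s X)).inv))) =
      B.comp (B.comp (su (r' + s') X).hom (su (r + s) X).inv)
        (B.comp (su (r + s) X).hom (B.comp (su s X).inv (su r (sig s X)).inv))
    simp [B.assoc]
  assoc := fun r s t (X : B.Obj) => by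
    refine cls_congr ?_
    change B.comp (B.comp (su (r + (s + t)) X).hom (su (r + s + t) X).inv)
        (B.comp (B.comp (su (r + s + t) X).hom
          (B.comp (su t X).inv (su (r + s) (sig t X)).inv))
          (B.comp (su (r + s) (sig t X)).hom
            (B.comp (su s (sig t X)).inv (su r (sig s (sig t X))).inv))) =
      B.comp (B.comp (su (r + (s + t)) X).hom
          (B.comp (su (s + t) X).inv (su r (sig (s + t) X)).inv))
        (B.comp (su r (sig (s + t) X)).hom
          (B.comp (B.comp (su (s + t) X).hom (B.comp (su t X).inv (su s (sig t X)).inv))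
            (su r (sig s (sig t X))).inv))
    simp [B.assoc]
  left_unit := fun r (X : B.Obj) => by
    refine cls_congr ?_
    change B.comp (B.comp (su (0 + r) X).hom (B.comp (su r X).inv (su 0 (sig r X)).inv))
      (su 0 (sig r X)).hom = B.comp (su (0 + r) X).hom (su r X).inv
    simp [B.assoc, B.comp_id]
  right_unit := fun r (X : B.Obj) => by
    refine cls_congr ?_
    change B.comp (B.comp (su (r + 0) X).hom (B.comp (su 0 X).inv (su r (sig 0 X)).inv))
      (B.comp (su r (sig 0 X)).hom (B.comp (su 0 X).hom (su r X).inv)) =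
        B.comp (su (r + 0) X).hom (su r X).inv
    simp [B.assoc]

/-! ### The translation -/

variable {B}

/-- The comparison of `X[-m]` and `X[-n]` for `m = n` is the canonical isomorphism between two
shifted copies, so that `eqToHom` can be computed with like the other structure morphisms. -/
theorem eqToHom_trF (X : B.Obj) {m n : ℤ} (h : m = n)
    (h' : (trF B m).zero.obj X = (trF B n).zero.obj X) :
    eqToHom h' = homCls ((tu m X).symm.trans (tu n X)).hom
        (Twist.hom_mem_cocycles _ (by simp [h]) (by simp)) := by
  subst h
  exact (id_homCls _).trans (cls_congr (Twist.inv_hom _).symm)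

variable (B) in
/-- The translations `X ↦ X[-n]` form an action of `ℤ`. -/
def shiftCore : ShiftMkCore B.H0.Zero ℤ where
  F n := (trF B n).zero
  zero := NatIso.ofComponents (fun X => ((tu 0 X).symm.iso (by simp) (by simp))) (by
    intro (X : B.Obj) (Y : B.Obj) f
    obtain ⟨f, hf, rfl⟩ := exists_homCls (B := B) f
    refine cls_congr ?_
    change B.comp (tu 0 Y).inv (B.comp (tu 0 Y).hom (B.comp f (tu 0 X).inv)) =
      B.comp f (tu 0 X).inv
    simp)
  add m n := NatIso.ofComponents (fun X => ((tu (m + n) X).symm.trans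
      ((tu m X).trans (tu n (tr m X)))).iso (by ring) (by simp)) (by
    intro (X : B.Obj) (Y : B.Obj) f
    obtain ⟨f, hf, rfl⟩ := exists_homCls (B := B) f
    refine cls_congr ?_
    change B.comp (B.comp (B.comp (tu n (tr m Y)).hom (tu m Y).hom) (tu (m + n) Y).inv)
        (B.comp (tu (m + n) Y).hom (B.comp f (tu (m + n) X).inv)) =
      B.comp (B.comp (tu n (tr m Y)).hom
        (B.comp (B.comp (tu m Y).hom (B.comp f (tu m X).inv)) (tu n (tr m X)).inv))
        (B.comp (B.comp (tu n (tr m X)).hom (tu m X).hom) (tu (m + n) X).inv)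
    simp [B.assoc])
  assoc_hom_app := fun m₁ m₂ m₃ (X : B.Obj) => by
    rw [eqToHom_trF X (add_assoc m₁ m₂ m₃)]
    refine cls_congr ?_
    change B.comp (B.comp (tu m₃ (tr m₂ (tr m₁ X))).hom (B.comp
          (B.comp (B.comp (tu m₂ (tr m₁ X)).hom (tu m₁ X).hom) (tu (m₁ + m₂) X).inv)
          (tu m₃ (tr (m₁ + m₂) X)).inv))
        (B.comp (B.comp (tu m₃ (tr (m₁ + m₂) X)).hom (tu (m₁ + m₂) X).hom)
          (tu (m₁ + m₂ + m₃) X).inv) =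
      B.comp (B.comp (B.comp (B.comp (tu m₃ (tr m₂ (tr m₁ X))).hom (tu m₂ (tr m₁ X)).hom)
          (tu (m₂ + m₃) (tr m₁ X)).inv)
        (B.comp (B.comp (tu (m₂ + m₃) (tr m₁ X)).hom (tu m₁ X).hom)
          (tu (m₁ + (m₂ + m₃)) X).inv))
        (B.comp (tu (m₁ + (m₂ + m₃)) X).hom (tu (m₁ + m₂ + m₃) X).inv)
    simp [B.assoc]
  zero_add_hom_app := fun n (X : B.Obj) => by
    rw [eqToHom_trF X (zero_add n)]
    refine cls_congr ?_
    change B.comp (B.comp (tu n (tr 0 X)).hom (tu 0 X).hom) (tu (0 + n) X).inv =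
      B.comp (B.comp (tu n (tr 0 X)).hom (B.comp (tu 0 X).hom (tu n X).inv))
        (B.comp (tu n X).hom (tu (0 + n) X).inv)
    simp [B.assoc]
  add_zero_hom_app := fun n (X : B.Obj) => by
    rw [eqToHom_trF X (add_zero n)]
    refine cls_congr ?_
    change B.comp (B.comp (tu 0 (tr n X)).hom (tu n X).hom) (tu (n + 0) X).inv =
      B.comp (tu 0 (tr n X)).hom (B.comp (tu n X).hom (tu (n + 0) X).inv)
    simp [B.assoc]

/-- The translation of the `0`-level is `X ↦ X[-1]`. -/
instance : HasShift B.H0.Zero ℤ := hasShiftMk _ _ (shiftCore B)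

theorem shift_homCls (n : ℤ) {X Y : B.Obj} {f : (B.Hom X Y).X}
    (hf : f ∈ (B.Hom X Y).cocycles 0) :
    (shiftFunctor B.H0.Zero n).map (homCls f hf) =
      homCls (Twist.conjLin (tu n X) (tu n Y) f) (Twist.conjLin_cocycles _ _ hf) := rfl

instance (n : ℤ) : (shiftFunctor B.H0.Zero n).Additive where
  map_add {X Y f g} := map_add (Twist.conj (a := 0) (tu (B := B) n X) (tu n Y)) f g

/-- The commutation of translations is the canonical isomorphism; no sign enters here, the signs
of shifted triangles being those of `Triangle.shiftFunctor`. -/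
theorem shiftFunctorComm_app (n : ℤ) (X : B.Obj) :
    (shiftFunctorComm B.H0.Zero 1 n).hom.app X =
      homCls (((tu 1 X).trans (tu n (tr 1 X))).symm.trans ((tu n X).trans (tu 1 (tr n X)))).hom
        (Twist.hom_mem_cocycles _ (by ring) (by simp)) := by
  rw [shiftFunctorComm_eq B.H0.Zero 1 n (1 + n) rfl]
  have h : (shiftFunctorAdd' B.H0.Zero n 1 (1 + n) (add_comm _ _)).hom.app X =
      homCls ((tu (1 + n) X).symm.trans ((tu n X).trans (tu 1 (tr n X)))).hom
        (Twist.hom_mem_cocycles _ (by ring) (by simp)) := by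
    rw [shiftFunctorAdd']
    have h1 : (eqToIso (congrArg (shiftFunctor B.H0.Zero) (add_comm 1 n))).hom.app X =
      eqToHom (by rw [add_comm]) := eqToHom_app
        (congrArg (shiftFunctor B.H0.Zero) (add_comm 1 n)) (show B.H0.Zero from X)
    refine (congrArg (fun x => x ≫ (shiftFunctorAdd B.H0.Zero n 1).hom.app X)
      (h1.trans (eqToHom_trF X (add_comm 1 n) _))).trans (cls_congr ?_)
    change B.comp (B.comp (B.comp (tu 1 (tr n X)).hom (tu n X).hom) (tu (n + 1) X).inv)
      (B.comp (tu (n + 1) X).hom (tu (1 + n) X).inv) =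
        B.comp (B.comp (tu 1 (tr n X)).hom (tu n X).hom) (tu (1 + n) X).inv
    simp [B.assoc]
  have h' : (shiftFunctorAdd' B.H0.Zero 1 n (1 + n) rfl).inv.app X =
      homCls ((tu (1 + n) X).symm.trans ((tu 1 X).trans (tu n (tr 1 X)))).inv
        (Twist.inv_mem_cocycles _ (by ring) (by simp)) := by
    rw [shiftFunctorAdd'_eq_shiftFunctorAdd]
    rfl
  refine (congrArg₂ (fun x y => x ≫ y) h' h).trans (cls_congr ?_)
  change B.comp (B.comp (B.comp (tu 1 (tr n X)).hom (tu n X).hom) (tu (1 + n) X).inv)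
      (B.comp (tu (1 + n) X).hom (B.comp (tu 1 X).inv (tu n (tr 1 X)).inv)) =
    B.comp (B.comp (tu 1 (tr n X)).hom (tu n X).hom) (B.comp (tu 1 X).inv (tu n (tr 1 X)).inv)
  simp [B.assoc]

/-- `Σ^r` commutes with the translations, by the canonical isomorphism between two shifted copies
of the same object. -/
instance (r : ℝ) : ((shiftF B).F r).zero.CommShift ℤ where
  commShiftIso n := NatIso.ofComponents (fun X => (((tu n X).trans (su r (tr n X))).symm.trans
      ((su r X).trans (tu n (sig r X)))).iso (by ring) (by ring)) (by
    intro (X : B.Obj) (Y : B.Obj) f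
    obtain ⟨f, hf, rfl⟩ := exists_homCls (B := B) f
    refine cls_congr ?_
    change B.comp (B.comp (B.comp (tu n (sig r Y)).hom (su r Y).hom)
          (B.comp (tu n Y).inv (su r (tr n Y)).inv))
        (B.comp (su r (tr n Y)).hom (B.comp (B.comp (tu n Y).hom (B.comp f (tu n X).inv))
          (su r (tr n X)).inv)) =
      B.comp (B.comp (tu n (sig r Y)).hom (B.comp (B.comp (su r Y).hom (B.comp f (su r X).inv))
          (tu n (sig r X)).inv))
        (B.comp (B.comp (tu n (sig r X)).hom (su r X).hom)
          (B.comp (tu n X).inv (su r (tr n X)).inv))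
    simp [B.assoc])
  commShiftIso_zero := by
    ext X
    rw [Functor.CommShift.isoZero_hom_app]
    revert X
    intro (X : B.Obj)
    refine cls_congr ?_
    change B.comp (B.comp (tu 0 (sig r X)).hom (su r X).hom)
        (B.comp (tu 0 X).inv (su r (tr 0 X)).inv) =
      B.comp (tu 0 (sig r X)).hom (B.comp (su r X).hom
        (B.comp (tu 0 X).inv (su r (tr 0 X)).inv))
    simp [B.assoc]
  commShiftIso_add m n := by
    ext X
    rw [Functor.CommShift.isoAdd_hom_app]
    revert X
    intro (X : B.Obj)
    refine cls_congr ?_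
    change B.comp (B.comp (tu (m + n) (sig r X)).hom (su r X).hom)
        (B.comp (tu (m + n) X).inv (su r (tr (m + n) X)).inv) =
      B.comp (B.comp
        (B.comp (B.comp (tu (m + n) (sig r X)).hom
            (B.comp (tu m (sig r X)).inv (tu n (tr m (sig r X))).inv))
          (B.comp (tu n (tr m (sig r X))).hom (B.comp
            (B.comp (B.comp (tu m (sig r X)).hom (su r X).hom)
              (B.comp (tu m X).inv (su r (tr m X)).inv))
            (tu n (sig r (tr m X))).inv)))
        (B.comp (B.comp (tu n (sig r (tr m X))).hom (su r (tr m X)).hom)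
          (B.comp (tu n (tr m X)).inv (su r (tr n (tr m X))).inv)))
        (B.comp (su r (tr n (tr m X))).hom (B.comp
          (B.comp (B.comp (tu n (tr m X)).hom (tu m X).hom) (tu (m + n) X).inv)
          (su r (tr (m + n) X)).inv))
    simp [B.assoc]

end FilteredDGCat

namespace FilteredDGCat

open FilteredComplex PersistenceCategory Shifts

variable {k : Type w} [Field k] {B : FilteredDGCat.{w, u, v} k}

/-! ### Cones -/

/-- `C` is a cone of the closed morphism `f : X ⟶ Y` of degree `0`: as a graded object it is
the direct sum of `Y` and of `X` placed one degree lower, by morphisms with `ℓ ≤ 0`, and the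
differential of the inclusion `inl` of `X` is `f`. -/
structure ConeData {X Y : B.Obj} (f : (B.Hom X Y).X) (C : B.Obj) where
  inl : (B.Hom X C).X
  inr : (B.Hom Y C).X
  fst : (B.Hom C X).X
  snd : (B.Hom C Y).X
  inl_mem : inl ∈ (B.Hom X C).gr (-1) 0
  inr_mem : inr ∈ (B.Hom Y C).gr 0 0
  fst_mem : fst ∈ (B.Hom C X).gr 1 0
  snd_mem : snd ∈ (B.Hom C Y).gr 0 0
  fst_inl : B.comp fst inl = B.id X
  snd_inr : B.comp snd inr = B.id Y
  fst_inr : B.comp fst inr = 0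
  snd_inl : B.comp snd inl = 0
  total : B.comp inl fst + B.comp inr snd = B.id C
  d_inr : (B.Hom Y C).d inr = 0
  d_inl : (B.Hom X C).d inl = B.comp inr f

namespace ConeData

variable {X Y C : B.Obj} {f : (B.Hom X Y).X} (c : ConeData f C)

theorem fst_inl_assoc {W : B.Obj} (g : (B.Hom W X).X) :
    B.comp c.fst (B.comp c.inl g) = g := by rw [← B.assoc, c.fst_inl, B.id_comp]

theorem snd_inr_assoc {W : B.Obj} (g : (B.Hom W Y).X) :
    B.comp c.snd (B.comp c.inr g) = g := by rw [← B.assoc, c.snd_inr, B.id_comp]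

theorem fst_inr_assoc {W : B.Obj} (g : (B.Hom W Y).X) :
    B.comp c.fst (B.comp c.inr g) = 0 := by
  rw [← B.assoc, c.fst_inr, map_zero, LinearMap.zero_apply]

theorem snd_inl_assoc {W : B.Obj} (g : (B.Hom W X).X) :
    B.comp c.snd (B.comp c.inl g) = 0 := by
  rw [← B.assoc, c.snd_inl, map_zero, LinearMap.zero_apply]

theorem inr_snd_assoc {W : B.Obj} (g : (B.Hom W C).X) :
    B.comp c.inr (B.comp c.snd g) = g - B.comp c.inl (B.comp c.fst g) := by
  rw [eq_sub_iff_add_eq, ← B.assoc, ← B.assoc, ← LinearMap.add_apply, ← map_add, add_comm,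
    c.total, B.id_comp]

theorem inr_snd : B.comp c.inr c.snd = B.id C - B.comp c.inl c.fst := by
  rw [eq_sub_iff_add_eq, add_comm, c.total]

/-- The differential of the relation `total`; the differentials of the two projections are
read off from its two components. -/
theorem d_total : B.comp c.inr (B.comp f c.fst) - B.comp c.inl ((B.Hom C X).d c.fst) +
    B.comp c.inr ((B.Hom C Y).d c.snd) = 0 := by
  have h := congrArg (B.Hom C C).d c.total
  rw [map_add, d_comp_neg_one c.inl_mem, d_comp_zero c.inr_mem, c.d_inr, c.d_inl, B.assoc,
    B.id_closed] at h
  simpa using h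

theorem d_fst : (B.Hom C X).d c.fst = 0 := by
  have h := congrArg (B.comp c.fst) c.d_total
  simpa [fst_inr_assoc, fst_inl_assoc] using h

theorem d_snd : (B.Hom C Y).d c.snd = -B.comp f c.fst := by
  have h := congrArg (B.comp c.snd) c.d_total
  rw [map_add, map_sub, c.snd_inr_assoc, c.snd_inl_assoc, c.snd_inr_assoc, map_zero,
    sub_zero] at h
  exact eq_neg_of_add_eq_zero_right h

attribute [simp] fst_inl snd_inr fst_inr snd_inl fst_inl_assoc snd_inr_assoc fst_inr_assoc
  snd_inl_assoc d_inr d_inl d_fst d_snd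

theorem inr_cocycle : c.inr ∈ (B.Hom Y C).cocycles 0 := mem_cocycles_iff.2 ⟨c.inr_mem, c.d_inr⟩

/-- The image of a cone under conjugation by shifts of degree `n`: it is a cone of
`(-1)^n` times the conjugate of `f`. -/
def conj {X' Y' C' : B.Obj} {r : ℝ} {n : ℤ} (u : Twist B X X' r n) (v : Twist B Y Y' r n)
    (t : Twist B C C' r n) : ConeData (n.negOnePow • Twist.conjLin u v f) C' where
  inl := n.negOnePow • Twist.conjLin u t c.inl
  inr := n.negOnePow • Twist.conjLin v t c.inr
  fst := n.negOnePow • Twist.conjLin t u c.fst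
  snd := n.negOnePow • Twist.conjLin t v c.snd
  inl_mem := units_smul_mem _ _ (Twist.conjLin_mem _ _ c.inl_mem)
  inr_mem := units_smul_mem _ _ (Twist.conjLin_mem _ _ c.inr_mem)
  fst_mem := units_smul_mem _ _ (Twist.conjLin_mem _ _ c.fst_mem)
  snd_mem := units_smul_mem _ _ (Twist.conjLin_mem _ _ c.snd_mem)
  fst_inl := by
    rw [units_smul_comp, comp_units_smul, smul_smul, Int.units_mul_self, one_smul,
      ← Twist.conjLin_comp, c.fst_inl, Twist.conjLin_id]
  snd_inr := by
    rw [units_smul_comp, comp_units_smul, smul_smul, Int.units_mul_self, one_smul,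
      ← Twist.conjLin_comp, c.snd_inr, Twist.conjLin_id]
  fst_inr := by
    rw [units_smul_comp, comp_units_smul, ← Twist.conjLin_comp, c.fst_inr]; simp
  snd_inl := by
    rw [units_smul_comp, comp_units_smul, ← Twist.conjLin_comp, c.snd_inl]; simp
  total := by
    rw [units_smul_comp, comp_units_smul, smul_smul, Int.units_mul_self, one_smul,
      units_smul_comp, comp_units_smul, smul_smul, Int.units_mul_self, one_smul,
      ← Twist.conjLin_comp, ← Twist.conjLin_comp, ← map_add, c.total, Twist.conjLin_id]
  d_inr := by rw [d_units_smul, Twist.d_conjLin, c.d_inr]; simp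
  d_inl := by
    rw [d_units_smul, Twist.d_conjLin, c.d_inl, units_smul_comp, comp_units_smul,
      Twist.conjLin_comp _ v]

/-- The cone of an isomorphism of degree `0` whose inverse raises the filtration by at most `r`
is acyclic at level `r`: a contraction is `inl ∘ f⁻¹ ∘ snd`. -/
theorem isAcyclic (c : ConeData f C) {g : (B.Hom Y X).X} {r : ℝ} (hr : 0 ≤ r)
    (hg : g ∈ (B.Hom Y X).gr 0 r) (hd : (B.Hom Y X).d g = 0)
    (hgf : B.comp g f = B.id X) (hfg : B.comp f g = B.id Y) :
    B.H0.IsAcyclic hr C := by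
  refine (i_cls _ _).trans ((Submodule.Quotient.mk_eq_zero _).2
    ⟨B.comp c.inl (B.comp g c.snd), comp_gr c.inl_mem (comp_gr hg c.snd_mem rfl le_rfl)
      (by norm_num) (by norm_num), ?_⟩)
  have h1 : B.comp f (B.comp g c.snd) = c.snd := by rw [← B.assoc, hfg, B.id_comp]
  have h2 : B.comp g (B.comp f c.fst) = c.fst := by rw [← B.assoc, hgf, B.id_comp]
  rw [d_comp_neg_one c.inl_mem, d_comp_zero hg]
  simp [hd, B.assoc, h1, h2, inr_snd]

end ConeData

/-- Every closed morphism `f` of degree `0` with `ℓ f ≤ 0` has a cone, and there is an object; a zero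
object is then obtained as the cone of an identity. -/
class HasCones (B : FilteredDGCat.{w, u, v} k) : Prop where
  nonempty : Nonempty B.Obj
  exists_cone : ∀ {X Y : B.Obj} (f : (B.Hom X Y).X), f ∈ (B.Hom X Y).cocycles 0 →
    ∃ C, Nonempty (ConeData f C)

/-- The cone of an identity is contractible at level `0`. -/
theorem isZero_cone_id {X C : B.Obj} (c : ConeData (B.id X) C) :
    Limits.IsZero (C := B.H0.Zero) C := by
  refine (Limits.IsZero.iff_id_eq_zero (C := B.H0.Zero) C).2 ?_
  have h := c.isAcyclic le_rfl (id_gr X) (B.id_closed X) (B.id_comp _) (B.id_comp _)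
  exact (B.H0.i_refl _).symm.trans h

instance [HasCones B] : Limits.HasZeroObject B.H0.Zero := by
  obtain ⟨X⟩ := HasCones.nonempty (B := B)
  obtain ⟨C, ⟨c⟩⟩ := HasCones.exists_cone (B.id X) (B.id_mem_cocycles X)
  exact ⟨_, isZero_cone_id c⟩

/-- Homotopy equivalences are isomorphisms in the `0`-level. -/
def homIso {X Y : B.Obj} {a : (B.Hom X Y).X} {b : (B.Hom Y X).X}
    (ha : a ∈ (B.Hom X Y).cocycles 0) (hb : b ∈ (B.Hom Y X).cocycles 0)
    (h : (B.Hom X X).X) (hh : h ∈ (B.Hom X X).gr (-1) 0)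
    (hd : (B.Hom X X).d h = B.id X - B.comp b a)
    (h' : (B.Hom Y Y).X) (hh' : h' ∈ (B.Hom Y Y).gr (-1) 0)
    (hd' : (B.Hom Y Y).d h' = B.id Y - B.comp a b) :
    @Iso B.H0.Zero _ X Y where
  hom := homCls a ha
  inv := homCls b hb
  hom_inv_id := (homCls_comp ha hb).trans (cls_eq_iff.2 ⟨h, hh, hd⟩ :
    cls (B.id X) (B.id_mem_cocycles X) = cls _ _).symm
  inv_hom_id := (homCls_comp hb ha).trans (cls_eq_iff.2 ⟨h', hh', hd'⟩ :
    cls (B.id Y) (B.id_mem_cocycles Y) = cls _ _).symm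

variable [Shifts B]

/-! ### Standard triangles -/

open Pretriangulated

theorem proj_cocycle {X Y C : B.Obj} {f : (B.Hom X Y).X} (c : ConeData f C) :
    B.comp (tu 1 X).hom c.fst ∈ (B.Hom C (tr 1 X)).cocycles 0 :=
  mem_cocycles_iff.2 ⟨comp_gr (tu 1 X).hom_mem c.fst_mem (by norm_num) (by norm_num), by
    rw [d_comp_of_closed (tu 1 X).hom_mem (tu 1 X).d_hom]; simp⟩

/-- The triangle `X ⟶ Y ⟶ C ⟶ X[-1]` of a cone. -/
abbrev stdTriangle {X Y C : B.Obj} {f : (B.Hom X Y).X} (hf : f ∈ (B.Hom X Y).cocycles 0)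
    (c : ConeData f C) : Triangle B.H0.Zero :=
  Triangle.mk (homCls f hf) (homCls c.inr c.inr_cocycle) (Z := (show B.H0.Zero from C))
    (show @Quiver.Hom B.H0.Zero _ C ((shiftFunctor B.H0.Zero (1 : ℤ)).obj X) from
      homCls (B.comp (tu 1 X).hom c.fst) (proj_cocycle c))

variable (B) in
/-- The triangles isomorphic to the triangle of a cone. -/
def exactTriangles : Set (Triangle B.H0.Zero) :=
  {T | ∃ (X Y C : B.Obj) (f : (B.Hom X Y).X) (hf : f ∈ (B.Hom X Y).cocycles 0)
    (c : ConeData f C), Nonempty (T ≅ stdTriangle hf c)}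

section

variable {X Y C : B.Obj} {f : (B.Hom X Y).X} (hf : f ∈ (B.Hom X Y).cocycles 0)
  (c : ConeData f C)

theorem contractible_exact (X : B.H0.Zero) [HasCones B] :
    contractibleTriangle X ∈ exactTriangles B := by
  obtain ⟨C, ⟨c⟩⟩ := HasCones.exists_cone (B.id X) (B.id_mem_cocycles X)
  have hC := isZero_cone_id c
  refine ⟨X, X, C, _, B.id_mem_cocycles X, c, ⟨Triangle.isoMk _ _ (Iso.refl _) (Iso.refl _)
    ((Limits.isZero_zero _).iso hC) ?_ ?_ ?_⟩⟩
  · rfl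
  · exact hC.eq_of_tgt _ _
  · exact (Limits.isZero_zero _).eq_of_src _ _

/-- The rotated triangle of the cone `C` of `f` is the triangle of a cone `C'` of the inclusion
`inr : Y ⟶ C`.  The comparison `X[-1] ⟶ C'` is `inl` corrected by `f` so as to become closed. -/
theorem rotate_std {C' : B.Obj} (c' : ConeData c.inr C') :
    Nonempty ((stdTriangle hf c).rotate ≅ stdTriangle c.inr_cocycle c') := by
  have hf' := (mem_cocycles_iff.1 hf).1
  have hfd : (B.Hom X Y).d f = 0 := (mem_cocycles_iff.1 hf).2
  have hs := (tu 1 X).hom_mem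
  have hi := (tu 1 X).inv_mem
  have ha : B.comp c'.inr (B.comp c.inl (tu 1 X).inv) - B.comp c'.inl (B.comp f (tu 1 X).inv) ∈
      (B.Hom (tr 1 X) C').cocycles 0 := mem_cocycles_iff.2 ⟨Submodule.sub_mem _
    (comp_gr c'.inr_mem (comp_gr c.inl_mem hi rfl le_rfl) (by norm_num) (by norm_num))
    (comp_gr c'.inl_mem (comp_gr hf' hi rfl le_rfl) (by norm_num) (by norm_num)), by
      rw [map_sub, d_comp_zero c'.inr_mem, d_comp_neg_one c.inl_mem, d_comp_neg_one c'.inl_mem,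
        d_comp_zero hf']
      simp [hfd, B.assoc]⟩
  have hb : B.comp (tu 1 X).hom (B.comp c.fst c'.snd) ∈ (B.Hom C' (tr 1 X)).cocycles 0 :=
    mem_cocycles_iff.2 ⟨comp_gr hs (comp_gr c.fst_mem c'.snd_mem rfl le_rfl)
      (by norm_num) (by norm_num), by
      rw [d_comp_of_closed hs (tu 1 X).d_hom, d_comp_one c.fst_mem]
      simp⟩
  let e := homIso ha hb 0 (Submodule.zero_mem _) (by simp [B.assoc])
    (B.comp c'.inl (B.comp c.snd c'.snd))
    (comp_gr c'.inl_mem (comp_gr c.snd_mem c'.snd_mem rfl le_rfl) (by norm_num) (by norm_num)) (by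
      rw [d_comp_neg_one c'.inl_mem, d_comp_zero c.snd_mem]
      simp only [ConeData.d_inl, ConeData.d_snd, B.assoc, map_add, map_neg, LinearMap.neg_apply,
        map_sub, LinearMap.sub_apply, ConeData.snd_inr_assoc, Twist.hom_inv_assoc,
        ConeData.inr_snd_assoc, ConeData.inr_snd]
      abel)
  refine ⟨Triangle.isoMk _ _ (Iso.refl _) (Iso.refl _) e ?_ ?_ ?_⟩
  · exact (Category.comp_id _).trans (Category.id_comp _).symm
  · have h : homCls c'.inr c'.inr_cocycle ≫ e.inv =
        homCls (B.comp (tu 1 X).hom c.fst) (proj_cocycle c) :=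
      (homCls_comp _ hb).trans (cls_congr (by simp [B.assoc, B.comp_id]))
    refine Eq.trans ?_ (Category.id_comp (homCls c'.inr c'.inr_cocycle)).symm
    exact (Iso.eq_comp_inv e).1 h.symm
  · refine (congrArg (fun x => _ ≫ x) ((shiftFunctor B.H0.Zero (1 : ℤ)).map_id _)).trans ?_
    refine (Category.comp_id _).trans ?_
    refine Eq.trans ?_ (homCls_comp ha (proj_cocycle c')).symm
    refine (congrArg Neg.neg (shift_homCls 1 hf)).trans (cls_congr ?_)
    change -B.comp (tu 1 Y).hom (B.comp f (tu 1 X).inv) = _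
    simp [B.assoc]

end

end FilteredDGCat

namespace FilteredDGCat

open FilteredComplex PersistenceCategory Shifts Pretriangulated

variable {k : Type w} [Field k] {B : FilteredDGCat.{w, u, v} k} [Shifts B]

/-! ### The axioms of triangulated categories -/

theorem iso_exact {T T' : Triangle B.H0.Zero} (hT : T ∈ exactTriangles B) (e : T' ≅ T) :
    T' ∈ exactTriangles B := by
  obtain ⟨X, Y, C, f, hf, c, ⟨e'⟩⟩ := hT
  exact ⟨X, Y, C, f, hf, c, ⟨e ≪≫ e'⟩⟩

theorem std_exact {X Y C : B.Obj} {f : (B.Hom X Y).X} (hf : f ∈ (B.Hom X Y).cocycles 0)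
    (c : ConeData f C) : stdTriangle hf c ∈ exactTriangles B :=
  ⟨X, Y, C, f, hf, c, ⟨Iso.refl _⟩⟩

/-- Translating a standard triangle with the signs `(-1)^n` of `Triangle.shiftFunctor` gives a
standard triangle: these are the signs in `ConeData.conj`. -/
theorem shift_std {X Y C : B.Obj} {f : (B.Hom X Y).X} (hf : f ∈ (B.Hom X Y).cocycles 0)
    (c : ConeData f C) (n : ℤ) :
    (Triangle.shiftFunctor B.H0.Zero n).obj (stdTriangle hf c) ∈ exactTriangles B := by
  let c' := c.conj (tu n X) (tu n Y) (tu n C)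
  have he : (-n).negOnePow = n.negOnePow := Int.negOnePow_neg n
  refine iso_exact (std_exact (units_smul_mem _ _ (Twist.conjLin_cocycles _ _ hf)) c')
    (Triangle.isoMk _ _ (Iso.refl _) (Iso.refl _) (Iso.refl _) ?_ ?_ ?_)
  · refine (Category.comp_id _).trans (Eq.trans ?_ (Category.id_comp _).symm)
    refine (congrArg (fun x => n.negOnePow • x) (shift_homCls n hf)).trans
      ((units_smul_homCls _ _).trans (cls_congr ?_))
    rw [he]
  · refine (Category.comp_id _).trans (Eq.trans ?_ (Category.id_comp _).symm)
    refine (congrArg (fun x => n.negOnePow • x) (shift_homCls n c.inr_cocycle)).trans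
      ((units_smul_homCls _ _).trans (cls_congr ?_))
    change _ = (-n).negOnePow • _
    rw [he]
  · refine (congrArg (fun x => _ ≫ x) ((shiftFunctor B.H0.Zero (1 : ℤ)).map_id _)).trans ?_
    refine (Category.comp_id _).trans (Eq.trans ?_ (Category.id_comp _).symm)
    refine (congrArg (fun x => n.negOnePow • x) ((congrArg₂ (fun x y => x ≫ y)
      (shift_homCls n (proj_cocycle c)) (shiftFunctorComm_app n X)).trans
      (homCls_comp _ _))).trans ((units_smul_homCls _ _).trans (cls_congr ?_))
    change n.negOnePow • B.comp (B.comp (B.comp (tu 1 (tr n X)).hom (tu n X).hom)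
        (B.comp (tu 1 X).inv (tu n (tr 1 X)).inv))
      (B.comp (tu n (tr 1 X)).hom (B.comp (B.comp (tu 1 X).hom c.fst) (tu n C).inv)) =
      B.comp (tu 1 (tr n X)).hom
        ((-n).negOnePow • B.comp (tu n X).hom (B.comp c.fst (tu n C).inv))
    simp [B.assoc]

theorem shift_exact {T : Triangle B.H0.Zero} (hT : T ∈ exactTriangles B) (n : ℤ) :
    (Triangle.shiftFunctor B.H0.Zero n).obj T ∈ exactTriangles B := by
  obtain ⟨X, Y, C, f, hf, c, ⟨e⟩⟩ := hT
  exact iso_exact (shift_std hf c n) ((Triangle.shiftFunctor B.H0.Zero n).mapIso e)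

theorem rotate_exact [HasCones B] {T : Triangle B.H0.Zero} (hT : T ∈ exactTriangles B) :
    T.rotate ∈ exactTriangles B := by
  obtain ⟨X, Y, C, f, hf, c, ⟨e⟩⟩ := hT
  obtain ⟨C', ⟨c'⟩⟩ := HasCones.exists_cone c.inr c.inr_cocycle
  obtain ⟨e'⟩ := rotate_std hf c c'
  exact ⟨_, _, _, _, _, c', ⟨(rotate B.H0.Zero).mapIso e ≪≫ e'⟩⟩

theorem exact_of_rotate [HasCones B] {T : Triangle B.H0.Zero}
    (hT : T.rotate ∈ exactTriangles B) : T ∈ exactTriangles B := by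
  -- three rotations are the shift by `1`, which is undone by the shift by `-1`
  have h1 : (Triangle.shiftFunctor B.H0.Zero 1).obj T ∈ exactTriangles B :=
    iso_exact (rotate_exact (rotate_exact hT)) ((rotateRotateRotateIso B.H0.Zero).symm.app T)
  exact iso_exact (shift_exact h1 (-1))
    ((Triangle.shiftFunctorZero B.H0.Zero).symm.app T ≪≫
      (Triangle.shiftFunctorAdd' B.H0.Zero 1 (-1) 0 (by norm_num)).app T)

/-- A square that commutes up to the homotopy `s` extends to the cones, by the matrix with diagonal
entries `a` and `b` and off-diagonal entry `s`. -/
theorem complete_std {X Y C X' Y' C' : B.Obj} {f : (B.Hom X Y).X} {f' : (B.Hom X' Y').X}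
    (hf : f ∈ (B.Hom X Y).cocycles 0) (hf' : f' ∈ (B.Hom X' Y').cocycles 0)
    (c : ConeData f C) (c' : ConeData f' C')
    {a : (B.Hom X X').X} (ha : a ∈ (B.Hom X X').cocycles 0) {b : (B.Hom Y Y').X}
    (hb : b ∈ (B.Hom Y Y').cocycles 0)
    (h : homCls f hf ≫ homCls b hb = homCls a ha ≫ homCls f' hf') :
    ∃ t : (stdTriangle hf c).obj₃ ⟶ (stdTriangle hf' c').obj₃,
      (stdTriangle hf c).mor₂ ≫ t = homCls b hb ≫ (stdTriangle hf' c').mor₂ ∧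
      (stdTriangle hf c).mor₃ ≫ (homCls a ha)⟦(1 : ℤ)⟧' = t ≫ (stdTriangle hf' c').mor₃ := by
  rw [homCls_comp, homCls_comp] at h
  obtain ⟨s, hs, hsd⟩ := cls_eq_iff.1 h
  obtain ⟨ha0, had⟩ := mem_cocycles_iff.1 ha
  obtain ⟨hb0, hbd⟩ := mem_cocycles_iff.1 hb
  have ht : B.comp c'.inl (B.comp a c.fst) + B.comp c'.inr (B.comp b c.snd) +
      B.comp c'.inr (B.comp s c.fst) ∈ (B.Hom C C').cocycles 0 := by
    refine mem_cocycles_iff.2 ⟨Submodule.add_mem _ (Submodule.add_mem _ ?_ ?_) ?_, ?_⟩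
    · exact comp_gr c'.inl_mem (comp_gr ha0 c.fst_mem rfl le_rfl) (by norm_num) (by norm_num)
    · exact comp_gr c'.inr_mem (comp_gr hb0 c.snd_mem rfl le_rfl) (by norm_num) (by norm_num)
    · exact comp_gr c'.inr_mem (comp_gr hs c.fst_mem rfl le_rfl) (by norm_num) (by norm_num)
    · rw [map_add, map_add, d_comp_neg_one c'.inl_mem, d_comp_zero c'.inr_mem,
        d_comp_zero c'.inr_mem, d_comp_zero ha0, d_comp_zero hb0, d_comp_neg_one hs]
      simp [had, hbd, hsd, B.assoc]
      abel
  refine ⟨homCls _ ht, ?_, ?_⟩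
  · refine (homCls_comp c.inr_cocycle ht).trans ((cls_congr ?_).trans
      (homCls_comp hb c'.inr_cocycle).symm)
    simp [B.assoc, B.comp_id]
  · refine (congrArg (fun x => homCls _ (proj_cocycle c) ≫ x) (shift_homCls 1 ha)).trans
      ((cls_congr ?_).trans (homCls_comp ht (proj_cocycle c')).symm)
    change B.comp (B.comp (tu 1 X').hom (B.comp a (tu 1 X).inv)) (B.comp (tu 1 X).hom c.fst) = _
    simp [B.assoc]

/-- The exact triangles are the triangles isomorphic to those of cones. -/
instance [HasCones B] : Pretriangulated B.H0.Zero where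
  distinguishedTriangles := exactTriangles B
  isomorphic_distinguished T hT T' e := iso_exact hT e
  contractible_distinguished X := contractible_exact X
  distinguished_cocone_triangle := fun {X Y} f => by
    obtain ⟨f, hf, rfl⟩ := exists_homCls (B := B) f
    obtain ⟨C, ⟨c⟩⟩ := HasCones.exists_cone f hf
    exact ⟨_, _, _, std_exact hf c⟩
  rotate_distinguished_triangle T := ⟨rotate_exact, exact_of_rotate⟩
  complete_distinguished_triangle_morphism := by
    rintro T T' ⟨X, Y, C, f, hf, c, ⟨e⟩⟩ ⟨X', Y', C', f', hf', c', ⟨e'⟩⟩ a b h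
    obtain ⟨a', ha, haa⟩ := exists_homCls (B := B) (e.inv.hom₁ ≫ a ≫ e'.hom.hom₁)
    obtain ⟨b', hb, hbb⟩ := exists_homCls (B := B) (e.inv.hom₂ ≫ b ≫ e'.hom.hom₂)
    have hc : (stdTriangle hf c).mor₁ ≫ (e.inv.hom₂ ≫ b ≫ e'.hom.hom₂) =
        (e.inv.hom₁ ≫ a ≫ e'.hom.hom₁) ≫ (stdTriangle hf' c').mor₁ := by
      rw [← Category.assoc, e.inv.comm₁, Category.assoc, ← Category.assoc T.mor₁, h]
      simp only [Category.assoc, e'.hom.comm₁]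
    obtain ⟨t, h1, h2⟩ := complete_std hf hf' c c' ha hb
      ((congrArg (fun x => (stdTriangle hf c).mor₁ ≫ x) hbb.symm).trans
        (hc.trans (congrArg (fun x => x ≫ (stdTriangle hf' c').mor₁) haa)))
    replace h1 : (stdTriangle hf c).mor₂ ≫ t =
      (e.inv.hom₂ ≫ b ≫ e'.hom.hom₂) ≫ (stdTriangle hf' c').mor₂ :=
        h1.trans (congrArg (fun x => x ≫ (stdTriangle hf' c').mor₂) hbb.symm)
    replace h2 : (stdTriangle hf c).mor₃ ≫ (e.inv.hom₁ ≫ a ≫ e'.hom.hom₁)⟦(1 : ℤ)⟧' =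
      t ≫ (stdTriangle hf' c').mor₃ :=
        (congrArg (fun x => (stdTriangle hf c).mor₃ ≫
          (shiftFunctor B.H0.Zero (1 : ℤ)).map x) haa).trans h2
    refine ⟨e.hom.hom₃ ≫ t ≫ e'.inv.hom₃, ?_, ?_⟩
    · rw [← Category.assoc, e.hom.comm₂, Category.assoc, ← Category.assoc _ t, h1]
      simp only [Category.assoc, e'.inv.comm₂]
      rw [← Category.assoc e.hom.hom₂, e.hom_inv_id_triangle_hom₂, Category.id_comp,
        ← Category.assoc e'.hom.hom₂, e'.hom_inv_id_triangle_hom₂, Category.id_comp]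
    · rw [Category.assoc, Category.assoc, ← e'.inv.comm₃, ← Category.assoc t, ← h2,
        Category.assoc, ← Category.assoc e.hom.hom₃, ← e.hom.comm₃, Category.assoc,
        ← Functor.map_comp, ← Functor.map_comp]
      simp only [Category.assoc, e'.hom_inv_id_triangle_hom₁, Category.comp_id]
      rw [← Category.assoc e.hom.hom₁, e.hom_inv_id_triangle_hom₁, Category.id_comp]

end FilteredDGCat

/-! ### Direct sums in a persistence category -/

namespace PersistenceCategory

variable {k : Type w} [Field k] {C : PersistenceCategory.{w, u, v} k}

/-- Associativity of composition with bounds on the shifts in place of their sums. -/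
theorem cmp_assoc {X Y Z W : C.Obj} {r s t a b q : ℝ} (f : C.Mor r X Y) (g : C.Mor s Y Z)
    (h : C.Mor t Z W) (h1 : r + s ≤ a) (h2 : a + t ≤ q) (h3 : s + t ≤ b) (h4 : r + b ≤ q) :
    cmp h2 (cmp h1 f g) h = cmp h4 f (cmp h3 g h) := by
  simp only [cmp]
  have e1 := C.comp_i h1 le_rfl (C.comp f g) h
  have e2 := C.comp_i le_rfl h3 f (C.comp g h)
  rw [C.i_refl] at e1 e2
  rw [e1, e2, ← C.assoc, C.i_trans, C.i_trans, C.i_trans]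

theorem id_cmp {X Y : C.Obj} {r : ℝ} (f : C.Mor r X Y) : cmp (zero_add r).le (C.id X) f = f :=
  C.id_comp f

theorem cmp_id {X Y : C.Obj} {r : ℝ} (f : C.Mor r X Y) : cmp (add_zero r).le f (C.id Y) = f :=
  C.comp_id f

theorem zero_cmp {X Y Z : C.Obj} {r s t : ℝ} (h : r + s ≤ t) (g : C.Mor s Y Z) :
    cmp h (0 : C.Mor r X Y) g = 0 := by
  simp [cmp]

theorem cmp_zero {X Y Z : C.Obj} {r s t : ℝ} (h : r + s ≤ t) (f : C.Mor r X Y) :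
    cmp h f (0 : C.Mor s Y Z) = 0 := by
  simp [cmp]

/-- A direct sum decomposition of `P` in the `0`-level splits the morphisms out of `P`. -/
theorem bijective_pair_left {A B P : C.Obj} {inl : C.Mor 0 A P} {inr : C.Mor 0 B P}
    {fst : C.Mor 0 P A} {snd : C.Mor 0 P B} (h0 : (0 : ℝ) + 0 ≤ 0)
    (e1 : cmp h0 inl fst = C.id A) (e2 : cmp h0 inl snd = 0) (e3 : cmp h0 inr fst = 0)
    (e4 : cmp h0 inr snd = C.id B) (ht : cmp h0 fst inl + cmp h0 snd inr = C.id P)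
    (X : C.Obj) (r : ℝ) : Function.Bijective fun f : C.Mor r P X =>
      ((cmp (zero_add r).le inl f, cmp (zero_add r).le inr f) : C.Mor r A X × C.Mor r B X) := by
  have hr := (zero_add r).le
  refine Function.bijective_iff_has_inverse.2
    ⟨fun p => cmp hr fst p.1 + cmp hr snd p.2, fun f => ?_, fun p => Prod.ext ?_ ?_⟩
  · dsimp only
    rw [← cmp_assoc fst inl f h0 hr hr hr, ← cmp_assoc snd inr f h0 hr hr hr, ← add_cmp,
      ht, id_cmp]
  · dsimp only
    rw [cmp_add, ← cmp_assoc inl fst p.1 h0 hr hr hr,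
      ← cmp_assoc inl snd p.2 h0 hr hr hr, e1, e2, zero_cmp, add_zero, id_cmp]
  · dsimp only
    rw [cmp_add, ← cmp_assoc inr fst p.1 h0 hr hr hr,
      ← cmp_assoc inr snd p.2 h0 hr hr hr, e3, e4, zero_cmp, zero_add, id_cmp]

/-- A direct sum decomposition of `P` in the `0`-level splits the morphisms into `P`. -/
theorem bijective_pair_right {A B P : C.Obj} {inl : C.Mor 0 A P} {inr : C.Mor 0 B P}
    {fst : C.Mor 0 P A} {snd : C.Mor 0 P B} (h0 : (0 : ℝ) + 0 ≤ 0)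
    (e1 : cmp h0 inl fst = C.id A) (e2 : cmp h0 inl snd = 0) (e3 : cmp h0 inr fst = 0)
    (e4 : cmp h0 inr snd = C.id B) (ht : cmp h0 fst inl + cmp h0 snd inr = C.id P)
    (X : C.Obj) (r : ℝ) : Function.Bijective fun f : C.Mor r X P =>
      ((cmp (add_zero r).le f fst, cmp (add_zero r).le f snd) : C.Mor r X A × C.Mor r X B) := by
  have hr := (add_zero r).le
  refine Function.bijective_iff_has_inverse.2
    ⟨fun p => cmp hr p.1 inl + cmp hr p.2 inr, fun f => ?_, fun p => Prod.ext ?_ ?_⟩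
  · dsimp only
    rw [cmp_assoc f fst inl hr hr h0 hr, cmp_assoc f snd inr hr hr h0 hr, ← cmp_add,
      ht, cmp_id]
  · dsimp only
    rw [add_cmp, cmp_assoc p.1 inl fst hr hr h0 hr,
      cmp_assoc p.2 inr fst hr hr h0 hr, e1, e3, cmp_zero, add_zero, cmp_id]
  · dsimp only
    rw [add_cmp, cmp_assoc p.1 inl snd hr hr h0 hr,
      cmp_assoc p.2 inr snd hr hr h0 hr, e2, e4, cmp_zero, zero_add, cmp_id]

end PersistenceCategory

namespace FilteredDGCat

open FilteredComplex PersistenceCategory Shifts Pretriangulated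

variable {k : Type w} [Field k] {B : FilteredDGCat.{w, u, v} k}

/-! ### The octahedron axiom -/

section octahedron

variable {X Y Z C₁ C₂ C₃ D : B.Obj} {f : (B.Hom X Y).X} {g : (B.Hom Y Z).X}
  (c₁ : ConeData f C₁) (c₂ : ConeData g C₂) (c₃ : ConeData (B.comp g f) C₃)

/-- The morphism from the cone of `f` to the cone of `g ∘ f` induced by `g`. -/
def octLeft : (B.Hom C₁ C₃).X := B.comp c₃.inl c₁.fst + B.comp c₃.inr (B.comp g c₁.snd)

/-- The morphism from the cone of `g ∘ f` to the cone of `g` induced by `f`. -/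
def octRight : (B.Hom C₃ C₂).X := B.comp c₂.inl (B.comp f c₃.fst) + B.comp c₂.inr c₃.snd

theorem octLeft_cocycle (hg : g ∈ (B.Hom Y Z).cocycles 0) :
    octLeft c₁ c₃ ∈ (B.Hom C₁ C₃).cocycles 0 := by
  obtain ⟨hg0, hgd⟩ := mem_cocycles_iff.1 hg
  refine mem_cocycles_iff.2 ⟨Submodule.add_mem _
    (comp_gr c₃.inl_mem c₁.fst_mem (by norm_num) (by norm_num))
    (comp_gr c₃.inr_mem (comp_gr hg0 c₁.snd_mem rfl le_rfl) (by norm_num) (by norm_num)), ?_⟩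
  rw [octLeft, map_add, d_comp_neg_one c₃.inl_mem, d_comp_zero c₃.inr_mem, d_comp_zero hg0]
  simp [hgd, B.assoc]

theorem octRight_cocycle (hf : f ∈ (B.Hom X Y).cocycles 0) :
    octRight c₂ c₃ ∈ (B.Hom C₃ C₂).cocycles 0 := by
  obtain ⟨hf0, hfd⟩ := mem_cocycles_iff.1 hf
  refine mem_cocycles_iff.2 ⟨Submodule.add_mem _
    (comp_gr c₂.inl_mem (comp_gr hf0 c₃.fst_mem rfl le_rfl) (by norm_num) (by norm_num))
    (comp_gr c₂.inr_mem c₃.snd_mem (by norm_num) (by norm_num)), ?_⟩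
  rw [octRight, map_add, d_comp_neg_one c₂.inl_mem, d_comp_zero c₂.inr_mem, d_comp_zero hf0]
  simp [hfd, B.assoc]

variable [Shifts B]

/-- The cone `D` of the induced morphism between the cones of `f` and of `g ∘ f` is homotopy
equivalent to the cone of `g`. -/
theorem octahedron_exact (hf : f ∈ (B.Hom X Y).cocycles 0) (hg : g ∈ (B.Hom Y Z).cocycles 0)
    (c : ConeData (octLeft c₁ c₃) D) :
    Triangle.mk (C := B.H0.Zero) (homCls _ (octLeft_cocycle c₁ c₃ hg))
      (homCls _ (octRight_cocycle c₂ c₃ hf))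
      ((stdTriangle hg c₂).mor₃ ≫ (stdTriangle hf c₁).mor₂⟦(1 : ℤ)⟧') ∈ exactTriangles B := by
  obtain ⟨hf0, hfd⟩ := mem_cocycles_iff.1 hf
  have hl := octLeft_cocycle c₁ c₃ hg
  have hr := octRight_cocycle c₂ c₃ hf
  obtain ⟨hr0, hrd⟩ := mem_cocycles_iff.1 hr
  have ha : B.comp c.inr (B.comp c₃.inr c₂.snd) + B.comp c.inl (B.comp c₁.inr c₂.fst) ∈
      (B.Hom C₂ D).cocycles 0 := mem_cocycles_iff.2 ⟨Submodule.add_mem _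
    (comp_gr c.inr_mem (comp_gr c₃.inr_mem c₂.snd_mem rfl le_rfl) (by norm_num) (by norm_num))
    (comp_gr c.inl_mem (comp_gr c₁.inr_mem c₂.fst_mem rfl le_rfl) (by norm_num) (by norm_num)),
    by
      rw [map_add, d_comp_zero c.inr_mem, d_comp_neg_one c.inl_mem, d_comp_zero c₃.inr_mem,
        d_comp_zero c₁.inr_mem]
      simp [octLeft, B.assoc]⟩
  have hb : B.comp (octRight c₂ c₃) c.snd + B.comp c₂.inl (B.comp c₁.snd c.fst) ∈
      (B.Hom D C₂).cocycles 0 := mem_cocycles_iff.2 ⟨Submodule.add_mem _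
    (comp_gr hr0 c.snd_mem (by norm_num) (by norm_num))
    (comp_gr c₂.inl_mem (comp_gr c₁.snd_mem c.fst_mem rfl le_rfl) (by norm_num) (by norm_num)),
    by
      rw [map_add, d_comp_zero hr0, d_comp_neg_one c₂.inl_mem, d_comp_zero c₁.snd_mem, hrd]
      simp [octLeft, octRight, B.assoc]⟩
  let e := homIso ha hb 0 (Submodule.zero_mem _) (by
      simp [octRight, B.assoc, ConeData.inr_snd])
    (B.comp c.inl (B.comp c₁.inl (B.comp c₃.fst c.snd)))
    (comp_gr c.inl_mem (comp_gr c₁.inl_mem (comp_gr c₃.fst_mem c.snd_mem rfl le_rfl) rfl le_rfl)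
      (by norm_num) (by norm_num)) (by
      rw [d_comp_neg_one c.inl_mem, d_comp_neg_one c₁.inl_mem, d_comp_one c₃.fst_mem]
      simp [octLeft, octRight, B.assoc, ConeData.inr_snd, ConeData.inr_snd_assoc]
      abel)
  refine iso_exact (std_exact hl c) (Triangle.isoMk _ _ (Iso.refl _) (Iso.refl _) e ?_ ?_ ?_)
  · exact (Category.comp_id _).trans (Category.id_comp _).symm
  · have h : homCls c.inr c.inr_cocycle ≫ e.inv = homCls _ hr :=
      (homCls_comp _ hb).trans (cls_congr (by simp [B.assoc, B.comp_id]))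
    refine Eq.trans ?_ (Category.id_comp (homCls c.inr c.inr_cocycle)).symm
    exact (Iso.eq_comp_inv e).1 h.symm
  · refine (congrArg (fun x => _ ≫ x) ((shiftFunctor B.H0.Zero (1 : ℤ)).map_id _)).trans ?_
    refine (Category.comp_id _).trans ?_
    refine Eq.trans ?_ (homCls_comp ha (proj_cocycle c)).symm
    refine (congrArg (fun x => (stdTriangle hg c₂).mor₃ ≫ x)
      (shift_homCls 1 c₁.inr_cocycle)).trans (cls_congr ?_)
    change B.comp (B.comp (tu 1 C₁).hom (B.comp c₁.inr (tu 1 Y).inv))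
      (B.comp (tu 1 Y).hom c₂.fst) = _
    simp [B.assoc]

end octahedron

variable [Shifts B]

/-- The octahedron axiom need only be checked on composable pairs of cocycles and one choice of
their cones. -/
instance [HasCones B] : IsTriangulated B.H0.Zero := IsTriangulated.mk' (by
  intro (X : B.Obj) (Y : B.Obj) (Z : B.Obj) φ ψ
  obtain ⟨f, hf, rfl⟩ := exists_homCls (B := B) φ
  obtain ⟨g, hg, rfl⟩ := exists_homCls (B := B) ψ
  have hgf := comp_cocycles' hf hg (add_zero 0).le
  obtain ⟨C₁, ⟨c₁⟩⟩ := HasCones.exists_cone f hf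
  obtain ⟨C₂, ⟨c₂⟩⟩ := HasCones.exists_cone g hg
  obtain ⟨C₃, ⟨c₃⟩⟩ := HasCones.exists_cone _ hgf
  obtain ⟨D, ⟨c⟩⟩ := HasCones.exists_cone _ (octLeft_cocycle c₁ c₃ hg)
  refine ⟨X, Y, Z, C₁, C₂, C₃, homCls f hf, homCls g hg, Iso.refl _, Iso.refl _, Iso.refl _,
    (Category.comp_id _).trans (Category.id_comp _).symm,
    (Category.comp_id _).trans (Category.id_comp _).symm,
    _, _, std_exact hf c₁, _, _, std_exact hg c₂, _, _, std_exact hgf c₃, ⟨?_⟩⟩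
  refine ⟨homCls _ (octLeft_cocycle c₁ c₃ hg), homCls _ (octRight_cocycle c₂ c₃ hf),
    ?_, ?_, ?_, ?_, octahedron_exact c₁ c₂ c₃ hf hg c⟩
  · exact cls_congr (by simp [octLeft, B.assoc, B.comp_id])
  · refine cls_congr ?_
    change B.comp (B.comp (tu 1 X).hom c₃.fst) (octLeft c₁ c₃) = B.comp (tu 1 X).hom c₁.fst
    simp [octLeft, B.assoc]
  · exact cls_congr (by simp [octRight, B.assoc, B.comp_id])
  · refine (congrArg (fun x => (stdTriangle hgf c₃).mor₃ ≫ x) (shift_homCls 1 hf)).trans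
      (cls_congr ?_)
    change B.comp (B.comp (tu 1 Y).hom (B.comp f (tu 1 X).inv)) (B.comp (tu 1 X).hom c₃.fst) =
      B.comp (B.comp (tu 1 Y).hom c₂.fst) (octRight c₂ c₃)
    simp [octRight, B.assoc])

/-! ### The triangulated persistence structure -/

/-- `Σ^r` maps cones to cones, without signs since its shifted copies have degree `0`. -/
theorem sigma_exact (r : ℝ) {T : Triangle B.H0.Zero} (hT : T ∈ exactTriangles B) :
    ((shiftF B).F r).zero.mapTriangle.obj T ∈ exactTriangles B := by
  obtain ⟨X, Y, C, f, hf, c, ⟨e⟩⟩ := hT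
  refine iso_exact ?_ (((shiftF B).F r).zero.mapTriangle.mapIso e)
  refine iso_exact (std_exact (units_smul_mem _ _ (Twist.conjLin_cocycles _ _ hf))
    (c.conj (su r X) (su r Y) (su r C)))
    (Triangle.isoMk _ _ (Iso.refl _) (Iso.refl _) (Iso.refl _) ?_ ?_ ?_)
  · refine (Category.comp_id _).trans (Eq.trans ?_ (Category.id_comp _).symm)
    exact cls_congr (by simp; rfl)
  · refine (Category.comp_id _).trans (Eq.trans ?_ (Category.id_comp _).symm)
    refine cls_congr ?_
    change _ = (0 : ℤ).negOnePow • Twist.conjLin (su r Y) (su r C) c.inr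
    simp
    rfl
  · refine (congrArg (fun x => _ ≫ x) ((shiftFunctor B.H0.Zero (1 : ℤ)).map_id _)).trans ?_
    refine (Category.comp_id _).trans (Eq.trans ?_ (Category.id_comp _).symm)
    refine cls_congr ?_
    change B.comp (B.comp (B.comp (tu 1 (sig r X)).hom (su r X).hom)
        (B.comp (tu 1 X).inv (su r (tr 1 X)).inv))
      (B.comp (su r (tr 1 X)).hom (B.comp (B.comp (tu 1 X).hom c.fst) (su r C).inv)) =
      B.comp (tu 1 (sig r X)).hom
        ((0 : ℤ).negOnePow • B.comp (su r X).hom (B.comp c.fst (su r C).inv))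
    simp [B.assoc]

variable (B) in
/-- A filtered dg-category with shifts and cones has a triangulated persistence category as its
degree-`0` cohomology. -/
def tpc [HasCones B] : TPC B.H0 where
  shift := shiftF B
  biprod_left b hb := bijective_pair_left (add_zero 0).le b.inl_fst b.inl_snd b.inr_fst b.inr_snd
    (Limits.IsBilimit.binary_total hb.some)
  biprod_right b hb := bijective_pair_right (add_zero 0).le b.inl_fst b.inl_snd b.inr_fst
    b.inr_snd (Limits.IsBilimit.binary_total hb.some)
  sigma_isTriangulated r := ⟨fun _ => sigma_exact r⟩
  cofiber := fun {r} hr (X : B.Obj) => by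
    have h : (su r X).inv ∈ (B.Hom (sig r X) X).cocycles 0 :=
      Twist.inv_mem_cocycles _ rfl (by linarith)
    obtain ⟨C, ⟨c⟩⟩ := HasCones.exists_cone _ h
    have he : (shiftF B).etaZero hr X = homCls (su r X).inv h := by
      refine cls_congr ?_
      change B.comp (su 0 X).inv (B.comp (su 0 X).hom (su r X).inv) = _
      simp
    refine ⟨C, homCls c.inr c.inr_cocycle, homCls _ (proj_cocycle c), ?_,
      c.isAcyclic hr (su r X).hom_mem (su r X).d_hom (su r X).inv_hom (su r X).hom_inv⟩
    rw [he]
    exact std_exact h c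

end FilteredDGCat

/-! ### Strictness -/

namespace FilteredDGCat

open FilteredComplex Shifts

variable {k : Type w} [Field k] {B : FilteredDGCat.{w, u, v} k}

/-- The laws of a strict structure are equations between morphisms whose source and target agree only
propositionally; this reduces them to such equations between cocycles. -/
theorem cls_heq {X Y X' Y' : B.Obj} {r r' : ℝ}
    {f : (B.Hom X Y).X} {f' : (B.Hom X' Y').X} (hf : f ∈ (B.Hom X Y).cocycles r)
    (hf' : f' ∈ (B.Hom X' Y').cocycles r') (hX : X = X') (hY : Y = Y') (hr : r = r')
    (h : HEq f f') : HEq (cls f hf) (cls f' hf') := by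
  subst hX hY hr
  cases h
  rfl

namespace Twist

variable {X X₁ X₂ Y Y₁ Y₂ : B.Obj} {r r' : ℝ} {n n' : ℤ}

/-- The inverse of an isomorphism is unique. -/
theorem ext {u v : Twist B X Y r n} (h : u.hom = v.hom) : u = v := by
  have h' : u.inv = v.inv := by
    have := congrArg (fun x => B.comp u.inv (B.comp x v.inv)) h
    simpa [B.comp_id] using this.symm
  cases u
  cases v
  cases h
  cases h'
  rfl

theorem conj_heq {u : Twist B X X₁ r n} {u' : Twist B X X₂ r' n'} {v : Twist B Y Y₁ r n}
    {v' : Twist B Y Y₂ r' n'} (hX : X₁ = X₂) (hY : Y₁ = Y₂) (hr : r = r') (hn : n = n')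
    (hu : HEq u.hom u'.hom) (hv : HEq v.hom v'.hom) {a : ℝ} (f : (B.Hom X Y).cohomology a) :
    HEq (conj u v f) (conj u' v' f) := by
  subst hX hY hr hn
  rw [ext (eq_of_heq hu), ext (eq_of_heq hv)]

theorem conj_refl {a : ℝ} (f : (B.Hom X Y).cohomology a) :
    conj (refl X) (refl Y) f = f := by
  obtain ⟨f, hf, rfl⟩ := exists_cls f
  exact cls_congr ((B.id_comp _).trans (B.comp_id f))

theorem conj_conj {s : ℝ} {m : ℤ} (u : Twist B X X₁ r n) (u' : Twist B X₁ X₂ s m)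
    (v : Twist B Y Y₁ r n) (v' : Twist B Y₁ Y₂ s m) {a : ℝ} (f : (B.Hom X Y).cohomology a) :
    conj u' v' (conj u v f) = conj (u.trans u') (v.trans v') f := by
  obtain ⟨f, hf, rfl⟩ := exists_cls f
  refine cls_congr ?_
  simp [conjLin_apply, trans, B.assoc]

theorem iso_hom_heq {u : Twist B X Y r n} (hn : n = 0) (hr : r = 0) (hY : Y = X)
    (h : HEq u.hom (B.id X)) : HEq (u.iso hn hr).hom (B.H0.id X) :=
  cls_heq _ _ rfl hY rfl h

theorem symm_trans_hom_heq {u : Twist B X Y₁ r n} {v : Twist B X Y₂ r' n'} (hY : Y₁ = Y₂)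
    (h : HEq u.hom v.hom) : HEq (u.symm.trans v).hom (B.id Y₂) := by
  subst hY
  refine heq_of_eq ?_
  change B.comp v.hom u.inv = _
  rw [← eq_of_heq h, u.inv_hom]

theorem symm_trans_iso_eq {u : Twist B X Y₁ r n} {v : Twist B X Y₂ r' n'} (hY : Y₁ = Y₂)
    (h : HEq u.hom v.hom) (hn : -n + n' = 0) (hr : -r + r' = 0) :
    ((u.symm.trans v).iso hn hr).hom = eqToHom (C := B.H0.Zero) hY := by
  subst hY
  exact cls_congr (eq_of_heq (symm_trans_hom_heq rfl h))

end Twist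

variable [Shifts B]

variable (B) in
/-- The chosen shifted copies satisfy the laws of an action of `ℝ` that commutes with the
translation on the nose, and the translation is bijective on objects. -/
structure StrictShifts : Prop where
  sig_zero : ∀ X : B.Obj, sig 0 X = X
  su_zero : ∀ X : B.Obj, HEq (su 0 X).hom (B.id X)
  sig_sig : ∀ r s (X : B.Obj), sig r (sig s X) = sig (r + s) X
  su_su : ∀ r s (X : B.Obj), HEq (B.comp (su r (sig s X)).hom (su s X).hom) (su (r + s) X).hom
  tr_bijective : Function.Bijective (tr (B := B) 1)
  sig_tr : ∀ r (X : B.Obj), sig r (tr 1 X) = tr 1 (sig r X)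
  su_tu : ∀ r (X : B.Obj), HEq (B.comp (su r (tr 1 X)).hom (tu 1 X).hom)
    (B.comp (tu 1 (sig r X)).hom (su r X).hom)

theorem shiftF_isStrict (h : StrictShifts B) : (shiftF B).IsStrict where
  obj_zero := h.sig_zero
  map_zero := fun {X Y : B.Obj} _ f =>
    (Twist.conj_heq (h.sig_zero X) (h.sig_zero Y) rfl rfl (h.su_zero X) (h.su_zero Y) f).trans
      (heq_of_eq (Twist.conj_refl f))
  ε_eq := fun (X : B.Obj) => Twist.iso_hom_heq rfl rfl (h.sig_zero X) (h.su_zero X)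
  obj_add := h.sig_sig
  map_add := fun r s {X Y : B.Obj} _ f =>
    (heq_of_eq (Twist.conj_conj (su s X) (su r (sig s X)) (su s Y) (su r (sig s Y)) f)).trans
      (Twist.conj_heq (h.sig_sig r s X) (h.sig_sig r s Y) (add_comm s r) (add_zero 0)
        (h.su_su r s X) (h.su_su r s Y) f)
  μ_eq := fun r s (X : B.Obj) => cls_heq _ _ (h.sig_sig r s X) rfl rfl
    (Twist.symm_trans_hom_heq (u := (su s X).trans (su r (sig s X))) (h.sig_sig r s X)
      (h.su_su r s X))

theorem tpc_isStrict [HasCones B] (h : StrictShifts B) : (tpc B).IsStrict where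
  shift_strict := shiftF_isStrict h
  T_bijective := h.tr_bijective
  T_comm := h.sig_tr
  commShift_eq := fun r (X : B.Obj) => Twist.symm_trans_iso_eq
    (u := (tu 1 X).trans (su r (tr 1 X))) (v := (su r X).trans (tu 1 (sig r X)))
    (h.sig_tr r X) (h.su_tu r X) (by ring) (by ring)

end FilteredDGCat

/-! ### Shifted copies of twisted complexes -/

namespace FilteredDGCat

open FilteredComplex

variable {k : Type w} [Field k] {A : FilteredDGCat.{w, u, v} k}

/-- The object `Σ^r X[d]` of the shift completion. -/
def sigMk (X : A.Obj) (r : ℝ) (d : ℤ) : A.Sig.Obj := SigObj.mk X r d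

namespace TwObj

theorem mk_congr {B : FilteredDGCat.{w, u, v} k} {n : ℕ} {o o' : Fin n → B.Obj}
    {q : ∀ i j : Fin n, (B.Hom (o j) (o i)).X} {q' : ∀ i j : Fin n, (B.Hom (o' j) (o' i)).X}
    {p₁ p₂ p₃ p₄ p₁' p₂' p₃' p₄'} (h : o = o') (hq : HEq q q') :
    (⟨n, o, q, p₁, p₂, p₃, p₄⟩ : TwObj B) = ⟨n, o', q', p₁', p₂', p₃', p₄'⟩ := by
  subst h
  cases hq
  rfl

/-- The differential of a homogeneous matrix, `df + q f - (-1)^m f q`, entry by entry. -/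
theorem D_apply_of_mem {B : FilteredDGCat.{w, u, v} k} {X Y : TwObj B} {m : ℤ}
    {f : (B.matComplex X.obj Y.obj).X} (hf : f ∈ (B.matComplex X.obj Y.obj).deg m)
    (i : Fin Y.n) (j : Fin X.n) :
    D X Y f i j = (B.Hom (X.obj j) (Y.obj i)).d (f i j) + ∑ c, B.comp (Y.q i c) (f c j) -
      m.negOnePow • ∑ c, B.comp (f i c) (X.q c j) := by
  rw [D_apply, sgn_of_mem hf]
  change (B.Hom (X.obj j) (Y.obj i)).d (f i j) + ∑ c, B.comp (Y.q i c) (f c j) -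
    ∑ c, B.comp (m.negOnePow • f i c) (X.q c j) = _
  simp only [units_smul_comp, ← Finset.smul_sum]

section relabel

variable {n : ℕ} {o : Fin n → A.Obj} {r r' : Fin n → ℝ} {d d' : Fin n → ℤ}
  {q q' : ∀ i j : Fin n, (A.Hom (o j) (o i)).X}

theorem relabel_mem {a : ℝ} {m : ℤ} (hr : ∀ i, r' i = r i + a) (hd : ∀ i, d' i = d i + m) :
    matOne o ∈ (A.Sig.matComplex (fun i => sigMk (o i) (r i) (d i))
      (fun i => sigMk (o i) (r' i) (d' i))).gr m a := by
  refine ⟨mat_mem_deg.2 fun i j => ?_, mat_ℓ_le.2 fun i j => ?_⟩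
  · change matOne o i j ∈ (A.Hom (o j) (o i)).deg (m - (d' i - d j))
    by_cases h : i = j
    · subst h
      rw [matOne_self, hd, add_sub_cancel_left, sub_self]
      exact A.id_deg _
    · rw [matOne_ne h]; exact Submodule.zero_mem _
  · change (A.Hom (o j) (o i)).ℓ (matOne o i j) + ((r' i - r j : ℝ) : WithBot ℝ) ≤ a
    by_cases h : i = j
    · subst h
      rw [matOne_self, hr, add_sub_cancel_left]
      exact (add_le_add (A.id_ℓ _) le_rfl).trans (zero_add _).le
    · rw [matOne_ne h, ℓ_zero]; exact bot_le

/-- The identity matrix is a closed morphism of degree `m` between two twisted complexes whose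
summands differ by the shift `[m]` and whose structure maps differ by the sign `(-1)^m`. -/
theorem relabel_closed {a : ℝ} {m : ℤ} {p₁ p₂ p₃ p₄ p₁' p₂' p₃' p₄'}
    (hr : ∀ i, r' i = r i + a) (hd : ∀ i, d' i = d i + m)
    (hq : ∀ i j, q' i j = m.negOnePow • q i j) :
    D (B := A.Sig) ⟨n, fun i => sigMk (o i) (r i) (d i), q, p₁, p₂, p₃, p₄⟩
      ⟨n, fun i => sigMk (o i) (r' i) (d' i), q', p₁', p₂', p₃', p₄'⟩
      (matOne o) = 0 := by
  funext i j
  refine (D_apply_of_mem (relabel_mem hr hd).1 i j).trans ?_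
  have h1 : (A.Hom (o j) (o i)).d (matOne o i j) = 0 :=
    congrFun (congrFun (matOne_closed (B := A) (X := o)) i) j
  have h2 : ∑ c, A.comp (q' i c) (matOne o c j) = q' i j :=
    congrFun (congrFun (matComp_one (B := A) (X := o) (Y := o) q') i) j
  have h3 : ∑ c, A.comp (matOne o i c) (q c j) = q i j :=
    congrFun (congrFun (matOne_comp (B := A) (X := o) (Y := o) q) i) j
  change (((d' i).negOnePow : ℤ) : k) • (A.Hom (o j) (o i)).d (matOne o i j) +
    ∑ c, A.comp (q' i c) (matOne o c j) -
      m.negOnePow • ∑ c, A.comp (matOne o i c) (q c j) = 0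
  rw [h1, h2, h3, hq, smul_zero, zero_add, sub_self]

/-- Two twisted complexes whose summands differ by `Σ^a` and `[m]`, and whose structure maps
differ by the sign `(-1)^m`, are shifted copies of each other. -/
def relabel (a : ℝ) (m : ℤ) {p₁ p₂ p₃ p₄ p₁' p₂' p₃' p₄'}
    (hr : ∀ i, r' i = r i + a) (hd : ∀ i, d' i = d i + m)
    (hq : ∀ i j, q' i j = m.negOnePow • q i j) :
    Twist A.Tw
      (TwObj.mk (B := A.Sig) n (fun i => sigMk (o i) (r i) (d i)) q p₁ p₂ p₃ p₄)
      (TwObj.mk (B := A.Sig) n (fun i => sigMk (o i) (r' i) (d' i)) q'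
        p₁' p₂' p₃' p₄') a m :=
  have hr' : ∀ i, r i = r' i + -a := fun i => by rw [hr]; ring
  have hd' : ∀ i, d i = d' i + -m := fun i => by rw [hd]; ring
  have hq' : ∀ i j, q i j = (-m).negOnePow • q' i j := fun i j => by
    rw [hq, Int.negOnePow_neg, smul_smul, Int.units_mul_self, one_smul]
  { hom := matOne o
    inv := matOne o
    hom_mem := relabel_mem hr hd
    inv_mem := relabel_mem hr' hd'
    d_hom := relabel_closed hr hd hq
    d_inv := relabel_closed hr' hd' hq'
    hom_inv := matOne_comp (B := A) (matOne o)
    inv_hom := matOne_comp (B := A) (matOne o) }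

theorem twist_q_deg {X Y : A.Sig.Obj} (n p : ℤ) {f : (A.Sig.Hom X Y).X}
    (hf : f ∈ (A.Sig.Hom X Y).deg p) : f ∈ (A.Sig.Hom
      (sigMk (SigObj.obj X) (SigObj.r X) (SigObj.d X - n))
      (sigMk (SigObj.obj Y) (SigObj.r Y) (SigObj.d Y - n))).deg p := by
  obtain ⟨X, a, c⟩ := X
  obtain ⟨Y, b, d⟩ := Y
  change f ∈ (A.Hom X Y).deg (p - (d - n - (c - n)))
  change f ∈ (A.Hom X Y).deg (p - (d - c)) at hf
  rwa [sub_sub_sub_cancel_right]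

/-- On objects shifted by `[-n]` the differential has the sign `(-1)^n`, which the sign of the
structure map of `X[-n]` compensates. -/
theorem twist_d {X Y : A.Sig.Obj} (n : ℤ) (f : (A.Sig.Hom X Y).X) :
    (A.Sig.Hom (sigMk (SigObj.obj X) (SigObj.r X) (SigObj.d X - n))
      (sigMk (SigObj.obj Y) (SigObj.r Y) (SigObj.d Y - n))).d (n.negOnePow • f) =
      (A.Sig.Hom X Y).d f := by
  obtain ⟨X, a, c⟩ := X
  obtain ⟨Y, b, d⟩ := Y
  revert f
  intro (f : (A.Hom X Y).X)
  change (((d - n).negOnePow : ℤ) : k) • (A.Hom X Y).d (n.negOnePow • f) =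
    ((d.negOnePow : ℤ) : k) • (A.Hom X Y).d f
  rw [negOnePow_smul' (k := k), map_smul, smul_smul, sign_sub, mul_assoc, sign_mul_self,
    mul_one]

/-- The twisted complex `X[-n]`. -/
def translate (n : ℤ) (X : TwObj A.Sig) : TwObj A.Sig where
  n := X.n
  obj i := sigMk (SigObj.obj (X.obj i)) (SigObj.r (X.obj i)) (SigObj.d (X.obj i) - n)
  q i j := (n.negOnePow • X.q i j : (A.Sig.Hom (X.obj j) (X.obj i)).X)
  q_deg i j := twist_q_deg n 1 (units_smul_mem _ _ (X.q_deg i j))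
  q_onesided i j h := by
    refine (congrArg (fun x : (A.Sig.Hom (X.obj j) (X.obj i)).X => n.negOnePow • x)
      (X.q_onesided i j h)).trans (smul_zero _)
  q_mc i j := by
    refine Eq.trans ?_ (X.q_mc i j)
    refine congrArg₂ (fun x y : (A.Sig.Hom (X.obj j) (X.obj i)).X => x + y) ?_ ?_
    · exact twist_d n (X.q i j)
    · refine Finset.sum_congr rfl fun c _ => ?_
      change A.Sig.comp (n.negOnePow • X.q i c) (n.negOnePow • X.q c j) =
        A.Sig.comp (X.q i c) (X.q c j)
      rw [units_smul_comp, comp_units_smul, smul_smul, Int.units_mul_self, one_smul]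
  q_ℓ i j := (ℓ_negOnePow (C := A.Sig.Hom (X.obj j) (X.obj i)) _ _).trans (X.q_ℓ i j)

/-- The twisted complex `X[-n]`.  For `n = 1` it is `TwObj.susp` by definition and not only up to the
equality `(-1)^1 • q = -q`. -/
def power : ℤ → TwObj A.Sig → TwObj A.Sig
  | 1, X => X.susp
  | n, X => X.translate n

/-- The translate `X[-n]` as a shifted copy of `X`. -/
def powerTwist (n : ℤ) (X : TwObj A.Sig) : Twist A.Tw X (power n X) 0 (-n) := by
  unfold power
  split
  · exact relabel 0 (-1) (fun _ => (add_zero _).symm) (fun _ => rfl) (fun i j => by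
      change -(show (A.Sig.Hom (X.obj j) (X.obj i)).X from X.q i j) = _
      rw [Int.negOnePow_neg, Int.negOnePow_one]
      exact ((Units.neg_smul _ _).trans (congrArg _ (one_smul ℤˣ _))).symm)
  · exact relabel 0 (-n) (fun _ => (add_zero _).symm) (fun _ => rfl) (fun i j => by
      rw [Int.negOnePow_neg]; rfl)

end relabel

end TwObj

/-- The identity matrices present the shifts of twisted complexes as shifted copies. -/
instance : Shifts A.Tw where
  sig r X := TwObj.sigma r X
  tr n X := TwObj.power n X
  su r _ := TwObj.relabel r 0 (fun _ => rfl) (fun _ => (add_zero _).symm)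
    (fun _ _ => (one_smul ℤˣ _).symm)
  tu := TwObj.powerTwist

end FilteredDGCat

/-! ### Cones of twisted complexes -/

namespace FilteredDGCat

open FilteredComplex

variable {k : Type w} [Field k] {A : FilteredDGCat.{w, u, v} k}

namespace TwObj

theorem matOne_comp_apply {B : FilteredDGCat.{w, u, v} k} {m n : ℕ} {X : Fin m → B.Obj}
    {Y : Fin n → B.Obj} (f : ∀ i j, (B.Hom (X j) (Y i)).X) (i : Fin n) (j : Fin m) :
    ∑ c, B.comp (matOne Y i c) (f c j) = f i j := congrFun (congrFun (matOne_comp f) i) j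

theorem comp_matOne_apply {B : FilteredDGCat.{w, u, v} k} {m n : ℕ} {X : Fin m → B.Obj}
    {Y : Fin n → B.Obj} (f : ∀ i j, (B.Hom (X j) (Y i)).X) (i : Fin n) (j : Fin m) :
    ∑ c, B.comp (f i c) (matOne X c j) = f i j := congrFun (congrFun (matComp_one f) i) j

theorem sum_comp_zero {B : FilteredDGCat.{w, u, v} k} {n : ℕ} {X Z : B.Obj} {Y : Fin n → B.Obj}
    (g : ∀ c, (B.Hom (Y c) Z).X) :
    ∑ c, B.comp (g c) (0 : (B.Hom X (Y c)).X) = 0 :=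
  Finset.sum_eq_zero fun _ _ => map_zero _

theorem sum_zero_comp {B : FilteredDGCat.{w, u, v} k} {n : ℕ} {X Z : B.Obj} {Y : Fin n → B.Obj}
    (f : ∀ c, (B.Hom X (Y c)).X) :
    ∑ c, B.comp (0 : (B.Hom (Y c) Z).X) (f c) = 0 :=
  Finset.sum_eq_zero fun _ _ => LinearMap.map_zero₂ _ _

theorem matOne_closed_apply {B : FilteredDGCat.{w, u, v} k} {n : ℕ} {X : Fin n → B.Obj}
    (i j : Fin n) : (B.Hom (X j) (X i)).d (matOne X i j) = 0 :=
  congrFun (congrFun matOne_closed i) j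

theorem add_eq_of_eq_zero_left {M : Type*} [AddCommGroup M] {a b c : M} (ha : a = 0)
    (hb : b = c) : a + b = c := by rw [ha, hb, zero_add]

theorem add_eq_of_eq_zero_right {M : Type*} [AddCommGroup M] {a b c : M} (ha : a = c)
    (hb : b = 0) : a + b = c := by rw [ha, hb, add_zero]

theorem sigSusp_d_zero {X Y : A.Sig.Obj} {f : (A.Sig.Hom X Y).X} (h : (A.Sig.Hom X Y).d f = 0) :
    (A.Sig.Hom X (sigSusp Y)).d f = 0 := by
  obtain ⟨X, a, c⟩ := X
  obtain ⟨Y, b, d⟩ := Y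
  revert f
  intro (f : (A.Hom X Y).X) h
  change ((d.negOnePow : ℤ) : k) • (A.Hom X Y).d f = 0 at h
  change (((d - 1).negOnePow : ℤ) : k) • (A.Hom X Y).d f = 0
  rw [sign_sub, mul_comm, mul_smul, h, smul_zero]

theorem susp_target_deg {X Y : A.Sig.Obj} {f : (A.Sig.Hom X Y).X}
    (h : f ∈ (A.Sig.Hom X Y).deg 0) : f ∈ (A.Sig.Hom X (sigSusp Y)).deg (-1) := by
  obtain ⟨X, a, c⟩ := X
  obtain ⟨Y, b, d⟩ := Y
  change f ∈ (A.Hom X Y).deg (-1 - (d - 1 - c))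
  change f ∈ (A.Hom X Y).deg (0 - (d - c)) at h
  rwa [show -1 - (d - 1 - c) = 0 - (d - c) by ring]

variable {X Y : TwObj A.Sig}

variable (X Y) in
/-- The rows of the inclusion `X ⟶ Y ⊕ X[-1]`, of degree `-1`. -/
def coneInlRow : ∀ (a : Fin Y.n ⊕ Fin X.n) (j : Fin X.n),
    (A.Sig.Hom (X.obj j) (coneObj X Y a)).X
  | .inl _, _ => 0
  | .inr i, j => (matOne X.obj i j : (A.Sig.Hom (X.obj j) (X.obj i)).X)

variable (X Y) in
/-- The columns of the projection `Y ⊕ X[-1] ⟶ X`, of degree `1`. -/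
def coneFstCol : ∀ (i : Fin X.n) (b : Fin Y.n ⊕ Fin X.n),
    (A.Sig.Hom (coneObj X Y b) (X.obj i)).X
  | _, .inl _ => 0
  | i, .inr j => (matOne X.obj i j : (A.Sig.Hom (X.obj j) (X.obj i)).X)

variable (X Y) in
/-- The columns of the projection `Y ⊕ X[-1] ⟶ Y`. -/
def coneSndCol : ∀ (i : Fin Y.n) (b : Fin Y.n ⊕ Fin X.n),
    (A.Sig.Hom (coneObj X Y b) (Y.obj i)).X
  | i, .inl j => matOne Y.obj i j
  | _, .inr _ => 0

theorem coneInlRow_mem (a j) :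
    coneInlRow X Y a j ∈ (A.Sig.Hom (X.obj j) (coneObj X Y a)).gr (-1) 0 := by
  rcases a with i | i
  · exact Submodule.zero_mem _
  · exact ⟨susp_target_deg (mat_mem_deg.1 matOne_deg i j),
      mat_ℓ_le.1 (matOne_ℓ (X := X.obj)) i j⟩

theorem coneIncRow_mem (a j) :
    coneIncRow X Y a j ∈ (A.Sig.Hom (Y.obj j) (coneObj X Y a)).gr 0 0 := by
  rcases a with i | i
  · exact ⟨mat_mem_deg.1 matOne_deg i j, mat_ℓ_le.1 matOne_ℓ i j⟩
  · exact Submodule.zero_mem _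

theorem coneFstCol_mem (i b) :
    coneFstCol X Y i b ∈ (A.Sig.Hom (coneObj X Y b) (X.obj i)).gr 1 0 := by
  rcases b with j | j
  · exact Submodule.zero_mem _
  · exact ⟨sigSusp_deg' (mat_mem_deg.1 matOne_deg i j),
      mat_ℓ_le.1 (matOne_ℓ (X := X.obj)) i j⟩

theorem coneSndCol_mem (i b) :
    coneSndCol X Y i b ∈ (A.Sig.Hom (coneObj X Y b) (Y.obj i)).gr 0 0 := by
  rcases b with j | j
  · exact ⟨mat_mem_deg.1 matOne_deg i j, mat_ℓ_le.1 matOne_ℓ i j⟩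
  · exact Submodule.zero_mem _

theorem cone_fst_inl (i j : Fin X.n) :
    ∑ c, A.Sig.comp (coneFstCol X Y i c) (coneInlRow X Y c j) = matOne X.obj i j :=
  (Fintype.sum_sum_type _).trans (add_eq_of_eq_zero_left (sum_comp_zero _)
    (matOne_comp_apply (matOne X.obj) i j))

theorem cone_snd_inr (i j : Fin Y.n) :
    ∑ c, A.Sig.comp (coneSndCol X Y i c) (coneIncRow X Y c j) = matOne Y.obj i j :=
  (Fintype.sum_sum_type _).trans (add_eq_of_eq_zero_right
    (matOne_comp_apply (matOne Y.obj) i j) (sum_comp_zero _))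

theorem cone_fst_inr (i : Fin X.n) (j : Fin Y.n) :
    ∑ c, A.Sig.comp (coneFstCol X Y i c) (coneIncRow X Y c j) = 0 :=
  (Fintype.sum_sum_type _).trans (add_eq_of_eq_zero_left (sum_zero_comp _) (sum_comp_zero _))

theorem cone_snd_inl (i : Fin Y.n) (j : Fin X.n) :
    ∑ c, A.Sig.comp (coneSndCol X Y i c) (coneInlRow X Y c j) = 0 :=
  (Fintype.sum_sum_type _).trans (add_eq_of_eq_zero_left (sum_comp_zero _) (sum_zero_comp _))

variable (X Y) in
/-- The identity matrix of `Y ⊕ X[-1]`, indexed by a sum type. -/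
def coneOne (a b : Fin Y.n ⊕ Fin X.n) : (A.Sig.Hom (coneObj X Y b) (coneObj X Y a)).X :=
  if h : a = b then h ▸ A.Sig.id (coneObj X Y a) else 0

theorem coneOne_self (a : Fin Y.n ⊕ Fin X.n) : coneOne X Y a a = A.Sig.id (coneObj X Y a) := by
  simp [coneOne]

theorem coneOne_ne {a b : Fin Y.n ⊕ Fin X.n} (h : a ≠ b) : coneOne X Y a b = 0 := by
  simp [coneOne, h]

theorem cone_total (a b : Fin Y.n ⊕ Fin X.n) :
    ∑ c, A.Sig.comp (coneInlRow X Y a c) (coneFstCol X Y c b) +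
      ∑ c, A.Sig.comp (coneIncRow X Y a c) (coneSndCol X Y c b) = coneOne X Y a b := by
  rcases a with i | i <;> rcases b with j | j
  · refine add_eq_of_eq_zero_left (sum_comp_zero _)
      ((matOne_comp_apply (matOne Y.obj) i j).trans ?_)
    by_cases h : i = j
    · subst h
      exact (matOne_self (X := Y.obj) i).trans (coneOne_self (X := X) (Y := Y) (.inl i)).symm
    · exact (matOne_ne h).trans (coneOne_ne (fun h' => h (Sum.inl_injective h'))).symm
  · exact (add_eq_of_eq_zero_left (sum_zero_comp _) (sum_comp_zero _)).trans
      (coneOne_ne Sum.inl_ne_inr).symm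
  · exact (add_eq_of_eq_zero_left (sum_comp_zero _) (sum_zero_comp _)).trans
      (coneOne_ne Sum.inr_ne_inl).symm
  · refine add_eq_of_eq_zero_right ((matOne_comp_apply (matOne X.obj) i j).trans ?_)
      (sum_comp_zero _)
    by_cases h : i = j
    · subst h
      exact (matOne_self (X := X.obj) i).trans (coneOne_self (X := X) (Y := Y) (.inr i)).symm
    · exact (matOne_ne h).trans (coneOne_ne (fun h' => h (Sum.inr_injective h'))).symm

theorem coneOne_eq (f : (A.Sig.matComplex X.obj Y.obj).X) (hf : f ∈ (homComplex X Y).cocycles 0)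
    (a b : Fin (cone f hf).n) : matOne (cone f hf).obj a b =
      coneOne X Y (finSumFinEquiv.symm a) (finSumFinEquiv.symm b) := by
  by_cases h : a = b
  · subst h
    exact (matOne_self a).trans (coneOne_self _).symm
  · exact (matOne_ne h).trans
      (coneOne_ne fun h' => h (finSumFinEquiv.symm.injective h')).symm

theorem coneIncRow_closed (a j) :
    (A.Sig.Hom (Y.obj j) (coneObj X Y a)).d (coneIncRow X Y a j) = 0 := by
  rcases a with i | i
  · exact matOne_closed_apply i j
  · exact map_zero _

theorem coneInlRow_closed (a j) :
    (A.Sig.Hom (X.obj j) (coneObj X Y a)).d (coneInlRow X Y a j) = 0 := by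
  rcases a with i | i
  · exact map_zero _
  · exact sigSusp_d_zero (matOne_closed_apply i j)

theorem coneQ_coneIncRow (f : (A.Sig.matComplex X.obj Y.obj).X) (a : Fin Y.n ⊕ Fin X.n)
    (j : Fin Y.n) : ∑ c, A.Sig.comp (coneQ f a c) (coneIncRow X Y c j) =
      ∑ c, A.Sig.comp (coneIncRow X Y a c) (Y.q c j) := by
  refine (Fintype.sum_sum_type _).trans (add_eq_of_eq_zero_right ?_ (sum_comp_zero _))
  rcases a with i | i
  · exact (comp_matOne_apply Y.q i j).trans (matOne_comp_apply Y.q i j).symm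
  · exact (sum_zero_comp _).trans (sum_zero_comp _).symm

theorem coneQ_coneInlRow (f : (A.Sig.matComplex X.obj Y.obj).X) (a : Fin Y.n ⊕ Fin X.n)
    (j : Fin X.n) : ∑ c, A.Sig.comp (coneQ f a c) (coneInlRow X Y c j) +
      ∑ c, A.Sig.comp (coneInlRow X Y a c) (X.q c j) =
      ∑ c, A.Sig.comp (coneIncRow X Y a c) (f c j) := by
  rw [Fintype.sum_sum_type]
  rcases a with i | i
  · exact add_eq_of_eq_zero_right (add_eq_of_eq_zero_left (sum_comp_zero _)
      ((comp_matOne_apply f i j).trans (matOne_comp_apply f i j).symm)) (sum_zero_comp _)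
  · have h1 : ∑ c, A.Sig.comp (coneQ f (.inr i) (.inl c)) (coneInlRow X Y (.inl c) j) +
        ∑ c, A.Sig.comp (coneQ f (.inr i) (.inr c)) (coneInlRow X Y (.inr c) j) = -X.q i j :=
      add_eq_of_eq_zero_left (sum_comp_zero _)
        (comp_matOne_apply (X := X.obj) (Y := X.obj) (fun a b => -X.q a b) i j)
    refine (congrArg₂ (fun x y : (A.Sig.Hom (X.obj j) (X.obj i)).X => x + y) h1
      (matOne_comp_apply X.q i j)).trans ?_
    exact (neg_add_cancel (X.q i j)).trans (sum_zero_comp _).symm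

/-- The twisted complex `TwObj.cone f` is a cone of `f`: the inclusions and the projections are
blocks of the identity matrix. -/
def coneData (f : (A.Sig.matComplex X.obj Y.obj).X) (hf : f ∈ (homComplex X Y).cocycles 0) :
    ConeData (B := A.Tw) (X := X) (Y := Y) f (cone f hf) where
  inl := fun a j => coneInlRow X Y (finSumFinEquiv.symm a) j
  inr := coneInc f hf
  fst := fun i b => coneFstCol X Y i (finSumFinEquiv.symm b)
  snd := fun i b => coneSndCol X Y i (finSumFinEquiv.symm b)
  inl_mem := ⟨mat_mem_deg.2 fun _ _ => (coneInlRow_mem _ _).1,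
    mat_ℓ_le.2 fun _ _ => (coneInlRow_mem _ _).2⟩
  inr_mem := ⟨mat_mem_deg.2 fun _ _ => (coneIncRow_mem _ _).1,
    mat_ℓ_le.2 fun _ _ => (coneIncRow_mem _ _).2⟩
  fst_mem := ⟨mat_mem_deg.2 fun _ _ => (coneFstCol_mem _ _).1,
    mat_ℓ_le.2 fun _ _ => (coneFstCol_mem _ _).2⟩
  snd_mem := ⟨mat_mem_deg.2 fun _ _ => (coneSndCol_mem _ _).1,
    mat_ℓ_le.2 fun _ _ => (coneSndCol_mem _ _).2⟩
  fst_inl := by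
    funext i j
    exact (Equiv.sum_comp finSumFinEquiv.symm fun c =>
      A.Sig.comp (coneFstCol X Y i c) (coneInlRow X Y c j)).trans (cone_fst_inl i j)
  snd_inr := by
    funext i j
    exact (Equiv.sum_comp finSumFinEquiv.symm fun c =>
      A.Sig.comp (coneSndCol X Y i c) (coneIncRow X Y c j)).trans (cone_snd_inr i j)
  fst_inr := by
    funext i j
    exact (Equiv.sum_comp finSumFinEquiv.symm fun c =>
      A.Sig.comp (coneFstCol X Y i c) (coneIncRow X Y c j)).trans (cone_fst_inr i j)
  snd_inl := by
    funext i j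
    exact (Equiv.sum_comp finSumFinEquiv.symm fun c =>
      A.Sig.comp (coneSndCol X Y i c) (coneInlRow X Y c j)).trans (cone_snd_inl i j)
  total := by
    funext a b
    exact (cone_total _ _).trans (coneOne_eq f hf a b).symm
  d_inr := by
    funext a j
    refine (D_apply_of_mem (m := 0) (mat_mem_deg.2 fun _ _ => (coneIncRow_mem _ _).1) a j).trans ?_
    rw [Int.negOnePow_zero, one_smul]
    refine sub_eq_zero.2 (add_eq_of_eq_zero_left (coneIncRow_closed _ _) ?_)
    exact (Equiv.sum_comp finSumFinEquiv.symm fun c =>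
      A.Sig.comp (coneQ f (finSumFinEquiv.symm a) c) (coneIncRow X Y c j)).trans
        (coneQ_coneIncRow f _ j)
  d_inl := by
    funext a j
    refine (D_apply_of_mem (m := -1)
      (mat_mem_deg.2 fun _ _ => (coneInlRow_mem _ _).1) a j).trans ?_
    rw [Int.negOnePow_neg, Int.negOnePow_one, Units.neg_smul, one_smul, sub_neg_eq_add]
    refine Eq.trans ?_ (coneQ_coneInlRow f (finSumFinEquiv.symm a) j)
    refine congrArg (· + _) (add_eq_of_eq_zero_left (coneInlRow_closed _ _) ?_)
    exact (Equiv.sum_comp finSumFinEquiv.symm fun c =>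
      A.Sig.comp (coneQ f (finSumFinEquiv.symm a) c) (coneInlRow X Y c j))

end TwObj

/-- Twisted complexes have cones; the empty list is an object. -/
instance : HasCones A.Tw where
  nonempty := ⟨⟨0, Fin.elim0, fun i => i.elim0, fun i => i.elim0, fun i => i.elim0,
    fun i => i.elim0, fun i => i.elim0⟩⟩
  exists_cone f hf := ⟨TwObj.cone f hf, ⟨TwObj.coneData f hf⟩⟩

end FilteredDGCat

/-! ### Strictness of the structure on twisted complexes -/

namespace FilteredDGCat

open FilteredComplex Shifts Pretriangulated

variable {k : Type w} [Field k]

variable {A : FilteredDGCat.{w, u, v} k}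

namespace TwObj

theorem sigma_zero (X : TwObj A.Sig) : X.sigma 0 = X := by
  refine mk_congr (B := A.Sig) (funext fun i => ?_) HEq.rfl
  exact congrArg (fun r => sigMk (SigObj.obj (X.obj i)) r (SigObj.d (X.obj i))) (add_zero _)

theorem sigma_sigma (r s : ℝ) (X : TwObj A.Sig) : (X.sigma s).sigma r = X.sigma (r + s) := by
  refine mk_congr (B := A.Sig) (funext fun i => ?_) HEq.rfl
  exact congrArg (fun r => sigMk (SigObj.obj (X.obj i)) r (SigObj.d (X.obj i)))
    ((add_assoc _ _ _).trans (congrArg _ (add_comm s r)))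

theorem susp_translate (X : TwObj A.Sig) : (X.translate (-1)).susp = X := by
  refine mk_congr (B := A.Sig) (funext fun i => ?_) (heq_of_eq ?_)
  · exact congrArg (fun d => sigMk (SigObj.obj (X.obj i)) (SigObj.r (X.obj i)) d)
      (show SigObj.d (X.obj i) - (-1) - 1 = SigObj.d (X.obj i) by ring)
  · funext i j
    change -((-1 : ℤ).negOnePow • X.q i j) = X.q i j
    rw [Int.negOnePow_neg, Int.negOnePow_one, Units.neg_smul, one_smul, neg_neg]

theorem translate_susp (X : TwObj A.Sig) : X.susp.translate (-1) = X := by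
  refine mk_congr (B := A.Sig) (funext fun i => ?_) (heq_of_eq ?_)
  · exact congrArg (fun d => sigMk (SigObj.obj (X.obj i)) (SigObj.r (X.obj i)) d)
      (show SigObj.d (X.obj i) - 1 - (-1) = SigObj.d (X.obj i) by ring)
  · funext i j
    change (-1 : ℤ).negOnePow • (-X.q i j : (A.Sig.Hom (X.obj j) (X.obj i)).X) = X.q i j
    rw [Int.negOnePow_neg, Int.negOnePow_one, Units.neg_smul, one_smul, neg_neg]

theorem susp_bijective : Function.Bijective (susp : TwObj A.Sig → TwObj A.Sig) :=
  Function.bijective_iff_has_inverse.2 ⟨translate (-1), translate_susp, susp_translate⟩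

end TwObj

theorem tw_strictShifts (A : FilteredDGCat.{w, u, v} k) : StrictShifts A.Tw where
  sig_zero := TwObj.sigma_zero
  su_zero _ := HEq.rfl
  sig_sig := TwObj.sigma_sigma
  su_su _ _ X := heq_of_eq (matOne_comp (B := A) (matOne fun i => SigObj.obj (TwObj.obj X i)))
  tr_bijective := TwObj.susp_bijective
  sig_tr _ _ := rfl
  su_tu _ _ := HEq.rfl

section

variable {B : FilteredDGCat.{w, u, v} k} [Shifts B]

/-- The class of `η r s`, on copies `X₁`, `X₂` that equal `Σ^r X`, `Σ^s X`. -/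
theorem exists_isClass_η [HasCones B] (r s : ℝ) {X X₁ X₂ : B.Obj} (h₁ : sig r X = X₁)
    (h₂ : sig s X = X₂) {g : (B.Hom X₁ X₂).X} (h : HEq (B.comp (su s X).hom (su r X).inv) g) :
    ∃ φ : B.H0.Mor (s - r) X₁ X₂, IsClass φ g ∧ HEq ((tpc B).shift.η r s X) φ := by
  subst h₁ h₂
  cases h
  exact ⟨(tpc B).shift.η r s X, ⟨_, rfl⟩, HEq.rfl⟩

/-- The class of the translate of `f`, on copies `X₁`, `Y₁` that equal `X[-1]`, `Y[-1]`. -/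
theorem exists_isClass_T_map [HasCones B] {X Y X₁ Y₁ : B.Obj} (hX : tr 1 X = X₁)
    (hY : tr 1 Y = Y₁) {f : (B.Hom X Y).X} (hf : f ∈ (B.Hom X Y).cocycles 0)
    {g : (B.Hom X₁ Y₁).X} (h : HEq (B.comp (tu 1 Y).hom (B.comp f (tu 1 X).inv)) g) :
    ∃ φ : B.H0.Mor 0 X₁ Y₁, IsClass φ g ∧
      HEq ((tpc B).T.map (X := X) (Y := Y) (cls f hf)) φ := by
  subst hX hY
  cases h
  exact ⟨(tpc B).T.map (X := X) (Y := Y) (cls f hf), ⟨Twist.conjLin_cocycles _ _ hf, rfl⟩,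
    HEq.rfl⟩

/-- The exact triangle of a cone of `f`, on a copy `X₁` that equals `X[-1]`. -/
theorem exists_isClass_cone [HasCones B] {X Y C X₁ : B.Obj} (hX : tr 1 X = X₁)
    {f : (B.Hom X Y).X} (hf : f ∈ (B.Hom X Y).cocycles 0) (c : ConeData f C)
    {j : (B.Hom Y C).X} (hj : c.inr = j) {g : (B.Hom C X₁).X}
    (h : HEq (B.comp (tu 1 X).hom c.fst) g) :
    letI := (tpc B).hasZeroObject; letI := (tpc B).hasShift; letI := (tpc B).shift_additive
    letI := (tpc B).pretriangulated
    ∃ (i : B.H0.Mor 0 Y C) (p : B.H0.Mor 0 C ((tpc B).T.obj X)) (p' : B.H0.Mor 0 C X₁),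
      IsClass i j ∧ IsClass p' g ∧ HEq p p' ∧
      Triangle.mk (C := B.H0.Zero) (X := X) (Y := Y) (Z := C) (cls f hf) i p ∈
        distTriang B.H0.Zero := by
  subst hX hj
  cases h
  exact ⟨cls c.inr c.inr_cocycle, cls _ (proj_cocycle c), cls _ (proj_cocycle c), ⟨_, rfl⟩,
    ⟨_, rfl⟩, HEq.rfl, std_exact hf c⟩

end

variable {A : FilteredDGCat.{w, u, v} k}

theorem tw_T_map (X Y : TwObj A.Sig) (f : (A.Tw.Hom X Y).X) :
    A.Tw.comp (tu (B := A.Tw) 1 Y).hom (A.Tw.comp f (tu (B := A.Tw) 1 X).inv) = f :=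
  (matOne_comp _).trans (matComp_one (B := A.Sig) f)

theorem tw_proj (X Y : TwObj A.Sig) (f : (A.Tw.Hom X Y).X)
    (hf : f ∈ (A.Tw.Hom X Y).cocycles 0) :
    A.Tw.comp (tu (B := A.Tw) 1 X).hom (TwObj.coneData f hf).fst = TwObj.coneProj f hf := by
  refine (matOne_comp _).trans ?_
  funext i b
  change TwObj.coneFstCol X Y i (finSumFinEquiv.symm b) =
    TwObj.coneProjCol X Y i (finSumFinEquiv.symm b)
  rcases finSumFinEquiv.symm b with j | j
  · rfl
  · rfl

theorem tw_eta (r s : ℝ) (X : TwObj A.Sig) :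
    A.Tw.comp (su (B := A.Tw) s X).hom (su (B := A.Tw) r X).inv = matOne X.obj :=
  matOne_comp (B := A) (matOne fun i => SigObj.obj (X.obj i))

theorem tw_isStandard (A : FilteredDGCat.{w, u, v} k) : IsStandard (tpc A.Tw) := by
  refine ⟨fun r X => rfl, fun r s X => ?_, fun X => rfl, fun X Y f hf => ?_, fun X Y f hf => ?_⟩
  · have h := exists_isClass_η (B := A.Tw) r s (X := X) (X₁ := X.sigma r) (X₂ := X.sigma s) rfl
      rfl (heq_of_eq (tw_eta r s X))
    exact h
  · have h := exists_isClass_T_map (B := A.Tw) (X := X) (Y := Y) (X₁ := X.susp) (Y₁ := Y.susp)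
      rfl rfl hf (heq_of_eq (tw_T_map X Y f))
    exact h
  · have h := exists_isClass_cone (B := A.Tw) (X := X) (X₁ := X.susp) rfl hf
      (TwObj.coneData f hf) rfl (heq_of_eq (tw_proj X Y f hf))
    exact h

end FilteredDGCat

/-! ### Filtered pre-triangulated dg-categories -/

namespace FilteredDGCat

open FilteredComplex

variable {k : Type w} [Field k] {A : FilteredDGCat.{w, u, v} k}

/-- The morphism of `A` given by a morphism between one-term twisted complexes. -/
def entry {X Y : A.Obj} (g : (A.Tw.Hom (A.incl.obj X) (A.incl.obj Y)).X) : (A.Hom X Y).X :=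
  g (0 : Fin 1) (0 : Fin 1)

theorem incl_map_entry {X Y : A.Obj} (g : (A.Tw.Hom (A.incl.obj X) (A.incl.obj Y)).X) :
    A.incl.map (entry g) = g := by
  funext i j
  obtain rfl : i = (0 : Fin 1) := Subsingleton.elim (α := Fin 1) _ _
  obtain rfl : j = (0 : Fin 1) := Subsingleton.elim (α := Fin 1) _ _
  rfl

theorem entry_incl_map {X Y : A.Obj} (f : (A.Hom X Y).X) : entry (A.incl.map f) = f := rfl

theorem entry_zero {X Y : A.Obj} :
    entry (0 : (A.Tw.Hom (A.incl.obj X) (A.incl.obj Y)).X) = 0 := rfl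

theorem entry_add {X Y : A.Obj} (f g : (A.Tw.Hom (A.incl.obj X) (A.incl.obj Y)).X) :
    entry (f + g) = entry f + entry g := rfl

theorem entry_id {X : A.Obj} : entry (A.Tw.id (A.incl.obj X)) = A.id X := by
  rw [← A.incl.map_id, entry_incl_map]

theorem entry_comp {X Y Z : A.Obj} (g : (A.Tw.Hom (A.incl.obj Y) (A.incl.obj Z)).X)
    (f : (A.Tw.Hom (A.incl.obj X) (A.incl.obj Y)).X) :
    entry (A.Tw.comp g f) = A.comp (entry g) (entry f) := by
  rw [← entry_incl_map (A.comp (entry g) (entry f)), A.incl.map_comp, incl_map_entry,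
    incl_map_entry]

theorem entry_d {X Y : A.Obj} (g : (A.Tw.Hom (A.incl.obj X) (A.incl.obj Y)).X) :
    (A.Hom X Y).d (entry g) = entry ((A.Tw.Hom (A.incl.obj X) (A.incl.obj Y)).d g) := by
  rw [← entry_incl_map ((A.Hom X Y).d (entry g)), A.incl.map_d, incl_map_entry]

theorem entry_mem {X Y : A.Obj} {g : (A.Tw.Hom (A.incl.obj X) (A.incl.obj Y)).X} {n : ℤ} {r : ℝ}
    (hg : g ∈ (A.Tw.Hom (A.incl.obj X) (A.incl.obj Y)).gr n r) :
    entry g ∈ (A.Hom X Y).gr n r := by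
  obtain ⟨h1, h2⟩ := hg
  constructor
  · have h : entry g ∈ (A.Hom X Y).deg (n - (0 - 0)) := mat_mem_deg.1 h1 (0 : Fin 1) (0 : Fin 1)
    rwa [sub_self, sub_zero] at h
  · exact (A.incl_ℓ (entry g)).symm.trans_le (mat_ℓ_le.1 h2 (0 : Fin 1) (0 : Fin 1))

theorem incl_map_cocycles {X Y : A.Obj} {f : (A.Hom X Y).X} {r : ℝ}
    (hf : f ∈ (A.Hom X Y).cocycles r) :
    A.incl.map f ∈ (A.Tw.Hom (A.incl.obj X) (A.incl.obj Y)).cocycles r := by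
  obtain ⟨⟨h1, h2⟩, h3⟩ := mem_cocycles_iff.1 hf
  exact mem_cocycles_iff.2 ⟨⟨A.incl.map_deg h1, (A.incl.map_ℓ f).trans h2⟩, by
    rw [← A.incl.map_d, h3, map_zero]⟩

theorem incl_map_ℓ {X Y : A.Obj} (f : (A.Hom X Y).X) :
    (A.Tw.Hom (A.incl.obj X) (A.incl.obj Y)).ℓ (A.incl.map f) = (A.Hom X Y).ℓ f := by
  refine le_antisymm (A.incl.map_ℓ f) ((A.incl_ℓ f).symm.trans_le ?_)
  exact entry_ℓ_le (X := (A.inclObj X).obj) (Y := (A.inclObj Y).obj) (A.incl.map f)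
    (0 : Fin 1) (0 : Fin 1)

namespace Twist

/-- Shifted copies of one-term twisted complexes come from `A`. -/
def entry {X Y : A.Obj} {r : ℝ} {n : ℤ} (u : Twist A.Tw (A.incl.obj X) (A.incl.obj Y) r n) :
    Twist A X Y r n where
  hom := FilteredDGCat.entry u.hom
  inv := FilteredDGCat.entry u.inv
  hom_mem := entry_mem u.hom_mem
  inv_mem := entry_mem u.inv_mem
  d_hom := by rw [entry_d, u.d_hom, entry_zero]
  d_inv := by rw [entry_d, u.d_inv, entry_zero]
  hom_inv := by rw [← entry_comp, u.hom_inv, entry_id]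
  inv_hom := by rw [← entry_comp, u.inv_hom, entry_id]

theorem exists_of_isomorphic {B : FilteredDGCat.{w, u, v} k} {X Y : B.Obj}
    (h : B.Isomorphic X Y) : Nonempty (Twist B X Y 0 0) := by
  obtain ⟨f, hf, g, hg, h1, h2⟩ := h
  rw [mem_cocycles_iff] at hf hg
  exact ⟨⟨f, g, hf.1, by simpa using hg.1, hf.2, hg.2, h1, h2⟩⟩

end Twist

/-- Cones of one-term twisted complexes come from `A`. -/
def ConeData.entry {X Y C : A.Obj} {f : (A.Hom X Y).X}
    (c : ConeData (B := A.Tw) (A.incl.map f) (A.incl.obj C)) : ConeData f C where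
  inl := FilteredDGCat.entry c.inl
  inr := FilteredDGCat.entry c.inr
  fst := FilteredDGCat.entry c.fst
  snd := FilteredDGCat.entry c.snd
  inl_mem := entry_mem c.inl_mem
  inr_mem := entry_mem c.inr_mem
  fst_mem := entry_mem c.fst_mem
  snd_mem := entry_mem c.snd_mem
  fst_inl := by rw [← entry_comp, c.fst_inl, entry_id]
  snd_inr := by rw [← entry_comp, c.snd_inr, entry_id]
  fst_inr := by rw [← entry_comp, c.fst_inr, entry_zero]
  snd_inl := by rw [← entry_comp, c.snd_inl, entry_zero]
  total := by rw [← entry_comp, ← entry_comp, ← entry_add, c.total, entry_id]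
  d_inr := by rw [entry_d, c.d_inr, entry_zero]
  d_inl := by rw [entry_d, c.d_inl, entry_comp, entry_incl_map]

namespace IsPretriangulated

/-- Shifted copies in `Tw(A)` can be replaced by objects of `A`. -/
theorem exists_twist (hA : A.IsPretriangulated) {r : ℝ} {n : ℤ} {X : A.Obj} {Z : A.Tw.Obj}
    (u : Twist A.Tw (A.incl.obj X) Z r n) : ∃ Y : A.Obj, Nonempty (Twist A X Y r n) := by
  obtain ⟨Y, hY⟩ := hA.2 Z
  obtain ⟨t⟩ := Twist.exists_of_isomorphic hY
  have u' := u.trans t.symm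
  rw [neg_zero, neg_zero, add_zero, add_zero] at u'
  exact ⟨Y, ⟨u'.entry⟩⟩

/-- A filtered pre-triangulated dg-category has shifts, as `Tw(A)` does. -/
@[reducible]
def shifts (hA : A.IsPretriangulated) : Shifts A where
  sig r X := (hA.exists_twist (Shifts.su (B := A.Tw) r (A.incl.obj X))).choose
  tr n X := (hA.exists_twist (Shifts.tu (B := A.Tw) n (A.incl.obj X))).choose
  su r X := (hA.exists_twist (Shifts.su (B := A.Tw) r (A.incl.obj X))).choose_spec.some
  tu n X := (hA.exists_twist (Shifts.tu (B := A.Tw) n (A.incl.obj X))).choose_spec.some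

theorem hasCones (hA : A.IsPretriangulated) : HasCones A where
  nonempty := by
    obtain ⟨Z⟩ := HasCones.nonempty (B := A.Tw)
    exact ⟨(hA.2 Z).choose⟩
  exists_cone {X Y} f hf := by
    obtain ⟨C', ⟨c⟩⟩ := HasCones.exists_cone (B := A.Tw) _ (incl_map_cocycles hf)
    obtain ⟨C, hC⟩ := hA.2 C'
    obtain ⟨t⟩ := Twist.exists_of_isomorphic hC
    have t' := t.symm
    rw [neg_zero, neg_zero] at t'
    have c' := c.conj (Twist.refl _) (Twist.refl _) t'
    have h : (0 : ℤ).negOnePow • Twist.conjLin (Twist.refl (A.incl.obj X))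
        (Twist.refl (A.incl.obj Y)) (A.incl.map f) = A.incl.map f := by
      rw [Int.negOnePow_zero, one_smul]
      exact (A.Tw.id_comp _).trans (A.Tw.comp_id _)
    rw [h] at c'
    exact ⟨C, ⟨c'.entry⟩⟩

theorem nonempty_tpc (hA : A.IsPretriangulated) : Nonempty (TPC A.H0) :=
  letI := hA.shifts
  haveI := hA.hasCones
  ⟨tpc A⟩

end IsPretriangulated

end FilteredDGCat

/-! ### Total complexes -/

namespace FilteredComplex

variable {k : Type w} [Field k]

/-- The finite direct sum of filtered complexes. -/
def pi {n : ℕ} (C : Fin n → FilteredComplex.{w, v} k) : FilteredComplex.{w, v} k where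
  X := ∀ i, (C i).X
  deg p := Submodule.pi Set.univ fun i => (C i).deg p
  internal := by
    rw [DirectSum.isInternal_submodule_iff_iSupIndep_and_iSup_eq_top]
    constructor
    · intro p
      rw [Submodule.disjoint_def]
      intro x hx hx'
      funext i
      have h2 : x i ∈ ⨆ q, ⨆ (_ : q ≠ p), (C i).deg q := by
        have := Submodule.mem_map_of_mem (f := LinearMap.proj (R := k) (φ := fun i => (C i).X) i) hx'
        simp only [Submodule.map_iSup] at this
        refine (iSup₂_mono fun q _ => ?_ :
          (⨆ q, ⨆ (_ : q ≠ p), Submodule.map (LinearMap.proj (R := k) (φ := fun i => (C i).X) i)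
            (Submodule.pi Set.univ fun i => (C i).deg q)) ≤
            ⨆ q, ⨆ (_ : q ≠ p), (C i).deg q) this
        rintro _ ⟨y, hy, rfl⟩
        exact hy i trivial
      exact Submodule.disjoint_def.1 ((C i).internal.submodule_iSupIndep p) _ (hx i trivial) h2
    · rw [eq_top_iff]
      rintro x -
      rw [← LinearMap.sum_single_apply (fun i => (C i).X) x]
      refine Submodule.sum_mem _ fun i _ => ?_
      induction x i using hom_induction with
      | h0 => simp
      | hadd x y hx hy =>
        rw [Pi.single_add]
        exact Submodule.add_mem _ hx hy
      | hdeg p x hx =>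
        refine Submodule.mem_iSup_of_mem p fun a _ => ?_
        by_cases ha : a = i
        · subst ha; simpa using hx
        · simp [ha]
  d := LinearMap.pi fun i => (C i).d ∘ₗ LinearMap.proj i
  d_deg hx i _ := (C i).d_deg (hx i trivial)
  d_d x := funext fun i => (C i).d_d _
  ℓ x := Finset.univ.sup fun i => (C i).ℓ (x i)
  ℓ_smul_add c x y hc := by
    refine Finset.sup_le fun i _ => ((C i).ℓ_smul_add c _ _ hc).trans (max_le_max ?_ ?_)
    · exact Finset.le_sup (f := fun i => (C i).ℓ (x i)) (Finset.mem_univ i)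
    · exact Finset.le_sup (f := fun i => (C i).ℓ (y i)) (Finset.mem_univ i)
  ℓ_eq_bot x := by
    simp only [Finset.sup_eq_bot_iff, Finset.mem_univ, true_imp_iff, ℓ_eq_bot]
    exact ⟨fun h => funext h, fun h i => congrFun h i⟩
  ℓ_d x := Finset.sup_mono_fun fun i _ => (C i).ℓ_d _
  ℓ_component c hc p := by
    refine Finset.sup_mono_fun fun i _ => ?_
    have := (C i).ℓ_component (c.mapRange (LinearMap.proj (R := k) (φ := fun i => (C i).X) i)
      (map_zero _)) (fun q => hc q i trivial) p
    rw [Finsupp.sum_mapRange_index (by simp)] at this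
    convert this using 2
    · simp
    exact map_sum (LinearMap.proj (R := k) (φ := fun i => (C i).X) i) _ _

theorem pi_ℓ_le {n : ℕ} {C : Fin n → FilteredComplex.{w, v} k} {x : (pi C).X} {b : WithBot ℝ} :
    (pi C).ℓ x ≤ b ↔ ∀ i, (C i).ℓ (x i) ≤ b := by
  change (Finset.univ.sup fun i => (C i).ℓ (x i)) ≤ b ↔ _
  simp

theorem le_pi_ℓ {n : ℕ} {C : Fin n → FilteredComplex.{w, v} k} (x : (pi C).X) (i : Fin n) :
    (C i).ℓ (x i) ≤ (pi C).ℓ x := pi_ℓ_le.1 le_rfl i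

/-- The endomorphism of a direct sum with the matrix `q`. -/
def piMat {n : ℕ} {C : Fin n → FilteredComplex.{w, v} k}
    (q : ∀ i j : Fin n, (C j).X →ₗ[k] (C i).X) : (pi C).X →ₗ[k] (pi C).X :=
  LinearMap.pi fun i => ∑ j, q i j ∘ₗ LinearMap.proj (R := k) (φ := fun i => (C i).X) j

theorem piMat_apply {n : ℕ} {C : Fin n → FilteredComplex.{w, v} k}
    (q : ∀ i j : Fin n, (C j).X →ₗ[k] (C i).X) (x : (pi C).X) (i : Fin n) :
    piMat q x i = ∑ j, q i j (x j) :=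
  LinearMap.sum_apply _ _ _

/-- The direct sum of the complexes `C i` with the differential perturbed by a Maurer-Cartan
matrix `q`. -/
def total {n : ℕ} (C : Fin n → FilteredComplex.{w, v} k)
    (q : ∀ i j : Fin n, (C j).X →ₗ[k] (C i).X)
    (q_deg : ∀ i j p x, x ∈ (C j).deg p → q i j x ∈ (C i).deg (p + 1))
    (q_mc : ∀ i j x, (C i).d (q i j x) + q i j ((C j).d x) + ∑ c, q i c (q c j x) = 0)
    (q_ℓ : ∀ i j x, (C i).ℓ (q i j x) ≤ (C j).ℓ x) : FilteredComplex.{w, v} k where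
  __ := pi C
  d := (pi C).d + piMat q
  d_deg {p x} hx := Submodule.add_mem _ ((pi C).d_deg hx) fun i _ => by
    rw [SetLike.mem_coe, piMat_apply]
    exact Submodule.sum_mem _ fun j _ => q_deg i j p _ (hx j trivial)
  d_d x := by
    funext i
    have h : ∀ (y : (pi C).X) (i : Fin n), ((pi C).d + piMat q) y i =
        (C i).d (y i) + ∑ j, q i j (y j) := fun y i => congrArg (_ + ·) (piMat_apply q y i)
    rw [h]
    simp only [h, map_add, map_sum, (C i).d_d, zero_add, Finset.sum_add_distrib]
    rw [Finset.sum_comm, ← add_assoc, ← Finset.sum_add_distrib, ← Finset.sum_add_distrib]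
    exact Finset.sum_eq_zero fun j _ => q_mc i j (x j)
  ℓ_d x := by
    refine (ℓ_add _ _).trans (max_le ((pi C).ℓ_d x) (pi_ℓ_le.2 fun i => ?_))
    rw [piMat_apply]
    exact ℓ_sum _ _ _ fun j _ => (q_ℓ i j _).trans (le_pi_ℓ x j)

end FilteredComplex

/-! ### Filtered complexes are pre-triangulated -/

namespace FilteredDGCat

open FilteredComplex

variable {k : Type w} [Field k]

variable {X Y Z : FilteredComplex.{w, v} k}

/-- The linear map underlying a morphism of filtered complexes. -/
def fkMap : ((FK.{w, v} k).Hom X Y).X →ₗ[k] X.X →ₗ[k] Y.X := (homTotal X Y).subtype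

/-- A homogeneous linear map of finite filtration level as a morphism of filtered complexes. -/
def fkHom {m : ℤ} (f : X.X →ₗ[k] Y.X) (hf : f ∈ homDeg X Y m) : ((FK.{w, v} k).Hom X Y).X :=
  (⟨f, Submodule.mem_iSup_of_mem m hf⟩ : homTotal X Y)

theorem fk_ext {f g : ((FK.{w, v} k).Hom X Y).X} (h : fkMap f = fkMap g) : f = g :=
  Subtype.ext h

theorem fk_ℓ_le {f : ((FK.{w, v} k).Hom X Y).X} {r : ℝ} :
    ((FK.{w, v} k).Hom X Y).ℓ f ≤ (r : WithBot ℝ) ↔ Bound (fkMap f) r :=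
  homℓ_le (exists_bound (show homTotal X Y from f).2)

theorem fkMap_d {f : ((FK.{w, v} k).Hom X Y).X} {m : ℤ} (h : fkMap f ∈ homDeg X Y m) :
    fkMap (((FK.{w, v} k).Hom X Y).d f) =
      Y.d ∘ₗ fkMap f - m.negOnePow • (fkMap f ∘ₗ X.d) := homD_of_mem h

/-- Levels of morphisms between shifted summands, in which the filtration function is `ℓ + a`. -/
theorem fk_add_ℓ_le {f : ((FK.{w, v} k).Hom X Y).X} {a b : ℝ} :
    ((FK.{w, v} k).Hom X Y).ℓ f + (a : WithBot ℝ) ≤ (b : WithBot ℝ) ↔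
      Bound (fkMap f) (b - a) := by
  rw [← fk_ℓ_le]
  induction ((FK.{w, v} k).Hom X Y).ℓ f with
  | bot => simp
  | coe c =>
    rw [← WithBot.coe_add, WithBot.coe_le_coe, WithBot.coe_le_coe]
    exact le_sub_iff_add_le.symm

/-- The differential of an entry of the structure map of a twisted complex, read on the
shifted complexes. -/
theorem negOnePow_smul_fkMap_d {f : ((FK.{w, v} k).Hom X Y).X} {c d : ℤ}
    (h : fkMap f ∈ homDeg X Y (1 - (d - c))) :
    ((d.negOnePow : ℤ) : k) • fkMap (((FK.{w, v} k).Hom X Y).d f) =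
      (((d.negOnePow : ℤ) : k) • Y.d) ∘ₗ fkMap f +
        fkMap f ∘ₗ (((c.negOnePow : ℤ) : k) • X.d) := by
  rw [fkMap_d h, negOnePow_smul' (k := k), smul_sub, smul_smul, LinearMap.smul_comp,
    LinearMap.comp_smul, sub_eq_add_neg, ← neg_smul]
  congr 2
  rw [sign_sub, sign_sub]
  simp only [Int.negOnePow_one, Units.val_neg, Units.val_one, Int.cast_neg, Int.cast_one]
  linear_combination (((c.negOnePow : ℤ) : k)) * sign_mul_self (k := k) d

/-- A row of morphisms, as a morphism from a twisted complex to an object of `A`. -/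
def toIncl {A : FilteredDGCat.{w, u, v} k} (Y : TwObj A.Sig) (X : A.Obj)
    (f : ∀ j, (A.Hom (SigObj.obj (Y.obj j)) X).X) : (A.Tw.Hom Y (A.incl.obj X)).X :=
  fun _ j => f j

/-- A column of morphisms, as a morphism from an object of `A` to a twisted complex. -/
def fromIncl {A : FilteredDGCat.{w, u, v} k} (Y : TwObj A.Sig) (X : A.Obj)
    (f : ∀ i, (A.Hom X (SigObj.obj (Y.obj i))).X) : (A.Tw.Hom (A.incl.obj X) Y).X :=
  fun i _ => f i

section total

variable (Y : TwObj (FK.{w, v} k).Sig)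

/-- The complex `X` of a summand `Σ^r X[d]` of a twisted complex. -/
def fkObj (i : Fin Y.n) : FilteredComplex.{w, v} k := SigObj.obj (Y.obj i)

/-- The summand `Σ^r X[d]` of a twisted complex, as a filtered complex. -/
def fkSummand (i : Fin Y.n) : FilteredComplex.{w, v} k :=
  (fkObj Y i).twist (SigObj.r (Y.obj i)) (SigObj.d (Y.obj i)) (SigObj.d (Y.obj i))

/-- An entry of the structure map of a twisted complex, as a linear map. -/
def fkEntry (i j : Fin Y.n) : (fkSummand Y j).X →ₗ[k] (fkSummand Y i).X :=
  fkMap (X := fkObj Y j) (Y := fkObj Y i) (Y.q i j)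

/-- The equation `dq + q² = 0` of a twisted complex, read on the total complex: it says that
`∂ + q` squares to zero. -/
theorem fkEntry_mc (i j : Fin Y.n) : (fkSummand Y i).d ∘ₗ fkEntry Y i j +
    fkEntry Y i j ∘ₗ (fkSummand Y j).d + ∑ c, fkEntry Y i c ∘ₗ fkEntry Y c j = 0 := by
  have h := congrArg (fkMap (X := fkObj Y j) (Y := fkObj Y i)) (Y.q_mc i j)
  refine Eq.trans ?_ h
  refine Eq.trans ?_ (map_add (fkMap (X := fkObj Y j) (Y := fkObj Y i))
    _ _).symm
  refine congrArg₂ (fun x y : (fkSummand Y j).X →ₗ[k] (fkSummand Y i).X => x + y) ?_ ?_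
  · exact (negOnePow_smul_fkMap_d (Y.q_deg i j)).symm
  · exact (map_sum (fkMap (X := fkObj Y j) (Y := fkObj Y i)) (fun c => (FK.{w, v} k).comp
      (A := fkObj Y j) (B := fkObj Y c) (C := fkObj Y i) (Y.q i c) (Y.q c j)) Finset.univ).symm

theorem fkEntry_deg (i j : Fin Y.n) (p : ℤ) (x) (hx : x ∈ (fkSummand Y j).deg p) :
    fkEntry Y i j x ∈ (fkSummand Y i).deg (p + 1) := by
  have h := (Y.q_deg i j).2 _ _ hx
  have e : p - SigObj.d (Y.obj j) + (1 - (SigObj.d (Y.obj i) - SigObj.d (Y.obj j))) =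
    p + 1 - SigObj.d (Y.obj i) := by ring
  rw [e] at h
  exact h

theorem fkEntry_ℓ (i j : Fin Y.n) (x) :
    (fkSummand Y i).ℓ (fkEntry Y i j x) ≤ (fkSummand Y j).ℓ x := by
  have h := (fk_add_ℓ_le (b := 0)).1 (Y.q_ℓ i j) x
  refine (add_le_add_left h ((SigObj.r (Y.obj i) : ℝ) : WithBot ℝ)).trans ?_
  rw [add_assoc, ← WithBot.coe_add]
  refine le_of_eq (congrArg (fun a : ℝ => _ + (a : WithBot ℝ)) ?_)
  ring

/-- The total complex of a twisted complex of filtered complexes. -/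
def fkTotal : FilteredComplex.{w, v} k :=
  total (fkSummand Y) (fkEntry Y) (fkEntry_deg Y)
    (fun i j x => by
      have h := LinearMap.congr_fun (fkEntry_mc Y i j) x
      simpa only [LinearMap.add_apply, LinearMap.comp_apply, LinearMap.sum_apply,
        LinearMap.zero_apply] using h)
    (fkEntry_ℓ Y)

theorem fkTotal_d_apply (x : (fkTotal Y).X) (i : Fin Y.n) :
    (fkTotal Y).d x i = (fkSummand Y i).d (x i) + ∑ j, fkEntry Y i j (x j) :=
  congrArg (_ + ·) (piMat_apply (C := fkSummand Y) (fkEntry Y) x i)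

/-- The projection of the total complex to a summand. -/
def fkProj (i : Fin Y.n) : (fkTotal Y).X →ₗ[k] (fkObj Y i).X :=
  LinearMap.proj (R := k) (φ := fun i => (fkSummand Y i).X) i

/-- The inclusion of a summand in the total complex. -/
def fkIncl (i : Fin Y.n) : (fkObj Y i).X →ₗ[k] (fkTotal Y).X :=
  LinearMap.single k (fun i => (fkSummand Y i).X) i

theorem fkProj_bound (i : Fin Y.n) :
    Bound (X := fkTotal Y) (Y := fkObj Y i) (fkProj Y i) (-SigObj.r (Y.obj i)) := by
  intro x
  have h : (fkObj Y i).ℓ (fkProj Y i x) + ((SigObj.r (Y.obj i) : ℝ) : WithBot ℝ) ≤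
    (fkTotal Y).ℓ x := le_pi_ℓ (C := fkSummand Y) x i
  refine le_trans (le_of_eq ?_) (add_le_add_left h _)
  rw [add_assoc, ← WithBot.coe_add, add_neg_cancel, WithBot.coe_zero, add_zero]

theorem fkProj_mem (i : Fin Y.n) : fkProj Y i ∈
    homDeg (fkTotal Y) (fkObj Y i) (0 - (SigObj.d (Y.obj i) - 0)) := by
  refine ⟨⟨_, fkProj_bound Y i⟩, fun p x hx => ?_⟩
  have h : fkProj Y i x ∈ (fkObj Y i).deg (p - SigObj.d (Y.obj i)) := hx i trivial
  rwa [show p + (0 - (SigObj.d (Y.obj i) - 0)) = p - SigObj.d (Y.obj i) by ring]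

theorem fkIncl_bound (i : Fin Y.n) :
    Bound (X := fkObj Y i) (Y := fkTotal Y) (fkIncl Y i) (SigObj.r (Y.obj i)) := by
  intro x
  refine (pi_ℓ_le (C := fkSummand Y)).2 fun j => ?_
  by_cases h : j = i
  · subst h
    refine le_of_eq (congrArg (fkSummand Y j).ℓ ?_)
    exact Pi.single_eq_same (M := fun i => (fkSummand Y i).X) j x
  · refine (le_of_eq (congrArg (fkSummand Y j).ℓ ?_)).trans (ℓ_zero.trans_le bot_le)
    exact Pi.single_eq_of_ne (M := fun i => (fkSummand Y i).X) h x

theorem fkIncl_mem (i : Fin Y.n) : fkIncl Y i ∈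
    homDeg (fkObj Y i) (fkTotal Y) (0 - (0 - SigObj.d (Y.obj i))) := by
  refine ⟨⟨_, fkIncl_bound Y i⟩, fun p x hx j _ => ?_⟩
  by_cases h : j = i
  · subst h
    have e : p + (0 - (0 - SigObj.d (Y.obj j))) - SigObj.d (Y.obj j) = p := by ring
    have h' : fkIncl Y j x j = x := Pi.single_eq_same (M := fun i => (fkSummand Y i).X) j x
    rw [SetLike.mem_coe]
    change fkIncl Y j x j ∈ (fkObj Y j).deg
      (p + (0 - (0 - SigObj.d (Y.obj j))) - SigObj.d (Y.obj j))
    rw [e, h']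
    exact hx
  · have h' : fkIncl Y i x j = 0 := Pi.single_eq_of_ne (M := fun i => (fkSummand Y i).X) h x
    rw [SetLike.mem_coe, h']
    exact Submodule.zero_mem _

/-- The projection of the total complex to a summand, as a morphism. -/
def fkProjHom (i : Fin Y.n) : ((FK.{w, v} k).Hom (fkTotal Y) (fkObj Y i)).X :=
  fkHom (fkProj Y i) (fkProj_mem Y i)

/-- The inclusion of a summand in the total complex, as a morphism. -/
def fkInclHom (i : Fin Y.n) : ((FK.{w, v} k).Hom (fkObj Y i) (fkTotal Y)).X :=
  fkHom (fkIncl Y i) (fkIncl_mem Y i)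

/-- The isomorphism from the total complex to the twisted complex. -/
def fkFromTotal : ((FK.{w, v} k).Tw.Hom ((FK.{w, v} k).incl.obj (fkTotal Y)) Y).X :=
  fromIncl Y (fkTotal Y) (fkProjHom Y)

/-- The isomorphism from the twisted complex to the total complex. -/
def fkToTotal : ((FK.{w, v} k).Tw.Hom Y ((FK.{w, v} k).incl.obj (fkTotal Y))).X :=
  toIncl Y (fkTotal Y) (fkInclHom Y)

theorem fkFromTotal_gr : fkFromTotal Y ∈
    ((FK.{w, v} k).Tw.Hom ((FK.{w, v} k).incl.obj (fkTotal Y)) Y).gr 0 0 := by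
  refine ⟨mat_mem_deg.2 fun i j => fkProj_mem Y i, mat_ℓ_le.2 fun i j => ?_⟩
  refine (fk_add_ℓ_le (X := fkTotal Y) (Y := fkObj Y i) (a := SigObj.r (Y.obj i) - 0)
    (b := 0)).2 ((fkProj_bound Y i).mono (le_of_eq ?_))
  ring

theorem fkToTotal_gr : fkToTotal Y ∈
    ((FK.{w, v} k).Tw.Hom Y ((FK.{w, v} k).incl.obj (fkTotal Y))).gr 0 0 := by
  refine ⟨mat_mem_deg.2 fun i j => fkIncl_mem Y j, mat_ℓ_le.2 fun i j => ?_⟩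
  refine (fk_add_ℓ_le (X := fkObj Y j) (Y := fkTotal Y) (a := 0 - SigObj.r (Y.obj j))
    (b := 0)).2 ((fkIncl_bound Y j).mono (le_of_eq ?_))
  ring

/-- The projections to the summands are the entries of a closed morphism from the total complex to
the twisted complex. -/
theorem fkProj_d (i : Fin Y.n) : (((SigObj.d (Y.obj i)).negOnePow : ℤ) : k) •
      ((fkObj Y i).d ∘ₗ fkProj Y i -
        (0 - (SigObj.d (Y.obj i) - 0)).negOnePow • (fkProj Y i ∘ₗ (fkTotal Y).d)) +
      ∑ c, fkMap (X := fkObj Y c) (Y := fkObj Y i) (Y.q i c) ∘ₗ fkProj Y c = 0 := by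
  have e : fkProj Y i ∘ₗ (fkTotal Y).d = (((SigObj.d (Y.obj i)).negOnePow : ℤ) : k) •
      ((fkObj Y i).d ∘ₗ fkProj Y i) +
      ∑ c, fkMap (X := fkObj Y c) (Y := fkObj Y i) (Y.q i c) ∘ₗ fkProj Y c := by
    refine LinearMap.ext fun x => (fkTotal_d_apply Y x i).trans ?_
    refine congrArg₂ (fun x y : (fkObj Y i).X => x + y) rfl ?_
    exact (LinearMap.sum_apply Finset.univ
      (fun c => fkMap (X := fkObj Y c) (Y := fkObj Y i) (Y.q i c) ∘ₗ fkProj Y c) x).symm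
  rw [e, sub_zero, zero_sub, Int.negOnePow_neg, negOnePow_smul' (k := k), smul_add, smul_smul,
    sign_mul_self, one_smul, sub_add_cancel_left, smul_neg, smul_smul, sign_mul_self, one_smul,
    neg_add_cancel]

theorem fkFromTotal_entry_closed (i : Fin Y.n) :
    (((SigObj.d (Y.obj i)).negOnePow : ℤ) : k) •
      ((FK.{w, v} k).Hom (fkTotal Y) (fkObj Y i)).d (fkProjHom Y i) +
    ∑ c, (FK.{w, v} k).comp (A := fkTotal Y) (B := fkObj Y c) (C := fkObj Y i) (Y.q i c)
      (fkProjHom Y c) = 0 := by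
  refine fk_ext (Eq.trans ?_ (fkProj_d Y i))
  rw [map_add, map_smul, map_sum, fkMap_d (fkProj_mem Y i)]
  rfl

theorem fkFromTotal_closed :
    ((FK.{w, v} k).Tw.Hom ((FK.{w, v} k).incl.obj (fkTotal Y)) Y).d (fkFromTotal Y) = 0 := by
  funext i j
  refine (TwObj.D_apply_of_mem (fkFromTotal_gr Y).1 i j).trans ?_
  refine (sub_eq_self.2 ?_).trans (fkFromTotal_entry_closed Y i)
  rw [Int.negOnePow_zero, one_smul]
  exact Finset.sum_eq_zero fun _ _ => map_zero _

end total

theorem fkTotal_hom_inv_id (Y : TwObj (FK.{w, v} k).Sig) :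
    (FK.{w, v} k).Tw.comp (fkToTotal Y) (fkFromTotal Y) =
        (FK.{w, v} k).Tw.id ((FK.{w, v} k).incl.obj (fkTotal Y)) := by
  funext a b
  obtain rfl : a = b := Subsingleton.elim (α := Fin 1) a b
  have h : ∑ c, (FK.{w, v} k).comp (A := fkTotal Y) (B := fkObj Y c) (C := fkTotal Y)
      (fkInclHom Y c) (fkProjHom Y c) = (FK.{w, v} k).id (fkTotal Y) := by
    refine fk_ext ((map_sum fkMap _ _).trans ?_)
    refine LinearMap.ext fun x => (LinearMap.sum_apply _ _ _).trans ?_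
    exact LinearMap.sum_single_apply (fun i => (fkSummand Y i).X) x
  exact h.trans (congrFun (congrFun ((FK.{w, v} k).incl.map_id (fkTotal Y)) a) a)

theorem fkTotal_inv_hom_id (Y : TwObj (FK.{w, v} k).Sig) :
    (FK.{w, v} k).Tw.comp (fkFromTotal Y) (fkToTotal Y) = (FK.{w, v} k).Tw.id Y := by
  funext i j
  have h : ((FK.{w, v} k).Tw.comp (fkFromTotal Y) (fkToTotal Y)) i j =
      (FK.{w, v} k).comp (A := fkObj Y j) (B := fkTotal Y) (C := fkObj Y i)
      (fkProjHom Y i) (fkInclHom Y j) := Fintype.sum_subsingleton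
        (fun c : Fin 1 => (FK.{w, v} k).comp (A := fkObj Y j) (B := fkTotal Y) (C := fkObj Y i)
          (fkProjHom Y i) (fkInclHom Y j)) 0
  refine h.trans ?_
  by_cases hij : i = j
  · subst hij
    refine Eq.trans ?_ (matOne_self _).symm
    refine fk_ext (LinearMap.ext fun x => ?_)
    exact Pi.single_eq_same (M := fun i => (fkSummand Y i).X) i x
  · refine Eq.trans ?_ (matOne_ne hij).symm
    refine fk_ext (LinearMap.ext fun x => ?_)
    exact Pi.single_eq_of_ne (M := fun i => (fkSummand Y i).X) hij x

theorem fk_isPretriangulated : (FK.{w, v} k).IsPretriangulated := by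
  refine ⟨fun X Y => ⟨Function.bijective_iff_has_inverse.2 ⟨entry, entry_incl_map,
    incl_map_entry⟩, fun f => ?_⟩, fun Y => ⟨fkTotal Y, ?_⟩⟩
  · exact incl_map_ℓ f
  · have h1 := fkTotal_hom_inv_id Y
    have h2 := fkTotal_inv_hom_id Y
    refine ⟨fkFromTotal Y, mem_cocycles_iff.2 ⟨fkFromTotal_gr Y, fkFromTotal_closed Y⟩,
      fkToTotal Y, mem_cocycles_iff.2 ⟨fkToTotal_gr Y, ?_⟩, h1, h2⟩
    -- the inverse of a closed isomorphism is closed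
    have h := d_comp_of_closed (fkFromTotal_gr Y) (fkFromTotal_closed Y) (fkToTotal Y)
    rw [h2, FilteredDGCat.id_closed, Int.negOnePow_zero, one_smul] at h
    have h' := congrArg ((FK.{w, v} k).Tw.comp (fkToTotal Y)) h
    rw [← FilteredDGCat.assoc, h1, FilteredDGCat.id_comp, map_zero] at h'
    exact h'.symm

end FilteredDGCat

/-! ### The strict structure on filtered complexes -/

namespace FilteredComplex

variable {k : Type w} [Field k]

theorem mk_congr {X : Type v} [AddCommGroup X] [Module k X] {deg deg' : ℤ → Submodule k X}
    {d d' : X →ₗ[k] X} {ℓ ℓ' : X → WithBot ℝ} {h₁ h₁' h₂ h₂' h₃ h₃' h₄ h₄' h₅ h₅' h₆ h₆' h₇ h₇'}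
    (hdeg : deg = deg') (hd : d = d') (hℓ : ℓ = ℓ') :
    (⟨X, deg, h₁, d, h₂, h₃, ℓ, h₄, h₅, h₆, h₇⟩ : FilteredComplex.{w, v} k) =
      ⟨X, deg', h₁', d', h₂', h₃', ℓ', h₄', h₅', h₆', h₇'⟩ := by
  subst hdeg hd hℓ
  rfl

theorem shift_zero (X : FilteredComplex.{w, v} k) : X.shift 0 0 = X := by
  refine mk_congr (funext fun n => ?_) ?_ (funext fun x => ?_)
  · rw [sub_zero]
  · rw [Int.negOnePow_zero, Units.val_one, Int.cast_one, one_smul]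
  · exact add_zero _

theorem shift_shift (X : FilteredComplex.{w, v} k) (r s : ℝ) (m n : ℤ) :
    (X.shift s n).shift r m = X.shift (r + s) (m + n) := by
  refine mk_congr (funext fun p => ?_) ?_ (funext fun x => ?_)
  · exact congrArg X.deg (by ring)
  · change ((m.negOnePow : ℤ) : k) • ((n.negOnePow : ℤ) : k) • X.d = _
    rw [smul_smul, ← Int.cast_mul, ← Units.val_mul, ← Int.negOnePow_add]
  · change X.ℓ x + (s : WithBot ℝ) + (r : WithBot ℝ) = _
    rw [add_comm r s, WithBot.coe_add, add_assoc]

theorem shift_bijective : Function.Bijective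
    fun X : FilteredComplex.{w, v} k => X.shift 0 (-1) := by
  refine Function.bijective_iff_has_inverse.2 ⟨fun X => X.shift 0 1, fun X => ?_, fun X => ?_⟩
  · refine (shift_shift X 0 0 1 (-1)).trans ?_
    rw [add_neg_cancel, add_zero, shift_zero]
  · refine (shift_shift X 0 0 (-1) 1).trans ?_
    rw [neg_add_cancel, add_zero, shift_zero]

theorem shift_shift_comm (X : FilteredComplex.{w, v} k) (r s : ℝ) (m n : ℤ) :
    (X.shift s n).shift r m = (X.shift r m).shift s n := by
  rw [shift_shift, shift_shift, add_comm r, add_comm m]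

end FilteredComplex

namespace FilteredDGCat

open FilteredComplex Shifts

variable {k : Type w} [Field k]

/-- Morphisms into two equal filtered complexes with the same underlying vector space agree if their
underlying linear maps do. -/
theorem fk_heq_of_mk {X : FilteredComplex.{w, v} k} {V : Type v} {_ : AddCommGroup V}
    {_ : Module k V} {deg deg' : ℤ → Submodule k V} {d d' : V →ₗ[k] V} {ℓ ℓ' : V → WithBot ℝ}
    {h₁ h₁' h₂ h₂' h₃ h₃' h₄ h₄' h₅ h₅' h₆ h₆' h₇ h₇'}
    (h : (⟨V, deg, h₁, d, h₂, h₃, ℓ, h₄, h₅, h₆, h₇⟩ : FilteredComplex.{w, v} k) =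
      ⟨V, deg', h₁', d', h₂', h₃', ℓ', h₄', h₅', h₆', h₇'⟩) (g : X.X →ₗ[k] V)
    {f : ((FK.{w, v} k).Hom X ⟨V, deg, h₁, d, h₂, h₃, ℓ, h₄, h₅, h₆, h₇⟩).X}
    {f' : ((FK.{w, v} k).Hom X ⟨V, deg', h₁', d', h₂', h₃', ℓ', h₄', h₅', h₆', h₇'⟩).X}
    (hf : fkMap f = g) (hf' : fkMap f' = g) : HEq f f' := by
  cases h
  exact heq_of_eq (fk_ext (hf.trans hf'.symm))

theorem id_mem_homDeg_shift (X : FilteredComplex.{w, v} k) (r : ℝ) (m : ℤ) :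
    (LinearMap.id : X.X →ₗ[k] X.X) ∈ homDeg X (X.shift r m) m := by
  refine ⟨⟨r, fun x => le_rfl⟩, fun p x hx => ?_⟩
  change x ∈ X.deg (p + m - m)
  rwa [add_sub_cancel_right]

theorem bound_id_shift (X : FilteredComplex.{w, v} k) (r : ℝ) (m : ℤ) :
    Bound (X := X.shift r m) (Y := X) (LinearMap.id : X.X →ₗ[k] X.X) (-r) := fun x => by
  change X.ℓ x ≤ X.ℓ x + (r : WithBot ℝ) + _
  rw [add_assoc, ← WithBot.coe_add, add_neg_cancel, WithBot.coe_zero, add_zero]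

theorem id_mem_homDeg_unshift (X : FilteredComplex.{w, v} k) (r : ℝ) (m : ℤ) :
    (LinearMap.id : X.X →ₗ[k] X.X) ∈ homDeg (X.shift r m) X (-m) :=
  ⟨⟨_, bound_id_shift X r m⟩, fun _ _ hx => hx⟩

/-- The identity map of a filtered complex, as a closed isomorphism onto a shifted copy. -/
def shiftTwist (X : FilteredComplex.{w, v} k) (r : ℝ) (m : ℤ) :
    Twist (FK.{w, v} k) X (X.shift r m) r m where
  hom := fkHom _ (id_mem_homDeg_shift X r m)
  inv := fkHom _ (id_mem_homDeg_unshift X r m)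
  hom_mem := ⟨id_mem_homDeg_shift X r m, fk_ℓ_le.2 fun x => le_rfl⟩
  inv_mem := ⟨id_mem_homDeg_unshift X r m, fk_ℓ_le.2 (bound_id_shift X r m)⟩
  d_hom := by
    refine fk_ext ((fkMap_d (id_mem_homDeg_shift X r m)).trans ?_)
    rw [negOnePow_smul' (k := k)]
    exact sub_self (((m.negOnePow : ℤ) : k) • X.d)
  d_inv := by
    refine fk_ext ((fkMap_d (id_mem_homDeg_unshift X r m)).trans ?_)
    rw [negOnePow_smul' (k := k), Int.negOnePow_neg]
    have h : X.d - ((m.negOnePow : ℤ) : k) • ((m.negOnePow : ℤ) : k) • X.d = 0 := by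
      rw [smul_smul, sign_mul_self, one_smul, sub_self]
    exact h
  hom_inv := rfl
  inv_hom := rfl

/-- The identity maps present the shifts of filtered complexes as shifted copies. -/
instance : Shifts (FK.{w, v} k) where
  sig r X := X.shift r 0
  tr n X := X.shift 0 (-n)
  su r X := shiftTwist X r 0
  tu n X := shiftTwist X 0 (-n)

instance : HasCones (FK.{w, v} k) := fk_isPretriangulated.hasCones

theorem shiftTwist_zero_heq (X : FilteredComplex.{w, v} k) :
    HEq (shiftTwist X 0 0).hom ((FK.{w, v} k).id X) :=
  fk_heq_of_mk (shift_zero X) LinearMap.id rfl rfl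

/-- Shifting twice is shifting once: all the maps are identities. -/
theorem shiftTwist_comp_heq (X : FilteredComplex.{w, v} k) (r s : ℝ) (m n : ℤ) {a : ℝ} {p : ℤ}
    (h : (X.shift s n).shift r m = X.shift a p) :
    HEq ((FK.{w, v} k).comp (shiftTwist (X.shift s n) r m).hom (shiftTwist X s n).hom)
      (shiftTwist X a p).hom :=
  fk_heq_of_mk (X := X) h LinearMap.id
    (f := (FK.{w, v} k).comp (shiftTwist (X.shift s n) r m).hom (shiftTwist X s n).hom)
    (f' := (shiftTwist X a p).hom) rfl rfl

theorem fk_strictShifts : StrictShifts (FK.{w, v} k) where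
  sig_zero := shift_zero
  su_zero := shiftTwist_zero_heq
  sig_sig r s X := (shift_shift X r s 0 0).trans (congrArg _ (add_zero 0))
  su_su r s X := shiftTwist_comp_heq X r s 0 0 ((shift_shift X r s 0 0).trans
    (congrArg _ (add_zero 0)))
  tr_bijective := shift_bijective
  sig_tr r X := shift_shift_comm X r 0 0 (-1)
  su_tu r X := (shiftTwist_comp_heq X r 0 0 (-1) (shift_shift X r 0 0 (-1))).trans
    (shiftTwist_comp_heq X 0 r (-1) 0 ((shift_shift_comm X 0 r (-1) 0).trans
      (shift_shift X r 0 0 (-1)))).symm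

theorem fk_isStandardFK : IsStandardFK (tpc (FK.{w, v} k)) := by
  refine ⟨fun r X => rfl, fun r s X => ?_, fun X => rfl⟩
  obtain ⟨φ, h, h'⟩ := exists_isClass_η (B := FK.{w, v} k) r s (X := X) rfl rfl HEq.rfl
  exact ⟨φ, _, rfl, h, h'⟩

end FilteredDGCat

end

theorem proposition6p6 (k : Type w) [Field k] :
    -- `H^0(Tw(A))` is a triangulated persistence category
    (∀ A : FilteredDGCat.{w, u, v} k, ∃ S : TPC A.Tw.H0,
      S.IsStrict ∧ FilteredDGCat.IsStandard S) ∧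
    -- `H^0(A)` is one if `A` is filtered pre-triangulated
    (∀ A : FilteredDGCat.{w, u, v} k, A.IsPretriangulated → Nonempty (TPC A.H0)) ∧
    -- filtered cochain complexes
    (FK.{w, v} k).IsPretriangulated ∧
    (∃ S : TPC (FK.{w, v} k).H0, S.IsStrict ∧ FilteredDGCat.IsStandardFK S) :=
  ⟨fun A => ⟨FilteredDGCat.tpc A.Tw, FilteredDGCat.tpc_isStrict (FilteredDGCat.tw_strictShifts A),
      FilteredDGCat.tw_isStandard A⟩,
    fun _ hA => hA.nonempty_tpc, FilteredDGCat.fk_isPretriangulated,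
    FilteredDGCat.tpc (FK.{w, v} k), FilteredDGCat.tpc_isStrict FilteredDGCat.fk_strictShifts,
    FilteredDGCat.fk_isStandardFK⟩
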